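/- Let $N\ge 1$, let $\Omega\subset\mathbb R^N$ be a bounded Lipschitz domain with boundary $\Gamma$, and let $T>0$. Write $(\cdot,\cdot)$, $\|\cdot\|$ for the inner product and norm of $L^2(\Omega)$ (scalar or vector valued) and $(\cdot,\cdot)_\Gamma$ for the inner product of $L^2(\Gamma)$. Let $f=f(x,t,r,p)$ be a measurable function of $x\in\Omega$, $r\in\mathbb R$, $p\in\mathbb R^N$ for each $t\in[0,T]$, and let $f$ be bounded on $\Omega\times[0,T]\times\mathbb R\times\mathbb R^N$. Let $g\in C([0,T];L^2(\Gamma))$, $h\in C([0,T];L^2(\Omega))$ with $\min_{t\in[0,T]}|(h(t),1)|\ge\omega>0$, $u_0\in H^1(\Omega)$ and $m\in C^1([0,T])$. For $n\in\mathbb N$, $n\ge1$, put $\tau=T/n$, $t_i=i\tau$, $z_i=z(t_i)$ for functions $z$ of time, and $\delta z_i=(z_i-z_{i-1})/\tau$ for sequences. Rothe iterates for the step $\tau$ are $u_0$ (given), $u_1,\dots,u_n\in H^1(\Omega)$ and $K_1,\dots,K_n\in\mathbb R$ such that, with $f_i=f(\cdot,t_i,u_i,\nabla u_i)$, for every $1\le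 i\le n$ $$m'_i+(g_i,1)_\Gamma+K_i(h_i,1)+\sum_{k=1}^iK_km_{i-k}\tau=(f_{i-1},1),$$ $$(\delta u_i,\phi)+(\nabla u_i,\nabla\phi)+(g_i,\phi)_\Gamma+K_i(h_i,\phi)+\Big(\sum_{k=1}^iK_ku_{i-k}\tau,\phi\Big)=(f_{i-1},\phi)\qquad\text{for all }\phi\in H^1(\Omega).$$ Then there is $\tau_0>0$ such that Rothe iterates exist for every step $\tau=T/n<\tau_0$ and the following hold. In each of (1)-(4) the constant $C>0$ may depend on the data ($\Omega,T,f,g,h,\omega,u_0,m$), but it does not depend on $n$ and $\tau$, and the estimate holds for all Rothe iterates for all steps $\tau=T/n<\tau_0$. (1) There is $C>0$ such that $$\max_{1\le j\le n}\|u_j\|^2+\sum_{i=1}^n\|\nabla u_i\|^2\tau+\sum_{i=1}^n\|u_i-u_{i-1}\|^2\le C.$$ (2) If $g\in C^1([0,T];L^2(\Gamma))$, there is $C>0$ such that $$\max_{1\le j\le n}\|\nabla u_j\|^2+\sum_{i=1}^n\|\delta u_i\|^2\tau+\sum_{i=1}^n\|\nabla u_i-\nabla u_{i-1}\|^2\le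 C.$$ (3) Suppose that $g\in C^1([0,T];L^2(\Gamma))$, that $h\in C([0,T];H^1(\Omega))$, that $u_0\in H^2(\Omega)$ satisfies the boundary condition at the initial time, $-\nabla u_0\cdot\nu=g(0)$ on $\Gamma$ (that is, $(-\Delta u_0,\phi)=(\nabla u_0,\nabla\phi)+(g(0),\phi)_\Gamma$ for all $\phi\in H^1(\Omega)$), and that $f$ is Lipschitz continuous in all variables. Then $\Delta u_i\in L^2(\Omega)$ and $(-\Delta u_i,\phi)=(\nabla u_i,\nabla\phi)+(g_i,\phi)_\Gamma$ for all $\phi\in H^1(\Omega)$ and $0\le i\le n$, and there is $C>0$ such that $$\text{(i)}\quad\max_{1\le j\le n}\|\Delta u_j\|^2+\sum_{i=1}^n\|\nabla\delta u_i\|^2\tau+\sum_{i=1}^n\|\Delta u_i-\Delta u_{i-1}\|^2\le C,\qquad\text{(ii)}\quad\max_{1\le j\le n}\|\delta u_j\|\le C.$$ (4) Suppose, in addition to the hypotheses of (3), that $h\in C^1([0,T];L^2(\Omega))$ and $m\in C^2([0,T])$, and let $K_0$ be given by $m'_0+(g_0,1)_\Gamma+K_0(h_0,1)=(f_0,1)$.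 Then there is $C>0$ such that $$\sum_{i=1}^j|\delta K_i|^2\tau\le C\qquad\text{for all }1\le j\le n.$$ -/

import Mathlib

open MeasureTheory Set Filter Topology
open scoped ContDiff Gradient InnerProductSpace

noncomputable section

namespace Rothe

/-- The Euclidean space `ℝ^N`. -/
abbrev Eucl (N : ℕ) : Type := EuclideanSpace ℝ (Fin N)

/-- A bounded Lipschitz domain: a bounded, nonempty, connected open set which near each of its
boundary points is, after the choice of a "vertical" unit vector `e`, the set of points lying
strictly above the graph of a Lipschitz function `ψ` of the horizontal component
`x - ⟪e, x⟫ e`. -/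
structure IsLipschitzDomain {N : ℕ} (Ω : Set (Eucl N)) : Prop where
  isOpen : IsOpen Ω
  isConnected : IsConnected Ω
  isBounded : Bornology.IsBounded Ω
  exists_graph : ∀ p ∈ frontier Ω, ∃ (e : Eucl N) (r : ℝ) (k : NNReal) (ψ : Eucl N → ℝ),
    ‖e‖ = 1 ∧ 0 < r ∧ LipschitzWith k ψ ∧
      ∀ x ∈ Metric.ball p r, x ∈ Ω ↔ ψ (x - ⟪e, x⟫_ℝ • e) < ⟪e, x⟫_ℝ

/-- The surface measure of `Γ = ∂Ω`: the `(N-1)`-dimensional Hausdorff measure, normalised so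
that it agrees with Lebesgue measure on `(N-1)`-dimensional subspaces, restricted to `∂Ω`. -/
def surfaceMeasure {N : ℕ} (Ω : Set (Eucl N)) : Measure (Eucl N) :=
  (Measure.euclideanHausdorffMeasure (N - 1)).restrict (frontier Ω)

/-- `L²(Ω)`. -/
abbrev L2 {N : ℕ} (Ω : Set (Eucl N)) : Type :=
  Lp ℝ 2 ((volume : Measure (Eucl N)).restrict Ω)

/-- `L²(Ω; ℝ^N)`. -/
abbrev L2Vec {N : ℕ} (Ω : Set (Eucl N)) : Type :=
  Lp (Eucl N) 2 ((volume : Measure (Eucl N)).restrict Ω)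

/-- `L²(Γ)`. -/
abbrev L2Bdry {N : ℕ} (Ω : Set (Eucl N)) : Type :=
  Lp ℝ 2 (surfaceMeasure Ω)

/-- `φ ∈ C_c^∞(Ω)`. -/
structure IsTestFunction {N : ℕ} (Ω : Set (Eucl N)) (φ : Eucl N → ℝ) : Prop where
  contDiff : ContDiff ℝ ∞ φ
  hasCompactSupport : HasCompactSupport φ
  tsupport_subset : tsupport φ ⊆ Ω

/-- `G ∈ L²(Ω; ℝ^N)` is the weak gradient of `u ∈ L²(Ω)`. -/
def IsWeakGradient {N : ℕ} (Ω : Set (Eucl N)) (u : L2 Ω) (G : L2Vec Ω) : Prop :=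
  ∀ φ : Eucl N → ℝ, IsTestFunction Ω φ →
    ∫ x in Ω, u x • ∇ φ x = - ∫ x in Ω, φ x • G x

lemma IsTestFunction.memLp_gradient {N : ℕ} {Ω : Set (Eucl N)} {φ : Eucl N → ℝ}
    (hφ : IsTestFunction Ω φ) (μ : Measure (Eucl N)) [IsFiniteMeasureOnCompacts μ] :
    MemLp (∇ φ) 2 μ := by
  have hc : Continuous (∇ φ) := by
    have h1 : Continuous (fderiv ℝ φ) := hφ.contDiff.continuous_fderiv (by simp)
    exact (InnerProductSpace.toDual ℝ (Eucl N)).symm.continuous.comp h1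
  refine hc.memLp_of_hasCompactSupport ?_
  exact (hφ.hasCompactSupport.fderiv ℝ).comp_left
    (g := (InnerProductSpace.toDual ℝ (Eucl N)).symm) (map_zero _)

lemma IsTestFunction.memLp {N : ℕ} {Ω : Set (Eucl N)} {φ : Eucl N → ℝ}
    (hφ : IsTestFunction Ω φ) (μ : Measure (Eucl N)) [IsFiniteMeasureOnCompacts μ] :
    MemLp φ 2 μ :=
  hφ.contDiff.continuous.memLp_of_hasCompactSupport hφ.hasCompactSupport

/-- The Sobolev space `H¹(Ω)`, as the space of pairs `(u, ∇u)` with `u ∈ L²(Ω)` having the weak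
gradient `∇u ∈ L²(Ω; ℝ^N)`. It inherits from `L²(Ω) × L²(Ω; ℝ^N)` the norm given by
`‖u‖²_{H¹} = ‖u‖² + ‖∇u‖²`. -/
def H1Submodule {N : ℕ} (Ω : Set (Eucl N)) : Submodule ℝ (WithLp 2 (L2 Ω × L2Vec Ω)) where
  carrier := {v | IsWeakGradient Ω v.fst v.snd}
  zero_mem' := by
    intro φ _
    have h1 : ∫ x in Ω, (0 : L2 Ω) x • ∇ φ x = 0 := by
      rw [integral_eq_zero_of_ae]
      filter_upwards [Lp.coeFn_zero ℝ 2 ((volume : Measure (Eucl N)).restrict Ω)] with x hx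
      rw [hx]; simp
    have h2 : ∫ x in Ω, φ x • (0 : L2Vec Ω) x = 0 := by
      rw [integral_eq_zero_of_ae]
      filter_upwards [Lp.coeFn_zero (Eucl N) 2 ((volume : Measure (Eucl N)).restrict Ω)] with x hx
      rw [hx]; simp
    change ∫ x in Ω, (0 : L2 Ω) x • ∇ φ x = - ∫ x in Ω, φ x • (0 : L2Vec Ω) x
    rw [h1, h2, neg_zero]
  add_mem' := by
    intro a b ha hb φ hφ
    have hg := hφ.memLp_gradient ((volume : Measure (Eucl N)).restrict Ω)
    have hp := hφ.memLp ((volume : Measure (Eucl N)).restrict Ω)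
    have e1 : ∫ x in Ω, (a.fst + b.fst) x • ∇ φ x
        = (∫ x in Ω, a.fst x • ∇ φ x) + ∫ x in Ω, b.fst x • ∇ φ x := by
      refine Eq.trans (integral_congr_ae ?_) (integral_add
        (memLp_one_iff_integrable.1 (hg.smul (Lp.memLp a.fst)))
        (memLp_one_iff_integrable.1 (hg.smul (Lp.memLp b.fst))))
      filter_upwards [Lp.coeFn_add a.fst b.fst] with x hx
      rw [hx]; simp [add_smul]
    have e2 : ∫ x in Ω, φ x • (a.snd + b.snd) x
        = (∫ x in Ω, φ x • a.snd x) + ∫ x in Ω, φ x • b.snd x := by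
      refine Eq.trans (integral_congr_ae ?_) (integral_add
        (memLp_one_iff_integrable.1 ((Lp.memLp a.snd).smul hp))
        (memLp_one_iff_integrable.1 ((Lp.memLp b.snd).smul hp)))
      filter_upwards [Lp.coeFn_add a.snd b.snd] with x hx
      rw [hx]; simp [smul_add]
    change ∫ x in Ω, (a.fst + b.fst) x • ∇ φ x = - ∫ x in Ω, φ x • (a.snd + b.snd) x
    rw [e1, e2, ha φ hφ, hb φ hφ, neg_add]
  smul_mem' := by
    intro c a ha φ hφ
    have e1 : ∫ x in Ω, (c • a.fst) x • ∇ φ x = c • ∫ x in Ω, a.fst x • ∇ φ x := by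
      rw [← integral_smul]
      refine integral_congr_ae ?_
      filter_upwards [Lp.coeFn_smul c a.fst] with x hx
      rw [hx, Pi.smul_apply, smul_assoc]
    have e2 : ∫ x in Ω, φ x • (c • a.snd) x = c • ∫ x in Ω, φ x • a.snd x := by
      rw [← integral_smul]
      refine integral_congr_ae ?_
      filter_upwards [Lp.coeFn_smul c a.snd] with x hx
      rw [hx, Pi.smul_apply, smul_comm]
    change ∫ x in Ω, (c • a.fst) x • ∇ φ x = - ∫ x in Ω, φ x • (c • a.snd) x
    rw [e1, e2, ha φ hφ, smul_neg]

/-- The Hilbert space `H¹(Ω)`. -/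
abbrev H1 {N : ℕ} (Ω : Set (Eucl N)) : Type := H1Submodule Ω

/-- The function underlying an element of `H¹(Ω)`. -/
def H1.fn {N : ℕ} {Ω : Set (Eucl N)} (u : H1 Ω) : L2 Ω := u.1.fst

/-- The weak gradient of an element of `H¹(Ω)`. -/
def H1.grad {N : ℕ} {Ω : Set (Eucl N)} (u : H1 Ω) : L2Vec Ω := u.1.snd

/-- `u ∈ H²(Ω)`: every weak partial derivative of `u ∈ H¹(Ω)` lies in `H¹(Ω)`. -/
def IsH2 {N : ℕ} {Ω : Set (Eucl N)} (u : H1 Ω) : Prop :=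
  ∀ i : Fin N, ∃ v : H1 Ω, ∀ᵐ x ∂((volume : Measure (Eucl N)).restrict Ω), v.fn x = u.grad x i

/-- `w ∈ L²(Γ)` is the trace of `u ∈ H¹(Ω)`: there are functions smooth up to the boundary that
converge to `u` in `H¹(Ω)` and whose restrictions to `Γ` converge to `w` in `L²(Γ)`. -/
def HasTrace {N : ℕ} {Ω : Set (Eucl N)} (u : H1 Ω) (w : L2Bdry Ω) : Prop :=
  ∃ φ : ℕ → Eucl N → ℝ, (∀ k, ContDiff ℝ ∞ (φ k)) ∧
    Tendsto (fun k => eLpNorm (fun x => φ k x - u.fn x) 2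
      ((volume : Measure (Eucl N)).restrict Ω)) atTop (𝓝 0) ∧
    Tendsto (fun k => eLpNorm (fun x => ∇ (φ k) x - u.grad x) 2
      ((volume : Measure (Eucl N)).restrict Ω)) atTop (𝓝 0) ∧
    Tendsto (fun k => eLpNorm (fun x => φ k x - w x) 2 (surfaceMeasure Ω)) atTop (𝓝 0)

/-- `L = Δu` in `L²(Ω)`, where in addition `-∇u ⋅ ν = g` weakly on `Γ`, that is
`(-Δu, φ) = (∇u, ∇φ) + (g, φ)_Γ` for all `φ ∈ H¹(Ω)`. -/
structure IsLaplacianWithFlux {N : ℕ} {Ω : Set (Eucl N)} (u : H1 Ω) (g : L2Bdry Ω) (L : L2 Ω) :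
    Prop where
  weak_laplacian : ∀ φ : Eucl N → ℝ, IsTestFunction Ω φ →
    ∫ x in Ω, L x * φ x = - ∫ x in Ω, ⟪u.grad x, ∇ φ x⟫_ℝ
  green : ∀ (φ : H1 Ω) (w : L2Bdry Ω), HasTrace φ w →
    -⟪L, φ.fn⟫_ℝ = ⟪u.grad, φ.grad⟫_ℝ + ⟪g, w⟫_ℝ

/-- The Neumann condition `-∇u ⋅ ν = g` on `Γ`, in the weak sense, for `u` with `Δu ∈ L²(Ω)`. -/
def SatisfiesNeumann {N : ℕ} {Ω : Set (Eucl N)} (u : H1 Ω) (g : L2Bdry Ω) : Prop :=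
  ∃ L : L2 Ω, IsLaplacianWithFlux u g L

/-- The backward difference quotient `δz_i = (z_i - z_{i-1}) / τ` (used for `i ≥ 1`). -/
def bdiff {X : Type*} [AddCommGroup X] [Module ℝ X] (τ : ℝ) (z : ℕ → X) (i : ℕ) : X :=
  τ⁻¹ • (z i - z (i - 1))

/-- The superposition `x ↦ f(x, t, u(x), ∇u(x))`. -/
def superpos {N : ℕ} {Ω : Set (Eucl N)} (f : Eucl N → ℝ → ℝ → Eucl N → ℝ) (t : ℝ) (u : H1 Ω) :
    Eucl N → ℝ :=
  fun x => f x t (u.fn x) (u.grad x)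

/-- The Rothe iterates `u_0, …, u_n`, `K_1, …, K_n` for the step `τ = T / n`: `u_0` is the given
initial value, and for `1 ≤ i ≤ n`, with `t_i = i τ`,
`m'(t_i) + (g_i, 1)_Γ + K_i (h_i, 1) + ∑_{k=1}^i K_k m_{i-k} τ = (f_{i-1}, 1)` and
`(δu_i, φ) + (∇u_i, ∇φ) + (g_i, φ)_Γ + K_i (h_i, φ) + (∑_{k=1}^i K_k u_{i-k} τ, φ) = (f_{i-1}, φ)`
for all `φ ∈ H¹(Ω)`. Other values of the sequences play no role. -/
structure IsRotheIterate {N : ℕ} {Ω : Set (Eucl N)} (T : ℝ)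
    (f : Eucl N → ℝ → ℝ → Eucl N → ℝ) (g : ℝ → L2Bdry Ω) (h : ℝ → L2 Ω) (u₀ : H1 Ω) (m : ℝ → ℝ)
    (n : ℕ) (τ : ℝ) (K : ℕ → ℝ) (u : ℕ → H1 Ω) : Prop where
  step : τ = T / n
  init : u 0 = u₀
  measured : ∀ i ∈ Finset.Icc 1 n,
    derivWithin m (Icc 0 T) (i * τ) + (∫ x, g (i * τ) x ∂(surfaceMeasure Ω))
        + K i * (∫ x in Ω, h (i * τ) x)
        + ∑ k ∈ Finset.Icc 1 i, K k * m (((i - k : ℕ) : ℝ) * τ) * τ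
      = ∫ x in Ω, superpos f (((i - 1 : ℕ) : ℝ) * τ) (u (i - 1)) x
  weak : ∀ i ∈ Finset.Icc 1 n, ∀ (φ : H1 Ω) (w : L2Bdry Ω), HasTrace φ w →
    ⟪(bdiff τ u i).fn, φ.fn⟫_ℝ + ⟪(u i).grad, φ.grad⟫_ℝ + ⟪g (i * τ), w⟫_ℝ
        + K i * ⟪h (i * τ), φ.fn⟫_ℝ
        + ⟪∑ k ∈ Finset.Icc 1 i, (K k * τ) • (u (i - k)).fn, φ.fn⟫_ℝ
      = ∫ x in Ω, superpos f (((i - 1 : ℕ) : ℝ) * τ) (u (i - 1)) x * φ.fn x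

/-- The defining equation of the initial kernel value `K_0`:
`m'(0) + (g_0, 1)_Γ + K_0 (h_0, 1) = (f_0, 1)`. -/
def IsInitialKernel {N : ℕ} {Ω : Set (Eucl N)} (T : ℝ)
    (f : Eucl N → ℝ → ℝ → Eucl N → ℝ) (g : ℝ → L2Bdry Ω) (h : ℝ → L2 Ω) (u₀ : H1 Ω) (m : ℝ → ℝ)
    (K₀ : ℝ) : Prop :=
  derivWithin m (Icc 0 T) 0 + (∫ x, g 0 x ∂(surfaceMeasure Ω)) + K₀ * (∫ x in Ω, h 0 x)
    = ∫ x in Ω, superpos f 0 u₀ x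

/-- `h ∈ C([0,T]; H¹(Ω))` for `h` with values in `L²(Ω)`. -/
def ContinuousInH1 {N : ℕ} {Ω : Set (Eucl N)} (T : ℝ) (h : ℝ → L2 Ω) : Prop :=
  ∃ H : ℝ → H1 Ω, ContinuousOn H (Icc 0 T) ∧ ∀ t ∈ Icc 0 T, (H t).fn = h t

/-- `f` is Lipschitz continuous in all variables on `Ω × [0,T] × ℝ × ℝ^N`. -/
def LipschitzInAll {N : ℕ} (Ω : Set (Eucl N)) (T : ℝ) (f : Eucl N → ℝ → ℝ → Eucl N → ℝ) : Prop :=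
  ∃ L : ℝ, ∀ x ∈ Ω, ∀ y ∈ Ω, ∀ t ∈ Icc 0 T, ∀ s ∈ Icc 0 T, ∀ (r q : ℝ) (p p' : Eucl N),
    |f x t r p - f y s q p'| ≤ L * (‖x - y‖ + |t - s| + |r - q| + ‖p - p'‖)

end Rothe

end

open Rothe

/-! The two equations decouple. In the measured equation of step `i + 1` the unknown `K (i + 1)`
occurs with coefficient `(h, 1) + m 0 * τ`, whose absolute value is at least `κ / 2` once `τ <
stepBound κ m`; the rest involves only earlier kernel values and bounded data, because `f` is
bounded. Discrete Gronwall therefore bounds all `K i` before anything is known about the `u i`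
(`RotheAssumptions.exists_kernel_bound`). The convolution `∑ K_k u_{i-k} τ` uses only earlier
iterates, so once `K (i + 1)` is known the weak equation is a linear elliptic problem, solved by
Lax–Milgram (`exists_isEulerStep`, `RotheAssumptions.exists_isRotheIterate`).

The estimates are those of an abstract backward Euler scheme (`IsEulerStep`) with three different
tests. Testing with `u_i` gives the energy bound (`exists_energy_bound`). Testing with `u_i -
u_{i-1}` gives the gradient bound; the boundary term is summed by parts, which costs a Lipschitz
bound on `g` (`exists_gradient_bound`). For the Laplacians, the equation says that `Δu_i` equals
`δu_i` plus a memory term minus the source; pairing this with `Δu_i - Δu_{i-1}` and applying Green's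
formula to differences gives control of `∇δu_i`. The source is summed by parts, and its increments
are absorbed by the `∇δu` term kept from the preceding step (`laplacian_step`,
`exists_laplacian_bound`). Finally, subtracting consecutive measured equations bounds `δK_i` by the
two norms of `δu` and `∇δu` just controlled in square sum
(`RotheAssumptions.exists_kernel_difference_bound`).

Behind all this lies trace theory for Lipschitz domains: `HasTrace` must define a bounded operator
on all of `H¹(Ω)` (`exists_trace_operator`). Existence and boundedness rest on two facts. Functions
smooth up to the boundary are dense (`H1.exists_smooth_tendsto`), shown by duality: an element
orthogonal to all of them is paired with its own inward translates, and the pairing vanishes. The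
trace inequality holds for smooth functions (`trace_inequality_smooth`), by the one-dimensional
fundamental theorem along segments entering the domain, Fubini, and the behaviour of Hausdorff
measure under the Lipschitz graph map. -/

noncomputable section

namespace Rothe

/-! ### The Hilbert space `H¹(Ω)` and its smooth elements. -/

section Sobolev

section LpPairing

variable {α : Type*} [MeasurableSpace α] {μ : Measure α} {E : Type*} [NormedAddCommGroup E]
  [InnerProductSpace ℝ E]

lemma inner_toLp_left {a : α → E} (ha : MemLp a 2 μ) (u : Lp E 2 μ) :
    ⟪ha.toLp a, u⟫_ℝ = ∫ x, ⟪a x, u x⟫_ℝ ∂μ := by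
  rw [L2.inner_def]
  refine integral_congr_ae ?_
  filter_upwards [ha.coeFn_toLp] with x hx
  rw [hx]

lemma integrable_inner_of_memLp {a b : α → E} (ha : MemLp a 2 μ) (hb : MemLp b 2 μ) :
    Integrable (fun x => ⟪a x, b x⟫_ℝ) μ := by
  refine (L2.integrable_inner (𝕜 := ℝ) (ha.toLp a) (hb.toLp b)).congr ?_
  filter_upwards [ha.coeFn_toLp, hb.coeFn_toLp] with x hx hy
  rw [hx, hy]

end LpPairing

variable {N : ℕ} {Ω : Set (Eucl N)}

@[simp] lemma H1.fn_add (u v : H1 Ω) : (u + v).fn = u.fn + v.fn := rfl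
@[simp] lemma H1.fn_sub (u v : H1 Ω) : (u - v).fn = u.fn - v.fn := rfl
@[simp] lemma H1.fn_smul (c : ℝ) (u : H1 Ω) : (c • u).fn = c • u.fn := rfl
@[simp] lemma H1.grad_add (u v : H1 Ω) : (u + v).grad = u.grad + v.grad := rfl
@[simp] lemma H1.grad_sub (u v : H1 Ω) : (u - v).grad = u.grad - v.grad := rfl
@[simp] lemma H1.grad_smul (c : ℝ) (u : H1 Ω) : (c • u).grad = c • u.grad := rfl

lemma H1.inner_eq (u v : H1 Ω) : ⟪u, v⟫_ℝ = ⟪u.fn, v.fn⟫_ℝ + ⟪u.grad, v.grad⟫_ℝ :=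
  WithLp.prod_inner_apply (𝕜 := ℝ) u.1 v.1

lemma H1.norm_sq_eq (u : H1 Ω) : ‖u‖ ^ 2 = ‖u.fn‖ ^ 2 + ‖u.grad‖ ^ 2 :=
  WithLp.prod_norm_sq_eq_of_L2 u.1

/-- `u ↦ u` as a continuous linear map `H¹(Ω) → L²(Ω)`. -/
def H1.fnL : H1 Ω →L[ℝ] L2 Ω :=
  (WithLp.fstL 2 ℝ (L2 Ω) (L2Vec Ω)).comp (H1Submodule Ω).subtypeL

/-- `u ↦ ∇u` as a continuous linear map `H¹(Ω) → L²(Ω; ℝ^N)`. -/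
def H1.gradL : H1 Ω →L[ℝ] L2Vec Ω :=
  (WithLp.sndL 2 ℝ (L2 Ω) (L2Vec Ω)).comp (H1Submodule Ω).subtypeL

@[simp] lemma H1.fnL_apply (u : H1 Ω) : H1.fnL u = u.fn := rfl
@[simp] lemma H1.gradL_apply (u : H1 Ω) : H1.gradL u = u.grad := rfl

lemma integral_inner_const {α : Type*} [MeasurableSpace α] {μ : Measure α} {v : α → Eucl N}
    (hv : Integrable v μ) (c : Eucl N) : ⟪c, ∫ x, v x ∂μ⟫_ℝ = ∫ x, ⟪c, v x⟫_ℝ ∂μ :=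
  (integral_inner hv c).symm

/-- A vector identity holds as soon as it holds against every constant vector `c`. The scalar form
is a statement about `L²` inner products, hence visibly closed under `L²` limits, and it is the form
in which test functions are used below. -/
lemma isWeakGradient_iff (u : L2 Ω) (G : L2Vec Ω) : IsWeakGradient Ω u G ↔
    ∀ φ : Eucl N → ℝ, IsTestFunction Ω φ → ∀ c : Eucl N,
      ∫ x in Ω, u x * ⟪c, ∇ φ x⟫_ℝ = - ∫ x in Ω, φ x * ⟪c, G x⟫_ℝ := by
  refine forall₂_congr fun φ hφ => ?_
  have hg := hφ.memLp_gradient ((volume : Measure (Eucl N)).restrict Ω)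
  have hp := hφ.memLp ((volume : Measure (Eucl N)).restrict Ω)
  have i1 : Integrable (fun x => u x • ∇ φ x) (volume.restrict Ω) :=
    memLp_one_iff_integrable.1 (hg.smul (Lp.memLp u))
  have i2 : Integrable (fun x => φ x • G x) (volume.restrict Ω) :=
    memLp_one_iff_integrable.1 ((Lp.memLp G).smul hp)
  have key : ∀ c : Eucl N, (⟪c, ∫ x in Ω, u x • ∇ φ x⟫_ℝ = ⟪c, - ∫ x in Ω, φ x • G x⟫_ℝ) ↔
      ∫ x in Ω, u x * ⟪c, ∇ φ x⟫_ℝ = - ∫ x in Ω, φ x * ⟪c, G x⟫_ℝ := by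
    intro c
    rw [inner_neg_right, integral_inner_const i1, integral_inner_const i2]
    simp only [inner_smul_right]
  constructor
  · intro h c
    rw [← key, h]
  · intro h
    exact ext_inner_left ℝ fun c => (key c).2 (h c)

/-- For each `φ` and `c` the defining condition equates two continuous functionals of the pair.
Closedness gives completeness of `H¹(Ω)`, needed for Lax–Milgram and for density via orthogonal
complements. -/
lemma isClosed_h1Submodule :
    IsClosed ((H1Submodule Ω : Submodule ℝ (WithLp 2 (L2 Ω × L2Vec Ω))) :
      Set (WithLp 2 (L2 Ω × L2Vec Ω))) := by
  have : ((H1Submodule Ω : Submodule ℝ (WithLp 2 (L2 Ω × L2Vec Ω))) :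
      Set (WithLp 2 (L2 Ω × L2Vec Ω))) = {v | ∀ φ : Eucl N → ℝ, IsTestFunction Ω φ →
      ∀ c : Eucl N, ∫ x in Ω, v.fst x * ⟪c, ∇ φ x⟫_ℝ = - ∫ x in Ω, φ x * ⟪c, v.snd x⟫_ℝ} := by
    ext v
    exact isWeakGradient_iff v.fst v.snd
  rw [this]
  simp only [ofPred_forall]
  refine isClosed_iInter fun φ => isClosed_iInter fun hφ => isClosed_iInter fun c => ?_
  have hg : MemLp (fun x => ⟪c, ∇ φ x⟫_ℝ) 2 ((volume : Measure (Eucl N)).restrict Ω) :=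
    (hφ.memLp_gradient _).const_inner c
  have hp : MemLp (fun x => φ x • c) 2 ((volume : Measure (Eucl N)).restrict Ω) := by
    have := (hφ.memLp ((volume : Measure (Eucl N)).restrict Ω))
    exact ((ContinuousLinearMap.id ℝ ℝ).smulRight c).comp_memLp' this
  have e : {v : WithLp 2 (L2 Ω × L2Vec Ω) |
      ∫ x in Ω, v.fst x * ⟪c, ∇ φ x⟫_ℝ = - ∫ x in Ω, φ x * ⟪c, v.snd x⟫_ℝ}
      = {v | ⟪hg.toLp _, v.fst⟫_ℝ = - ⟪hp.toLp _, v.snd⟫_ℝ} := by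
    ext v
    simp only [mem_ofPred_eq, inner_toLp_left, inner_smul_left]
    simp
  rw [e]
  exact isClosed_eq (continuous_const.inner (WithLp.continuous_fst ..))
    (continuous_const.inner (WithLp.continuous_snd ..)).neg

instance instCompleteSpaceH1 : CompleteSpace (H1 Ω) :=
  isClosed_h1Submodule.completeSpace_coe

lemma continuous_gradient {φ : Eucl N → ℝ} (hφ : ContDiff ℝ ∞ φ) : Continuous (∇ φ) := by
  have h1 : Continuous (fderiv ℝ φ) := hφ.continuous_fderiv (by simp)
  exact (InnerProductSpace.toDual ℝ (Eucl N)).symm.continuous.comp h1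

lemma inner_gradient (φ : Eucl N → ℝ) (c x : Eucl N) : ⟪c, ∇ φ x⟫_ℝ = fderiv ℝ φ x c := by
  rw [real_inner_comm, inner_gradient_left]

lemma memLp_restrict_of_continuous {E : Type*} [NormedAddCommGroup E]
    (hΩ : Bornology.IsBounded Ω) {a : Eucl N → E} (ha : Continuous a) (p : ENNReal)
    (μ : Measure (Eucl N)) [IsFiniteMeasureOnCompacts μ] [SecondCountableTopologyEither (Eucl N) E] :
    MemLp a p (μ.restrict Ω) := by
  have hK : IsCompact (closure Ω) := hΩ.isCompact_closure
  obtain ⟨C, hC⟩ := hK.exists_bound_of_continuousOn ha.continuousOn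
  have : IsFiniteMeasure (μ.restrict (closure Ω)) :=
    ⟨by rw [Measure.restrict_apply_univ]; exact hK.measure_lt_top⟩
  have : MemLp a p (μ.restrict (closure Ω)) := by
    refine MemLp.of_bound ha.aestronglyMeasurable C ?_
    exact (ae_restrict_iff' isClosed_closure.measurableSet).2 (Eventually.of_forall hC)
  exact this.mono_measure (Measure.restrict_mono subset_closure le_rfl)

lemma integral_mul_gradient {φ χ : Eucl N → ℝ} (hφ : ContDiff ℝ ∞ φ) (hχ : ContDiff ℝ ∞ χ)
    (hc : HasCompactSupport χ) (c : Eucl N) :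
    ∫ x, φ x * ⟪c, ∇ χ x⟫_ℝ = - ∫ x, χ x * ⟪c, ∇ φ x⟫_ℝ := by
  simp only [inner_gradient]
  have c1 : Continuous fun x => fderiv ℝ φ x c :=
    (hφ.continuous_fderiv (by simp)).clm_apply continuous_const
  have c2 : Continuous fun x => fderiv ℝ χ x c :=
    (hχ.continuous_fderiv (by simp)).clm_apply continuous_const
  rw [integral_mul_fderiv_eq_neg_fderiv_mul_of_integrable]
  · simp [mul_comm]
  · exact (c1.mul hχ.continuous).integrable_of_hasCompactSupport hc.mul_left
  · exact (hφ.continuous.mul c2).integrable_of_hasCompactSupport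
      (HasCompactSupport.mul_left (hc.fderiv_apply ℝ c))
  · exact (hφ.continuous.mul hχ.continuous).integrable_of_hasCompactSupport hc.mul_left
  · exact fun x _ => hφ.differentiable (by simp) x
  · exact fun x _ => hχ.differentiable (by simp) x

lemma IsTestFunction.gradient_eq_zero {φ : Eucl N → ℝ} (hφ : IsTestFunction Ω φ) {x : Eucl N}
    (hx : x ∉ Ω) : ∇ φ x = 0 := by
  have : fderiv ℝ φ x = 0 := by
    by_contra hne
    exact hx (hφ.tsupport_subset (support_fderiv_subset ℝ hne))
  simp [gradient, this]

lemma IsTestFunction.eq_zero {φ : Eucl N → ℝ} (hφ : IsTestFunction Ω φ) {x : Eucl N}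
    (hx : x ∉ Ω) : φ x = 0 :=
  image_eq_zero_of_notMem_tsupport fun h => hx (hφ.tsupport_subset h)

/-- The element of `H¹(Ω)` given by the restriction to `Ω` of a smooth function. -/
def H1.ofSmooth (hΩ : Bornology.IsBounded Ω) {φ : Eucl N → ℝ} (hφ : ContDiff ℝ ∞ φ) : H1 Ω :=
  ⟨WithLp.toLp 2 ((memLp_restrict_of_continuous hΩ hφ.continuous 2 volume).toLp φ,
    (memLp_restrict_of_continuous hΩ (continuous_gradient hφ) 2 volume).toLp (∇ φ)), by
    refine (isWeakGradient_iff _ _).2 fun χ hχ c => ?_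
    have e1 : ∫ x in Ω, ((memLp_restrict_of_continuous hΩ hφ.continuous 2 volume).toLp φ) x
        * ⟪c, ∇ χ x⟫_ℝ = ∫ x, φ x * ⟪c, ∇ χ x⟫_ℝ := by
      rw [← setIntegral_eq_integral_of_forall_compl_eq_zero (s := Ω) (μ := volume)
        (f := fun x => φ x * ⟪c, ∇ χ x⟫_ℝ) (fun x hx => by rw [hχ.gradient_eq_zero hx]; simp)]
      refine integral_congr_ae ?_
      filter_upwards [MemLp.coeFn_toLp
        (memLp_restrict_of_continuous hΩ hφ.continuous 2 volume)] with x hx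
      rw [hx]
    have e2 : ∫ x in Ω, χ x * ⟪c, ((memLp_restrict_of_continuous hΩ
        (continuous_gradient hφ) 2 volume).toLp (∇ φ)) x⟫_ℝ = ∫ x, χ x * ⟪c, ∇ φ x⟫_ℝ := by
      rw [← setIntegral_eq_integral_of_forall_compl_eq_zero (s := Ω) (μ := volume)
        (f := fun x => χ x * ⟪c, ∇ φ x⟫_ℝ) (fun x hx => by rw [hχ.eq_zero hx]; simp)]
      refine integral_congr_ae ?_
      filter_upwards [MemLp.coeFn_toLp
        (memLp_restrict_of_continuous hΩ (continuous_gradient hφ) 2 volume)] with x hx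
      rw [hx]
    refine e1.trans ((integral_mul_gradient hφ hχ.contDiff hχ.hasCompactSupport c).trans ?_)
    exact congrArg Neg.neg e2.symm⟩

lemma H1.ofSmooth_fn (hΩ : Bornology.IsBounded Ω) {φ : Eucl N → ℝ} (hφ : ContDiff ℝ ∞ φ) :
    (H1.ofSmooth hΩ hφ).fn = (memLp_restrict_of_continuous hΩ hφ.continuous 2 volume).toLp φ := rfl

lemma H1.ofSmooth_grad (hΩ : Bornology.IsBounded Ω) {φ : Eucl N → ℝ} (hφ : ContDiff ℝ ∞ φ) :
    (H1.ofSmooth hΩ hφ).grad =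
      (memLp_restrict_of_continuous hΩ (continuous_gradient hφ) 2 volume).toLp (∇ φ) := rfl

lemma H1.ofSmooth_fn_ae (hΩ : Bornology.IsBounded Ω) {φ : Eucl N → ℝ} (hφ : ContDiff ℝ ∞ φ) :
    (H1.ofSmooth hΩ hφ).fn =ᵐ[volume.restrict Ω] φ :=
  MemLp.coeFn_toLp (memLp_restrict_of_continuous hΩ hφ.continuous 2 volume)

lemma H1.ofSmooth_grad_ae (hΩ : Bornology.IsBounded Ω) {φ : Eucl N → ℝ} (hφ : ContDiff ℝ ∞ φ) :
    (H1.ofSmooth hΩ hφ).grad =ᵐ[volume.restrict Ω] ∇ φ :=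
  MemLp.coeFn_toLp (memLp_restrict_of_continuous hΩ (continuous_gradient hφ) 2 volume)

end Sobolev

/-! ### Density of functions smooth up to the boundary. -/

section Density

section Translation

variable {E F : Type*} [NormedAddCommGroup E] [InnerProductSpace ℝ E] [FiniteDimensional ℝ E]
  [MeasurableSpace E] [BorelSpace E] [NormedAddCommGroup F] [InnerProductSpace ℝ F]

/-- Translation acts continuously on `L²`, and the integral is the inner product of a translate with
a fixed element. -/
lemma continuous_integral_inner_translate {a b : E → F} (ha : MemLp a 2 volume)
    (hb : MemLp b 2 volume) : Continuous fun z : E => ∫ y, ⟪a (y + z), b y⟫_ℝ := by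
  let τ : C(E, C(E, E)) := ContinuousMap.curry ⟨fun p : E × E => p.2 + p.1, by fun_prop⟩
  have hτ : ∀ z, MeasurePreserving (τ z) (volume : Measure E) volume := fun z =>
    measurePreserving_add_right volume z
  have hc : Continuous fun z => Lp.compMeasurePreserving (τ z) (hτ z) (ha.toLp a) :=
    Continuous.compMeasurePreservingLp continuous_const τ.continuous hτ (by simp)
  refine (hc.inner (continuous_const (y := hb.toLp b))).congr fun z => ?_
  rw [L2.inner_def]
  refine integral_congr_ae ?_
  have h1 : (fun y => (ha.toLp a) (y + z)) =ᵐ[volume] fun y => a (y + z) :=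
    (hτ z).quasiMeasurePreserving.ae_eq ha.coeFn_toLp
  filter_upwards [Lp.coeFn_compMeasurePreserving (ha.toLp a) (hτ z), hb.coeFn_toLp, h1]
    with y hy hy' hy''
  rw [hy, hy', ← hy'']
  rfl

lemma integrable_kernel_mul_inner {ρ : E → ℝ} (hρ : Continuous ρ) (hρc : HasCompactSupport ρ)
    {A X : E → F} (hA : Integrable A volume) (hX : Integrable X volume) :
    Integrable (fun p : E × E => ρ (p.2 - p.1) * ⟪A p.2, X p.1⟫_ℝ)
      ((volume : Measure E).prod volume) := by
  obtain ⟨C, hC⟩ := hρc.exists_bound_of_continuous hρ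
  have h1 : Integrable (fun p : E × E => ⟪A p.2, X p.1⟫_ℝ) ((volume : Measure E).prod volume) := by
    refine ((hA.norm.mul_prod hX.norm).swap).mono'
      (hA.aestronglyMeasurable.comp_snd.inner hX.aestronglyMeasurable.comp_fst)
      (Eventually.of_forall fun p => ?_)
    exact norm_inner_le_norm _ _
  refine h1.bdd_mul (c := C) ?_ (Eventually.of_forall fun p => hC _)
  exact (hρ.comp (by fun_prop)).aestronglyMeasurable

lemma integrable_mul_inner_kernel {κ : E → F} (hκ : Continuous κ) (hκc : HasCompactSupport κ)
    {a : E → ℝ} {X : E → F} (ha : Integrable a volume) (hX : Integrable X volume) :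
    Integrable (fun p : E × E => a p.2 * ⟪κ (p.2 - p.1), X p.1⟫_ℝ)
      ((volume : Measure E).prod volume) := by
  obtain ⟨C, hC⟩ := hκc.exists_bound_of_continuous hκ
  refine (((ha.norm.mul_prod hX.norm).swap).const_mul C).mono'
    (ha.aestronglyMeasurable.comp_snd.mul
      ((hκ.comp_aestronglyMeasurable ?_).inner hX.aestronglyMeasurable.comp_fst))
    (Eventually.of_forall fun p => ?_)
  · exact (by fun_prop : Continuous fun p : E × E => p.2 - p.1).aestronglyMeasurable
  · simp only [Function.comp, Prod.fst_swap, Prod.snd_swap, norm_mul]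
    have h1 := norm_inner_le_norm (𝕜 := ℝ) (κ (p.2 - p.1)) (X p.1)
    have h2 : ‖κ (p.2 - p.1)‖ * ‖X p.1‖ ≤ C * ‖X p.1‖ := by gcongr; exact hC _
    calc ‖a p.2‖ * ‖⟪κ (p.2 - p.1), X p.1⟫_ℝ‖ ≤ ‖a p.2‖ * (C * ‖X p.1‖) := by
          gcongr; exact h1.trans h2
      _ = C * (‖a p.2‖ * ‖X p.1‖) := by ring

/-- If the mollified pairings of `(a, A)` and `(b, B)` vanish for all kernels supported in an open
set which accumulates at `0`, then so does the pairing itself. -/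
lemma integral_pairing_eq_zero_of_kernel {S : Set E} (hS : IsOpen S) (h0 : (0 : E) ∈ closure S)
    {a b : E → ℝ} {A B : E → F} (ha : MemLp a 2 volume) (hb : MemLp b 2 volume)
    (hA : MemLp A 2 volume) (hB : MemLp B 2 volume) (ha' : Integrable a volume)
    (hb' : Integrable b volume) (hA' : Integrable A volume) (hB' : Integrable B volume)
    (h : ∀ ρ : E → ℝ, ContDiff ℝ ∞ ρ → HasCompactSupport ρ → tsupport ρ ⊆ S →
      ∫ y, ∫ x, ρ (x - y) * (⟪a x, b y⟫_ℝ + ⟪A x, B y⟫_ℝ) = 0) :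
    ∫ y, (⟪a y, b y⟫_ℝ + ⟪A y, B y⟫_ℝ) = 0 := by
  -- `Φ z` pairs the `z`-translate with the original. The hypothesis says that `Φ` integrates to
  -- zero against every kernel in `S`, so `Φ` vanishes on `S`, and by continuity at `0 ∈ closure S`,
  -- where it is the untranslated pairing.
  set Φ : E → ℝ := fun z => (∫ y, ⟪a (y + z), b y⟫_ℝ) + ∫ y, ⟪A (y + z), B y⟫_ℝ with hΦ
  have hΦc : Continuous Φ :=
    (continuous_integral_inner_translate ha hb).add (continuous_integral_inner_translate hA hB)
  have hmp : ∀ z : E, MeasurePreserving (fun y : E => y + z) volume volume := fun z =>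
    measurePreserving_add_right volume z
  have hΦ' : ∀ z, Φ z = ∫ y, (⟪a (y + z), b y⟫_ℝ + ⟪A (y + z), B y⟫_ℝ) := fun z =>
    (integral_add
      (integrable_inner_of_memLp (ha.comp_measurePreserving (hmp z)) hb)
      (integrable_inner_of_memLp (hA.comp_measurePreserving (hmp z)) hB)).symm
  have key : ∀ ρ : E → ℝ, ContDiff ℝ ∞ ρ → HasCompactSupport ρ → tsupport ρ ⊆ S →
      ∫ z, ρ z • Φ z = 0 := by
    intro ρ hρ hρc hρS
    have hk := (integrable_kernel_mul_inner hρ.continuous hρc ha' hb').add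
      (integrable_kernel_mul_inner hρ.continuous hρc hA' hB')
    have hg : Integrable (Function.uncurry fun y z : E =>
        ρ z * (⟪a (y + z), b y⟫_ℝ + ⟪A (y + z), B y⟫_ℝ)) ((volume : Measure E).prod volume) := by
      refine ((measurePreserving_prod_add volume volume).integrable_comp_of_integrable hk).congr
        (Eventually.of_forall fun p => ?_)
      simp only [Function.comp, Pi.add_apply, add_sub_cancel_left, Function.uncurry]
      ring
    calc ∫ z, ρ z • Φ z
        = ∫ z, ∫ y, ρ z * (⟪a (y + z), b y⟫_ℝ + ⟪A (y + z), B y⟫_ℝ) := by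
          refine integral_congr_ae (Eventually.of_forall fun z => ?_)
          simp only [smul_eq_mul, hΦ', integral_const_mul]
      _ = ∫ y, ∫ z, ρ z * (⟪a (y + z), b y⟫_ℝ + ⟪A (y + z), B y⟫_ℝ) :=
          (integral_integral_swap hg).symm
      _ = ∫ y, ∫ x, ρ (x - y) * (⟪a x, b y⟫_ℝ + ⟪A x, B y⟫_ℝ) := by
          refine integral_congr_ae (Eventually.of_forall fun y => ?_)
          simp only
          rw [← integral_add_left_eq_self (μ := volume)
            (fun x => ρ (x - y) * (⟪a x, b y⟫_ℝ + ⟪A x, B y⟫_ℝ)) y]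
          simp
      _ = 0 := h ρ hρ hρc hρS
  have hae := hS.ae_eq_zero_of_integral_contDiff_smul_eq_zero
    ((hΦc.locallyIntegrable (μ := volume)).locallyIntegrableOn S) key
  have hon : EqOn Φ 0 S := Measure.eqOn_open_of_ae_eq (μ := volume)
    ((ae_restrict_iff' hS.measurableSet).2 hae) hS hΦc.continuousOn continuousOn_const
  have hcl : closure S ⊆ {z | Φ z = 0} :=
    closure_minimal hon (isClosed_eq hΦc continuous_const)
  have := hcl h0
  rw [mem_ofPred_eq, hΦ'] at this
  simpa using this

end Translation

variable {N : ℕ} {Ω : Set (Eucl N)}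

/-- Near every point of its closure, a Lipschitz domain is mapped into itself by an open set of
arbitrarily small translations. -/
lemma IsLipschitzDomain.exists_translations (hΩ : IsLipschitzDomain Ω) {p : Eucl N}
    (hp : p ∈ closure Ω) : ∃ r > 0, ∃ S : Set (Eucl N), IsOpen S ∧ 0 ∈ closure S ∧
      ∀ y ∈ Ω ∩ Metric.ball p r, ∀ z ∈ S, y + z ∈ Ω := by
  by_cases hpΩ : p ∈ Ω
  · obtain ⟨r, hr, hb⟩ := Metric.isOpen_iff.1 hΩ.isOpen p hpΩ
    refine ⟨r / 2, by positivity, Metric.ball 0 (r / 2), Metric.isOpen_ball,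
      subset_closure (by simpa using hr), fun y hy z hz => hb ?_⟩
    have h1 := hy.2
    rw [Metric.mem_ball, dist_eq_norm] at *
    calc ‖y + z - p‖ = ‖(y - p) + (z - 0)‖ := by congr 1; abel
      _ ≤ ‖y - p‖ + ‖z - 0‖ := norm_add_le _ _
      _ < r := by linarith
  · obtain ⟨e, r, k, ψ, he, hr, hψ, hgr⟩ := hΩ.exists_graph p
      (by rw [hΩ.isOpen.frontier_eq]; exact ⟨hp, hpΩ⟩)
    -- The directions in the open cone above the graph's slope: moving by such `z` raises the height
    -- by more than the Lipschitz function `ψ` can rise. The apex `0` is only in the closure.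
    refine ⟨r / 2, by positivity,
      Metric.ball 0 (r / 2) ∩ {z | k * ‖z - ⟪e, z⟫_ℝ • e‖ < ⟪e, z⟫_ℝ}, ?_, ?_, ?_⟩
    · exact Metric.isOpen_ball.inter (isOpen_lt (by fun_prop) (by fun_prop))
    · rw [Metric.mem_closure_iff]
      intro ε hε
      have hs : 0 < min (ε / 2) (r / 4) := by positivity
      refine ⟨(min (ε / 2) (r / 4)) • e, ⟨?_, ?_⟩, ?_⟩
      · simp only [Metric.mem_ball, dist_zero_right, norm_smul, he, mul_one, Real.norm_eq_abs,
          abs_of_pos hs]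
        linarith [min_le_right (ε / 2) (r / 4)]
      · simp only [mem_ofPred_eq, inner_smul_right, real_inner_self_eq_norm_sq, he]
        simpa using ⟨hε, hr⟩
      · simp only [dist_zero_left, norm_smul, he, mul_one, Real.norm_eq_abs, abs_of_pos hs]
        linarith [min_le_left (ε / 2) (r / 4)]
    · rintro y ⟨hyΩ, hyb⟩ z ⟨hz, hzc⟩
      rw [Metric.mem_ball, dist_eq_norm] at hyb hz
      have hyb' : y ∈ Metric.ball p r := by
        rw [Metric.mem_ball, dist_eq_norm]; linarith
      have hyz : y + z ∈ Metric.ball p r := by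
        rw [Metric.mem_ball, dist_eq_norm]
        calc ‖y + z - p‖ = ‖(y - p) + (z - 0)‖ := by congr 1; abel
          _ ≤ ‖y - p‖ + ‖z - 0‖ := norm_add_le _ _
          _ < r := by linarith
      rw [hgr _ hyz]
      have h1 := (hgr _ hyb').1 hyΩ
      have h2 := hψ.dist_le_mul (y + z - ⟪e, y + z⟫_ℝ • e) (y - ⟪e, y⟫_ℝ • e)
      rw [dist_eq_norm, Real.norm_eq_abs, dist_eq_norm] at h2
      have h3 : y + z - ⟪e, y + z⟫_ℝ • e - (y - ⟪e, y⟫_ℝ • e) = z - ⟪e, z⟫_ℝ • e := by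
        rw [inner_add_right, add_smul]; abel
      rw [h3] at h2
      have h4 := (abs_le.1 h2).2
      have h5 : (k : ℝ) * ‖z - ⟪e, z⟫_ℝ • e‖ < ⟪e, z⟫_ℝ := hzc
      rw [inner_add_right] at h4 ⊢
      linarith

lemma IsLipschitzDomain.isFiniteMeasure (hΩ : IsLipschitzDomain Ω) :
    IsFiniteMeasure ((volume : Measure (Eucl N)).restrict Ω) :=
  ⟨by rw [Measure.restrict_apply_univ]; exact hΩ.isBounded.measure_lt_top⟩

lemma gradient_translate (ρ : Eucl N → ℝ) (y x : Eucl N) :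
    ∇ (fun x => ρ (x - y)) x = ∇ ρ (x - y) := by
  simp only [gradient, fderiv_comp_sub]

lemma gradient_mul_reflect {η ρ : Eucl N → ℝ} (hη : ContDiff ℝ ∞ η) (hρ : ContDiff ℝ ∞ ρ)
    (x y : Eucl N) : ∇ (fun y => η y * ρ (x - y)) y
      = ρ (x - y) • ∇ η y - η y • ∇ ρ (x - y) := by
  refine ext_inner_left ℝ fun c => ?_
  have h1 : HasFDerivAt η (fderiv ℝ η y) y := (hη.differentiable (by simp) y).hasFDerivAt
  have h2 : HasFDerivAt (fun y => ρ (x - y)) ((fderiv ℝ ρ (x - y)).comp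
      (-ContinuousLinearMap.id ℝ (Eucl N))) y := by
    refine ((hρ.differentiable (by simp) (x - y)).hasFDerivAt).comp y ?_
    exact (hasFDerivAt_id y).const_sub x
  rw [inner_gradient, (h1.fun_mul h2).fderiv, inner_sub_right, inner_smul_right, inner_smul_right,
    inner_gradient, inner_gradient]
  simp
  ring

/-- The pairing of `u ∈ H¹(Ω)` with itself, localised by a smooth function `η`. -/
def localPairing (u : H1 Ω) (η : Eucl N → ℝ) : ℝ :=
  ∫ x in Ω, (u.fn x * (η x * u.fn x + ⟪u.grad x, ∇ η x⟫_ℝ) + η x * ⟪u.grad x, u.grad x⟫_ℝ)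

lemma memLp_bdd_smul (hΩ : IsLipschitzDomain Ω) {E : Type*} [NormedAddCommGroup E]
    [NormedSpace ℝ E] {η : Eucl N → ℝ} (hη : Continuous η) {a : Eucl N → E}
    (ha : MemLp a 2 (volume.restrict Ω)) :
    MemLp (fun x => η x • a x) 2 (volume.restrict Ω) :=
  ha.smul (memLp_restrict_of_continuous (p := ⊤) hΩ.isBounded hη volume)

lemma memLp_inner_bdd (hΩ : IsLipschitzDomain Ω) {v : Eucl N → Eucl N} (hv : Continuous v)
    {G : Eucl N → Eucl N} (hG : MemLp G 2 (volume.restrict Ω)) :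
    MemLp (fun x => ⟪G x, v x⟫_ℝ) 2 (volume.restrict Ω) := by
  obtain ⟨C, hC⟩ := hΩ.isBounded.isCompact_closure.exists_bound_of_continuousOn hv.continuousOn
  refine hG.of_le_mul (c := C) (hG.1.inner hv.aestronglyMeasurable) ?_
  refine (ae_restrict_iff' hΩ.isOpen.measurableSet).2 (Eventually.of_forall fun x hx => ?_)
  refine (norm_inner_le_norm _ _).trans ?_
  rw [mul_comm]
  gcongr
  exact hC x (subset_closure hx)

/-- For a kernel `ρ` supported in `S`, the double integral of `ρ (x - y)` against `a x * b y + ⟪A x,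
B y⟫` is evaluated in two ways. For fixed `y` in `Ω` with `η y ≠ 0`, the function `x ↦ ρ (x - y)`
has compact support in `Ω`, so the weak gradient of `u` applies. For fixed `x`, the function `y ↦ η
y * ρ (x - y)` is smooth on the whole space, so orthogonality applies. Both give the integral of `a
x * ⟪∇ρ (x - y), B y⟫`, with opposite signs, because reflection changes the sign of `∇ρ`. -/
lemma localPairing_eq_zero (hΩ : IsLipschitzDomain Ω) {u : H1 Ω}
    (hu : ∀ φ : Eucl N → ℝ, ContDiff ℝ ∞ φ →
      ∫ x in Ω, (u.fn x * φ x + ⟪u.grad x, ∇ φ x⟫_ℝ) = 0)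
    {p : Eucl N} {r : ℝ} {S : Set (Eucl N)} (hS : IsOpen S) (h0 : 0 ∈ closure S)
    (hpS : ∀ y ∈ Ω ∩ Metric.ball p r, ∀ z ∈ S, y + z ∈ Ω)
    {η : Eucl N → ℝ} (hη : ContDiff ℝ ∞ η) (hηs : Function.support η ⊆ Metric.ball p r) :
    localPairing u η = 0 := by
  have hfin := hΩ.isFiniteMeasure
  have hm : MeasurableSet Ω := hΩ.isOpen.measurableSet
  have hufn : MemLp u.fn 2 (volume.restrict Ω) := Lp.memLp u.fn
  have hugr : MemLp u.grad 2 (volume.restrict Ω) := Lp.memLp u.grad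
  have hF : MemLp (fun y => η y * u.fn y + ⟪u.grad y, ∇ η y⟫_ℝ) 2 (volume.restrict Ω) :=
    (memLp_bdd_smul hΩ hη.continuous hufn).add (memLp_inner_bdd hΩ (continuous_gradient hη) hugr)
  have hX : MemLp (fun y => η y • u.grad y) 2 (volume.restrict Ω) :=
    memLp_bdd_smul hΩ hη.continuous hugr
  have key := integral_pairing_eq_zero_of_kernel hS h0
    (a := Ω.indicator u.fn) (b := Ω.indicator fun y => η y * u.fn y + ⟪u.grad y, ∇ η y⟫_ℝ)
    (A := Ω.indicator u.grad) (B := Ω.indicator fun y => η y • u.grad y)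
    ((memLp_indicator_iff_restrict hm).2 hufn) ((memLp_indicator_iff_restrict hm).2 hF)
    ((memLp_indicator_iff_restrict hm).2 hugr) ((memLp_indicator_iff_restrict hm).2 hX)
    ((integrable_indicator_iff hm).2 (hufn.integrable one_le_two))
    ((integrable_indicator_iff hm).2 (hF.integrable one_le_two))
    ((integrable_indicator_iff hm).2 (hugr.integrable one_le_two))
    ((integrable_indicator_iff hm).2 (hX.integrable one_le_two)) ?_
  · rw [localPairing, ← key, ← setIntegral_eq_integral_of_forall_compl_eq_zero (s := Ω)
      (μ := volume) (f := fun y => ⟪Ω.indicator u.fn y, Ω.indicator (fun y => η y * u.fn y +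
        ⟪u.grad y, ∇ η y⟫_ℝ) y⟫_ℝ + ⟪Ω.indicator u.grad y, Ω.indicator (fun y => η y • u.grad y) y⟫_ℝ)
        (fun x hx => by simp [hx])]
    refine setIntegral_congr_fun hm fun x hx => ?_
    simp only [indicator_of_mem hx, inner_smul_right, real_inner_eq_re_inner]
    simp [mul_comm]
  intro ρ hρ hρc hρS
  set a : Eucl N → ℝ := Ω.indicator u.fn with ha
  set b : Eucl N → ℝ := Ω.indicator fun y => η y * u.fn y + ⟪u.grad y, ∇ η y⟫_ℝ with hb
  set A : Eucl N → Eucl N := Ω.indicator u.grad with hA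
  set B : Eucl N → Eucl N := Ω.indicator fun y => η y • u.grad y with hB
  have ia : Integrable a := (integrable_indicator_iff hm).2 (hufn.integrable one_le_two)
  have ib : Integrable b := (integrable_indicator_iff hm).2 (hF.integrable one_le_two)
  have iA : Integrable A := (integrable_indicator_iff hm).2 (hugr.integrable one_le_two)
  have iB : Integrable B := (integrable_indicator_iff hm).2 (hX.integrable one_le_two)
  have hρgc : HasCompactSupport (∇ ρ) := (hρc.fderiv ℝ).comp_left
    (g := (InnerProductSpace.toDual ℝ (Eucl N)).symm) (map_zero _)
  have k1 := integrable_kernel_mul_inner hρ.continuous hρc ia ib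
  have k2 := integrable_kernel_mul_inner hρ.continuous hρc iA iB
  have k3 := integrable_mul_inner_kernel (continuous_gradient hρ) hρgc ia iB
  -- the weak gradient of `u`, tested with translates of `ρ`
  have I2 : ∀ y, ∫ x, ρ (x - y) * ⟪A x, B y⟫_ℝ = - ∫ x, a x * ⟪∇ ρ (x - y), B y⟫_ℝ := by
    intro y
    by_cases hy : B y = 0
    -- Only points `y ∈ Ω` with `η y ≠ 0` matter; these lie in the ball where translation by `S`
    -- stays inside `Ω`.
    · simp [hy]
    have hyΩ : y ∈ Ω := by
      by_contra hn; exact hy (by simp [hB, hn])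
    have hηy : η y ≠ 0 := by
      intro hn; exact hy (by simp [hB, hn])
    have hφ : IsTestFunction Ω fun x => ρ (x - y) :=
      { contDiff := hρ.comp (contDiff_id.sub contDiff_const)
        hasCompactSupport := hρc.comp_homeomorph (Homeomorph.subRight y)
        tsupport_subset := by
          have : tsupport (fun x => ρ (x - y)) ⊆ (fun x => x - y) ⁻¹' tsupport ρ :=
            tsupport_comp_subset_preimage ρ (by fun_prop)
          intro x hx
          have := hpS y ⟨hyΩ, hηs hηy⟩ (x - y) (hρS (this hx))
          simpa using this }
    have := (isWeakGradient_iff _ _).1 u.2 _ hφ (B y)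
    have e1 : ∫ x, a x * ⟪∇ ρ (x - y), B y⟫_ℝ
        = ∫ x in Ω, u.fn x * ⟪B y, ∇ (fun x => ρ (x - y)) x⟫_ℝ := by
      rw [← setIntegral_eq_integral_of_forall_compl_eq_zero (s := Ω) (μ := volume)
        (f := fun x => a x * ⟪∇ ρ (x - y), B y⟫_ℝ) (fun x hx => by simp [ha, hx])]
      refine setIntegral_congr_fun hm fun x hx => ?_
      simp only [ha, indicator_of_mem hx, gradient_translate, real_inner_comm (B y)]
    have e2 : ∫ x, ρ (x - y) * ⟪A x, B y⟫_ℝ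
        = ∫ x in Ω, ρ (x - y) * ⟪B y, u.grad x⟫_ℝ := by
      rw [← setIntegral_eq_integral_of_forall_compl_eq_zero (s := Ω) (μ := volume)
        (f := fun x => ρ (x - y) * ⟪A x, B y⟫_ℝ) (fun x hx => by simp [hA, hx])]
      refine setIntegral_congr_fun hm fun x hx => ?_
      simp only [hA, indicator_of_mem hx, real_inner_comm (B y)]
    rw [e1, e2]
    exact (neg_eq_iff_eq_neg.2 this).symm
  -- the orthogonality to smooth functions, tested with reflected translates of `ρ`
  have I1 : ∀ x, ∫ y, ρ (x - y) * ⟪a x, b y⟫_ℝ = ∫ y, a x * ⟪∇ ρ (x - y), B y⟫_ℝ := by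
    intro x
    have hsm : ContDiff ℝ ∞ fun y => η y * ρ (x - y) :=
      hη.mul (hρ.comp (contDiff_const.sub contDiff_id))
    have := hu _ hsm
    have e1 : ∫ y, ρ (x - y) * ⟪a x, b y⟫_ℝ
        = a x * ∫ y in Ω, ρ (x - y) * (η y * u.fn y + ⟪u.grad y, ∇ η y⟫_ℝ) := by
      rw [← integral_const_mul,
        ← setIntegral_eq_integral_of_forall_compl_eq_zero (s := Ω) (μ := volume)
        (f := fun y => ρ (x - y) * ⟪a x, b y⟫_ℝ) (fun x hx => by simp [hb, hx])]
      refine setIntegral_congr_fun hm fun y hy => ?_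
      simp only [hb, indicator_of_mem hy]
      simp
      ring
    have e2 : ∫ y, a x * ⟪∇ ρ (x - y), B y⟫_ℝ
        = a x * ∫ y in Ω, η y * ⟪u.grad y, ∇ ρ (x - y)⟫_ℝ := by
      rw [← integral_const_mul,
        ← setIntegral_eq_integral_of_forall_compl_eq_zero (s := Ω) (μ := volume)
        (f := fun y => a x * ⟪∇ ρ (x - y), B y⟫_ℝ) (fun x hx => by simp [hB, hx])]
      refine setIntegral_congr_fun hm fun y hy => ?_
      simp only [hB, indicator_of_mem hy, inner_smul_right, real_inner_comm (u.grad y)]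
    rw [e1, e2]
    congr 1
    rw [← sub_eq_zero, ← this, ← integral_sub]
    · refine setIntegral_congr_fun hm fun y hy => ?_
      simp only [gradient_mul_reflect hη hρ, inner_sub_right, inner_smul_right]
      ring
    · have := memLp_bdd_smul hΩ (hρ.continuous.comp (continuous_const.sub continuous_id)) hF
        (η := fun y => ρ (x - y))
      exact this.integrable one_le_two
    · have := memLp_bdd_smul hΩ hη.continuous (memLp_inner_bdd hΩ
        ((continuous_gradient hρ).comp (continuous_const.sub continuous_id)) hugr
        (v := fun y => ∇ ρ (x - y)))
      exact this.integrable one_le_two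
  calc ∫ y, ∫ x, ρ (x - y) * (⟪a x, b y⟫_ℝ + ⟪A x, B y⟫_ℝ)
      = ∫ p : Eucl N × Eucl N, (ρ (p.2 - p.1) * ⟪a p.2, b p.1⟫_ℝ
          + ρ (p.2 - p.1) * ⟪A p.2, B p.1⟫_ℝ) ∂(volume.prod volume) := by
        simp only [mul_add]
        exact (integral_prod _ (k1.add k2)).symm
    _ = (∫ x, ∫ y, ρ (x - y) * ⟪a x, b y⟫_ℝ) + ∫ y, ∫ x, ρ (x - y) * ⟪A x, B y⟫_ℝ := by
        rw [integral_add k1 k2, integral_prod_symm _ k1, integral_prod _ k2]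
    _ = (∫ x, ∫ y, a x * ⟪∇ ρ (x - y), B y⟫_ℝ) + ∫ y, - ∫ x, a x * ⟪∇ ρ (x - y), B y⟫_ℝ := by
        simp only [I1, I2]
    _ = 0 := by
        rw [integral_neg, ← integral_prod_symm (fun p : Eucl N × Eucl N =>
          a p.2 * ⟪∇ ρ (p.2 - p.1), B p.1⟫_ℝ) k3, integral_prod _ k3, add_neg_cancel]

/-- `localPairing u` is linear in the cutoff, so factors `1 - χ` may be inserted whenever the piece
cut out by `χ` contributes nothing. -/
lemma localPairing_mul_one_sub (hΩ : IsLipschitzDomain Ω) (u : H1 Ω) {η χ : Eucl N → ℝ}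
    (hη : ContDiff ℝ ∞ η) (hχ : ContDiff ℝ ∞ χ) (h : localPairing u (η * χ) = 0) :
    localPairing u (η * (1 - χ)) = localPairing u η := by
  have hufn : MemLp u.fn 2 (volume.restrict Ω) := Lp.memLp u.fn
  have hugr : MemLp u.grad 2 (volume.restrict Ω) := Lp.memLp u.grad
  have hint : ∀ φ : Eucl N → ℝ, ContDiff ℝ ∞ φ → Integrable (fun x => u.fn x * (φ x * u.fn x
      + ⟪u.grad x, ∇ φ x⟫_ℝ) + φ x * ⟪u.grad x, u.grad x⟫_ℝ) (volume.restrict Ω) := by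
    intro φ hφ
    have h1 := (memLp_bdd_smul hΩ hφ.continuous hufn).add
      (memLp_inner_bdd hΩ (continuous_gradient hφ) hugr)
    have h2 := integrable_inner_of_memLp h1 hufn
    have h3 := integrable_inner_of_memLp hugr (memLp_bdd_smul hΩ hφ.continuous hugr)
    refine (h2.add h3).congr (Eventually.of_forall fun x => ?_)
    simp [inner_smul_right]
  have e : localPairing u (η * (1 - χ)) = localPairing u η - localPairing u (η * χ) := by
    refine Eq.trans ?_ (integral_sub (hint _ hη) (hint (η * χ) (hη.mul hχ)))
    refine integral_congr_ae (Eventually.of_forall fun x => ?_)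
    have hg : ∇ (η * (1 - χ)) x = ∇ η x - ∇ (η * χ) x := by
      refine ext_inner_left ℝ fun c => ?_
      rw [inner_sub_right, inner_gradient, inner_gradient, inner_gradient,
        show η * (1 - χ) = η - η * χ by ring,
        fderiv_sub (hη.differentiable (by simp) x) (g := η * χ) ((hη.mul hχ).differentiable (by simp) x)]
      rfl
    simp only [hg, inner_sub_right, Pi.mul_apply, Pi.sub_apply, Pi.one_apply]
    ring
  rw [e, h, sub_zero]

/-- An element of `H¹(Ω)` orthogonal to all functions smooth up to the boundary vanishes. -/
lemma eq_zero_of_orthogonal_smooth (hΩ : IsLipschitzDomain Ω) {u : H1 Ω}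
    (hu : ∀ φ : Eucl N → ℝ, ContDiff ℝ ∞ φ →
      ∫ x in Ω, (u.fn x * φ x + ⟪u.grad x, ∇ φ x⟫_ℝ) = 0) : u = 0 := by
  choose! r hr S hS h0 hpS using fun p (hp : p ∈ closure Ω) => hΩ.exists_translations hp
  have hkey : ∀ p ∈ closure Ω, ∃ χ : Eucl N → ℝ, ContDiff ℝ ∞ χ ∧
      Function.support χ ⊆ Metric.ball p (r p) ∧ ∀ x ∈ Metric.ball p (r p / 2), χ x = 1 := by
    intro p hp
    have hr' := hr p hp
    let χ : ContDiffBump p := ⟨r p / 2, r p, by positivity, by linarith⟩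
    exact ⟨χ, χ.contDiff, χ.support_eq.subset,
      fun x hx => χ.one_of_mem_closedBall (Metric.ball_subset_closedBall hx)⟩
  choose! χ hχ hχs hχ1 using hkey
  -- The product of the `1 - χ p` replaces a partition of unity: each factor leaves the pairing
  -- unchanged, and over a finite cover of `closure Ω` the product vanishes on `Ω`.
  have hprod : ∀ t : Finset (Eucl N), (∀ p ∈ t, p ∈ closure Ω) → ∀ η : Eucl N → ℝ,
      ContDiff ℝ ∞ η → localPairing u (η * ∏ p ∈ t, (1 - χ p)) = localPairing u η := by
    classical
    intro t
    induction t using Finset.induction_on with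
    | empty => intro _ η _; simp
    | insert q t hq ih =>
      intro ht η hη
      have hqc := ht q (Finset.mem_insert_self q t)
      rw [Finset.prod_insert hq, ← mul_assoc,
        ih (fun p hp => ht p (Finset.mem_insert_of_mem hp)) (η * (1 - χ q))
          (hη.mul (contDiff_const.sub (hχ q hqc)))]
      refine localPairing_mul_one_sub hΩ u hη (hχ q hqc) ?_
      refine localPairing_eq_zero hΩ hu (hS q hqc) (h0 q hqc) (hpS q hqc) (hη.mul (hχ q hqc)) ?_
      exact (Function.support_mul_subset_right _ _).trans (hχs q hqc)
  obtain ⟨t, ht, hcov⟩ := hΩ.isBounded.isCompact_closure.elim_nhds_subcover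
    (fun p => Metric.ball p (r p / 2))
    (fun p hp => Metric.ball_mem_nhds p (half_pos (hr p hp)))
  have h1 : localPairing u 1 = 0 := by
    rw [← hprod t ht 1 contDiff_const, one_mul]
    have hz : ∀ x ∈ Ω, (∏ p ∈ t, (1 - χ p)) x = 0 := by
      intro x hx
      obtain ⟨p, hp, hxp⟩ := mem_iUnion₂.1 (hcov (subset_closure hx))
      rw [Finset.prod_apply]
      exact Finset.prod_eq_zero hp (by simp [hχ1 p (ht p hp) x hxp])
    refine (setIntegral_congr_fun hΩ.isOpen.measurableSet fun x hx => ?_).trans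
      (integral_zero _ _)
    have hg : ∇ (∏ p ∈ t, (1 - χ p)) x = 0 := by
      have : (∏ p ∈ t, (1 - χ p)) =ᶠ[𝓝 x] fun _ => (0 : ℝ) :=
        Filter.eventuallyEq_of_mem (hΩ.isOpen.mem_nhds hx) hz
      rw [gradient, this.fderiv_eq]
      simp
    simp [hg, hz x hx]
  -- With the constant cutoff `1` the gradient term drops out and the local pairing is the full `H¹`
  -- norm squared.
  have h2 : ‖u‖ ^ 2 = 0 := by
    rw [← h1, H1.norm_sq_eq, ← real_inner_self_eq_norm_sq, ← real_inner_self_eq_norm_sq,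
      L2.inner_def, L2.inner_def, localPairing,
      ← integral_add (L2.integrable_inner u.fn u.fn) (L2.integrable_inner u.grad u.grad)]
    refine integral_congr_ae (Eventually.of_forall fun x => ?_)
    have : ∇ (1 : Eucl N → ℝ) x = 0 := gradient_fun_const x (1 : ℝ)
    simp [this]
    ring
  exact norm_eq_zero.1 (pow_eq_zero_iff two_ne_zero |>.1 h2)

lemma H1.eq_ofSmooth (hΩ : Bornology.IsBounded Ω) {φ : Eucl N → ℝ} (hφ : ContDiff ℝ ∞ φ)
    {v : H1 Ω} (h1 : v.fn =ᵐ[volume.restrict Ω] φ) (h2 : v.grad =ᵐ[volume.restrict Ω] ∇ φ) :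
    v = H1.ofSmooth hΩ hφ := by
  refine Subtype.ext ((WithLp.ofLp_injective 2) (Prod.ext ?_ ?_))
  · exact Lp.ext (h1.trans (H1.ofSmooth_fn_ae hΩ hφ).symm)
  · exact Lp.ext (h2.trans (H1.ofSmooth_grad_ae hΩ hφ).symm)

lemma gradient_add_of_smooth {φ χ : Eucl N → ℝ} (hφ : ContDiff ℝ ∞ φ) (hχ : ContDiff ℝ ∞ χ)
    (x : Eucl N) : ∇ (φ + χ) x = ∇ φ x + ∇ χ x := by
  rw [gradient, fderiv_add (hφ.differentiable (by simp) x) (hχ.differentiable (by simp) x), map_add]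
  rfl

lemma gradient_smul_of_smooth (c : ℝ) {φ : Eucl N → ℝ} (hφ : ContDiff ℝ ∞ φ)
    (x : Eucl N) : ∇ (c • φ) x = c • ∇ φ x := by
  rw [gradient, fderiv_const_smul (hφ.differentiable (by simp) x), map_smulₛₗ]
  simp [gradient]

lemma H1.ofSmooth_add (hΩ : Bornology.IsBounded Ω) {φ χ : Eucl N → ℝ} (hφ : ContDiff ℝ ∞ φ)
    (hχ : ContDiff ℝ ∞ χ) : H1.ofSmooth hΩ hφ + H1.ofSmooth hΩ hχ
      = H1.ofSmooth hΩ (φ := φ + χ) (hφ.add hχ) := by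
  refine H1.eq_ofSmooth hΩ _ ?_ ?_
  · filter_upwards [Lp.coeFn_add (H1.ofSmooth hΩ hφ).fn (H1.ofSmooth hΩ hχ).fn,
      H1.ofSmooth_fn_ae hΩ hφ, H1.ofSmooth_fn_ae hΩ hχ] with x h1 h2 h3
    rw [H1.fn_add, h1, Pi.add_apply, h2, h3, Pi.add_apply]
  · filter_upwards [Lp.coeFn_add (H1.ofSmooth hΩ hφ).grad (H1.ofSmooth hΩ hχ).grad,
      H1.ofSmooth_grad_ae hΩ hφ, H1.ofSmooth_grad_ae hΩ hχ] with x h1 h2 h3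
    rw [H1.grad_add, h1, Pi.add_apply, h2, h3, gradient_add_of_smooth hφ hχ]

lemma H1.ofSmooth_smul (hΩ : Bornology.IsBounded Ω) (c : ℝ) {φ : Eucl N → ℝ}
    (hφ : ContDiff ℝ ∞ φ) : c • H1.ofSmooth hΩ hφ
      = H1.ofSmooth hΩ (φ := c • φ) (contDiff_const.smul hφ) := by
  refine H1.eq_ofSmooth hΩ _ ?_ ?_
  · filter_upwards [Lp.coeFn_smul c (H1.ofSmooth hΩ hφ).fn,
      H1.ofSmooth_fn_ae hΩ hφ] with x h1 h2
    rw [H1.fn_smul, h1, Pi.smul_apply, h2, Pi.smul_apply]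
  · filter_upwards [Lp.coeFn_smul c (H1.ofSmooth hΩ hφ).grad,
      H1.ofSmooth_grad_ae hΩ hφ] with x h1 h2
    rw [H1.grad_smul, h1, Pi.smul_apply, h2, gradient_smul_of_smooth c hφ]

lemma H1.ofSmooth_zero (hΩ : Bornology.IsBounded Ω) :
    H1.ofSmooth hΩ (φ := fun _ => (0 : ℝ)) contDiff_const = 0 := by
  symm
  refine H1.eq_ofSmooth hΩ _ (Lp.coeFn_zero ℝ 2 _) ?_
  rw [gradient_fun_const']
  exact Lp.coeFn_zero (Eucl N) 2 _

/-- Functions smooth up to the boundary are dense in `H¹(Ω)`. -/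
lemma H1.exists_smooth_tendsto (hΩ : IsLipschitzDomain Ω) (u : H1 Ω) :
    ∃ (φ : ℕ → Eucl N → ℝ) (hφ : ∀ k, ContDiff ℝ ∞ (φ k)),
      Tendsto (fun k => H1.ofSmooth hΩ.isBounded (hφ k)) atTop (𝓝 u) := by
  let D : Submodule ℝ (H1 Ω) := Submodule.span ℝ
    {v | ∃ (φ : Eucl N → ℝ) (hφ : ContDiff ℝ ∞ φ), v = H1.ofSmooth hΩ.isBounded hφ}
  -- Smooth restrictions already form a subspace; the span is used only to apply the orthogonal
  -- complement criterion.
  have hD : ∀ v ∈ D, ∃ (φ : Eucl N → ℝ) (hφ : ContDiff ℝ ∞ φ),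
      v = H1.ofSmooth hΩ.isBounded hφ := by
    intro v hv
    induction hv using Submodule.span_induction with
    | mem v hv => exact hv
    | zero => exact ⟨fun _ => 0, contDiff_const, (H1.ofSmooth_zero _).symm⟩
    | add v w _ _ hv hw =>
      obtain ⟨φ, hφ, rfl⟩ := hv
      obtain ⟨χ, hχ, rfl⟩ := hw
      exact ⟨φ + χ, hφ.add hχ, H1.ofSmooth_add _ hφ hχ⟩
    | smul c v _ hv =>
      obtain ⟨φ, hφ, rfl⟩ := hv
      exact ⟨c • φ, contDiff_const.smul hφ, H1.ofSmooth_smul _ c hφ⟩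
  have hdense : D.topologicalClosure = ⊤ := by
    rw [Submodule.topologicalClosure_eq_top_iff, Submodule.eq_bot_iff]
    intro v hv
    refine eq_zero_of_orthogonal_smooth hΩ fun φ hφ => ?_
    have := (Submodule.mem_orthogonal _ _).1 hv _ (Submodule.subset_span ⟨φ, hφ, rfl⟩)
    rw [H1.inner_eq, H1.ofSmooth_fn, H1.ofSmooth_grad, inner_toLp_left, inner_toLp_left,
      ← integral_add] at this
    · rw [← this]
      refine integral_congr_ae (Eventually.of_forall fun x => ?_)
      simp only [real_inner_comm (∇ φ x)]
      simp
    · exact integrable_inner_of_memLp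
        (memLp_restrict_of_continuous hΩ.isBounded hφ.continuous 2 volume) (Lp.memLp v.fn)
    · exact integrable_inner_of_memLp (memLp_restrict_of_continuous hΩ.isBounded
        (continuous_gradient hφ) 2 volume) (Lp.memLp v.grad)
  have hu : u ∈ closure (D : Set (H1 Ω)) := by
    rw [← Submodule.topologicalClosure_coe, hdense]; trivial
  obtain ⟨v, hv, hlim⟩ := mem_closure_iff_seq_limit.1 hu
  choose φ hφ hφv using fun k => hD (v k) (hv k)
  exact ⟨φ, hφ, by simpa only [← hφv] using hlim⟩

end Density

/-! ### Surface measure and the trace inequality for smooth functions. -/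

section TraceInequality

/-- The weight `1 - s / δ` equals `1` at `0` and vanishes at `δ`, so integrating the derivative of
`-(1 - s / δ) * v s ^ 2` leaves only the value at `0`; the mixed term is split by Young's
inequality. -/
lemma sq_le_integral_of_contDiff {v v' : ℝ → ℝ} (hv : ∀ s, HasDerivAt v (v' s) s)
    (hv' : Continuous v') {δ : ℝ} (hδ : 0 < δ) :
    v 0 ^ 2 ≤ ∫ s in (0 : ℝ)..δ, (1 / δ + 1) * (v s ^ 2 + v' s ^ 2) := by
  have hc : Continuous v := continuous_iff_continuousAt.2 fun s => (hv s).continuousAt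
  have hd : ∀ s, HasDerivAt (fun s => -((1 - s / δ) * v s ^ 2))
      (1 / δ * v s ^ 2 - (1 - s / δ) * (2 * v s * v' s)) s := by
    intro s
    have h1 : HasDerivAt (fun s : ℝ => 1 - s / δ) (-(1 / δ)) s := by
      simpa using ((hasDerivAt_id s).div_const δ).const_sub 1
    refine (h1.fun_mul ((hv s).fun_pow 2)).fun_neg.congr_deriv ?_
    simp
    ring
  have hint : Continuous fun s => 1 / δ * v s ^ 2 - (1 - s / δ) * (2 * v s * v' s) := by fun_prop
  have hftc := intervalIntegral.integral_eq_sub_of_hasDerivAt (a := 0) (b := δ)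
    (fun s _ => hd s) (hint.intervalIntegrable 0 δ)
  have e : v 0 ^ 2 = ∫ s in (0 : ℝ)..δ, (1 / δ * v s ^ 2 - (1 - s / δ) * (2 * v s * v' s)) := by
    rw [hftc]; field_simp; ring
  rw [e]
  refine intervalIntegral.integral_mono_on hδ.le (hint.intervalIntegrable 0 δ)
    (Continuous.intervalIntegrable (by fun_prop) 0 δ) fun s hs => ?_
  have h1 : 0 ≤ s / δ := div_nonneg hs.1 hδ.le
  have h2 : s / δ ≤ 1 := (div_le_one hδ).2 hs.2
  have h3 : 0 ≤ 1 / δ := by positivity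
  have h4 : 0 ≤ 1 / δ * v' s ^ 2 := by positivity
  have h5 : -(2 * v s * v' s) * (1 - s / δ) ≤ v s ^ 2 + v' s ^ 2 := by
    have : -(2 * v s * v' s) ≤ v s ^ 2 + v' s ^ 2 := by nlinarith [sq_nonneg (v s + v' s)]
    calc -(2 * v s * v' s) * (1 - s / δ) ≤ (v s ^ 2 + v' s ^ 2) * (1 - s / δ) := by
          gcongr
      _ ≤ (v s ^ 2 + v' s ^ 2) * 1 := by
          gcongr
          linarith
      _ = _ := mul_one _
  linarith

variable {N : ℕ} {Ω : Set (Eucl N)}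

/-- The energy density of a smooth function, as an extended nonnegative function. -/
def energyDensity (φ : Eucl N → ℝ) (x : Eucl N) : ENNReal :=
  ENNReal.ofReal (φ x ^ 2 + ‖∇ φ x‖ ^ 2)

lemma continuous_energyDensity {φ : Eucl N → ℝ} (hφ : ContDiff ℝ ∞ φ) :
    Continuous (energyDensity φ) := by
  have h1 := hφ.continuous
  have h2 := continuous_gradient hφ
  exact ENNReal.continuous_ofReal.comp (by fun_prop)

lemma ofReal_sq_le_lintegral_segment {φ : Eucl N → ℝ} (hφ : ContDiff ℝ ∞ φ) {e : Eucl N}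
    (he : ‖e‖ = 1) (x : Eucl N) {δ : ℝ} (hδ : 0 < δ) :
    ENNReal.ofReal (φ x ^ 2)
      ≤ ENNReal.ofReal (1 / δ + 1) * ∫⁻ s in Ioc 0 δ, energyDensity φ (x + s • e) := by
  have hd : ∀ s, HasDerivAt (fun s : ℝ => φ (x + s • e)) (⟪e, ∇ φ (x + s • e)⟫_ℝ) s := by
    intro s
    rw [inner_gradient]
    have h1 : HasDerivAt (fun s : ℝ => x + s • e) e s := by
      simpa using ((hasDerivAt_id s).smul_const e).const_add x
    exact ((hφ.differentiable (by simp) (x + s • e)).hasFDerivAt).comp_hasDerivAt s h1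
  have hg := continuous_gradient hφ
  have hφc := hφ.continuous
  have h := sq_le_integral_of_contDiff hd (by fun_prop) hδ
  have h' : φ x ^ 2 ≤ ∫ s in Ioc 0 δ, (1 / δ + 1) *
      (φ (x + s • e) ^ 2 + ‖∇ φ (x + s • e)‖ ^ 2) := by
    simp only [zero_smul, add_zero] at h
    refine h.trans ?_
    rw [intervalIntegral.integral_of_le hδ.le]
    refine integral_mono (Continuous.integrableOn_Ioc (by fun_prop))
      (Continuous.integrableOn_Ioc (by fun_prop)) fun s => ?_
    have h3 : ⟪e, ∇ φ (x + s • e)⟫_ℝ ^ 2 ≤ ‖∇ φ (x + s • e)‖ ^ 2 := by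
      rw [sq_le_sq, abs_norm]
      simpa [he] using abs_real_inner_le_norm e (∇ φ (x + s • e))
    simp only
    gcongr
  refine (ENNReal.ofReal_le_ofReal h').trans ?_
  rw [ofReal_integral_eq_lintegral_ofReal (Continuous.integrableOn_Ioc (by fun_prop))
    (Eventually.of_forall fun s => by positivity), ← lintegral_const_mul']
  · simp only [energyDensity]
    refine lintegral_mono fun s => ?_
    rw [ENNReal.ofReal_mul (by positivity)]
  · exact ENNReal.ofReal_ne_top

section Graph

/-- The Hausdorff measure on the hyperplane orthogonal to `e`. -/
def hyperplaneMeasure (e : Eucl N) : Measure ((ℝ ∙ e)ᗮ : Submodule ℝ (Eucl N)) :=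
  Measure.euclideanHausdorffMeasure (N - 1)

/-- The hyperplane has dimension exactly `N - 1`, which makes its Hausdorff measure of that
dimension a Haar measure. -/
lemma isAddHaarMeasure_hyperplaneMeasure {e : Eucl N} (hN : 1 ≤ N) (he : ‖e‖ = 1) :
    (hyperplaneMeasure e).IsAddHaarMeasure := by
  have : Fact (Module.finrank ℝ (Eucl N) = (N - 1) + 1) := ⟨by simp; omega⟩
  have hfr : Module.finrank ℝ ((ℝ ∙ e)ᗮ : Submodule ℝ (Eucl N)) = N - 1 :=
    Submodule.finrank_orthogonal_span_singleton (by rw [← norm_pos_iff, he]; exact one_pos)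
  have := isAddHaarMeasure_euclideanHausdorffMeasure (E := ((ℝ ∙ e)ᗮ : Submodule ℝ (Eucl N)))
  rw [hfr] at this
  exact this

/-- Fubini's theorem for the decomposition of `ℝ^N` into a line and its orthogonal hyperplane. -/
lemma exists_lintegral_hyperplane {e : Eucl N} (hN : 1 ≤ N) (he : ‖e‖ = 1) :
    ∃ c : ENNReal, c ≠ ⊤ ∧ ∀ q : Eucl N → ENNReal, Measurable q →
      ∫⁻ y, (∫⁻ s : ℝ, q (y + s • e)) ∂(hyperplaneMeasure e) = c * ∫⁻ x, q x := by
  have := isAddHaarMeasure_hyperplaneMeasure hN he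
  let Λ : ((ℝ ∙ e)ᗮ : Submodule ℝ (Eucl N)) × ℝ →ₗ[ℝ] Eucl N :=
    LinearMap.coprod ((ℝ ∙ e)ᗮ : Submodule ℝ (Eucl N)).subtype
      (LinearMap.toSpanSingleton ℝ (Eucl N) e)
  have hΛ : ∀ y s, Λ (y, s) = y + s • e := fun y s => by simp [Λ]
  have hsurj : Function.Surjective Λ := by
    intro x
    refine ⟨(⟨x - ⟪e, x⟫_ℝ • e, ?_⟩, ⟪e, x⟫_ℝ), by rw [hΛ]; simp⟩
    rw [Submodule.mem_orthogonal_singleton_iff_inner_right, inner_sub_right, inner_smul_right,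
      real_inner_self_eq_norm_sq, he]
    simp
  -- A trivial kernel is compact, so its Haar mass is finite; this makes the constant in Fubini's
  -- formula finite, and no more about it is needed.
  have hinj : Subsingleton (LinearMap.ker Λ) := by
    refine (Submodule.subsingleton_iff_eq_bot).2 (LinearMap.ker_eq_bot'.2 ?_)
    rintro ⟨y, s⟩ h
    rw [hΛ] at h
    have hy := (Submodule.mem_orthogonal_singleton_iff_inner_right).1 y.2
    have hs : s = 0 := by
      have := congrArg (fun x => ⟪e, x⟫_ℝ) h
      simpa [inner_add_right, inner_smul_right, hy, he] using this
    subst hs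
    simpa using h
  obtain ⟨c, hc0, hc, hmap⟩ := Λ.exists_map_addHaar_eq_smul_addHaar'
    ((hyperplaneMeasure e).prod volume) volume hsurj
  have hfin : Measure.addHaar (univ : Set (LinearMap.ker Λ)) ≠ ⊤ :=
    isCompact_univ.measure_lt_top.ne
  refine ⟨_, ENNReal.mul_ne_top hc.ne hfin, fun q hq => ?_⟩
  have hΛm : Measurable Λ := Λ.continuous_of_finiteDimensional.measurable
  have h1 : ∫⁻ x, q x ∂(Measure.map Λ ((hyperplaneMeasure e).prod volume)) = c * Measure.addHaar (univ : Set (LinearMap.ker Λ)) *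
      ∫⁻ x, q x := by
    rw [hmap, lintegral_smul_measure, smul_eq_mul]
  rw [← h1, lintegral_map hq hΛm, lintegral_prod (fun a => q (Λ a)) (hq.comp hΛm).aemeasurable]
  simp only [hΛ]

/-- The graph of `ψ` over the hyperplane orthogonal to `e`. -/
def graphMap (e : Eucl N) (ψ : Eucl N → ℝ) (y : ((ℝ ∙ e)ᗮ : Submodule ℝ (Eucl N))) : Eucl N :=
  y + ψ y • e

lemma lipschitzWith_graphMap {e : Eucl N} (he : ‖e‖ = 1) {k : NNReal} {ψ : Eucl N → ℝ}
    (hψ : LipschitzWith k ψ) : LipschitzWith (1 + k) (graphMap e ψ) := by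
  refine LipschitzWith.of_dist_le_mul fun y z => ?_
  have h1 := hψ.dist_le_mul (y : Eucl N) z
  rw [dist_eq_norm, Real.norm_eq_abs, dist_eq_norm] at h1
  rw [dist_eq_norm, dist_eq_norm]
  calc ‖graphMap e ψ y - graphMap e ψ z‖
      = ‖((y : Eucl N) - z) + (ψ y - ψ z) • e‖ := by
        congr 1; simp only [graphMap, sub_smul]; abel
    _ ≤ ‖(y : Eucl N) - z‖ + |ψ y - ψ z| := by
        refine (norm_add_le _ _).trans ?_
        rw [norm_smul, he, mul_one, Real.norm_eq_abs]
    _ ≤ ((1 + k : NNReal) : ℝ) * ‖y - z‖ := by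
        have : ‖y - z‖ = ‖(y : Eucl N) - z‖ := rfl
        push_cast
        rw [this]
        linarith

/-- Each point of `A` is the image under `graphMap` of its orthogonal projection, and a Lipschitz
map with constant `1 + k` enlarges Hausdorff measure of dimension `N - 1` by at most the power `N -
1` of that constant. The normalising factors on the two sides agree. -/
lemma restrict_graph_le {e : Eucl N} (he : ‖e‖ = 1) {k : NNReal} {ψ : Eucl N → ℝ}
    (hψ : LipschitzWith k ψ) {A : Set (Eucl N)} (hA : MeasurableSet A)
    (hgr : ∀ x ∈ A, ψ (x - ⟪e, x⟫_ℝ • e) = ⟪e, x⟫_ℝ) :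
    (Measure.euclideanHausdorffMeasure (N - 1)).restrict A
      ≤ (((1 + k : NNReal) : ENNReal) ^ ((N - 1 : ℕ) : ℝ)) •
        (Measure.map (graphMap e ψ) (hyperplaneMeasure e)).restrict A := by
  have hL := lipschitzWith_graphMap he hψ
  refine Measure.le_iff.2 fun s hs => ?_
  rw [Measure.smul_apply, Measure.restrict_apply hs, Measure.restrict_apply hs,
    Measure.map_apply hL.continuous.measurable (hs.inter hA), smul_eq_mul]
  have hsub : s ∩ A ⊆ graphMap e ψ '' (graphMap e ψ ⁻¹' (s ∩ A)) := by
    intro x hx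
    have hPx : x - ⟪e, x⟫_ℝ • e ∈ ((ℝ ∙ e)ᗮ : Submodule ℝ (Eucl N)) := by
      rw [Submodule.mem_orthogonal_singleton_iff_inner_right, inner_sub_right, inner_smul_right,
        real_inner_self_eq_norm_sq, he]
      simp
    have hx' : graphMap e ψ ⟨_, hPx⟩ = x := by simp [graphMap, hgr x hx.2]
    exact ⟨⟨_, hPx⟩, by rw [mem_preimage, hx']; exact hx, hx'⟩
  refine (measure_mono hsub).trans ?_
  have := hL.hausdorffMeasure_image_le (d := ((N - 1 : ℕ) : ℝ)) (by positivity)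
    (graphMap e ψ ⁻¹' (s ∩ A))
  rw [hyperplaneMeasure, Measure.euclideanHausdorffMeasure_def,
    Measure.euclideanHausdorffMeasure_def, Measure.smul_apply, Measure.smul_apply,
    ENNReal.smul_def, ENNReal.smul_def, smul_eq_mul, smul_eq_mul, mul_left_comm]
  gcongr

end Graph

/-- Near `p` the boundary is a graph. The value at a boundary point is bounded by the energy on a
short segment running upward from it into `Ω`, and integrating over the base hyperplane sweeps these
segments out into a volume integral. -/
lemma local_trace_inequality (hN : 1 ≤ N) (hΩ : IsLipschitzDomain Ω) {p : Eucl N}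
    (hp : p ∈ frontier Ω) : ∃ r > 0, ∃ C : ENNReal, C ≠ ⊤ ∧ ∀ φ : Eucl N → ℝ, ContDiff ℝ ∞ φ →
      ∫⁻ x in Metric.ball p r, ENNReal.ofReal (φ x ^ 2) ∂(surfaceMeasure Ω)
        ≤ C * ∫⁻ x in Ω, energyDensity φ x := by
  obtain ⟨e, r, k, ψ, he, hr, hψ, hgr⟩ := hΩ.exists_graph p hp
  obtain ⟨c, hc, hfub⟩ := exists_lintegral_hyperplane hN he
  set A : Set (Eucl N) := Metric.ball p (r / 2) ∩ frontier Ω with hA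
  have hAm : MeasurableSet A := Metric.isOpen_ball.measurableSet.inter isClosed_frontier.measurableSet
  -- Boundary points lie on the graph: they are limits of points strictly above it, and are not
  -- themselves strictly above it because `Ω` is open.
  have hAgr : ∀ x ∈ A, ψ (x - ⟪e, x⟫_ℝ • e) = ⟪e, x⟫_ℝ := by
    rintro x ⟨hxb, hxf⟩
    have hxb' : x ∈ Metric.ball p r := Metric.ball_subset_ball (by linarith) hxb
    rw [hΩ.isOpen.frontier_eq] at hxf
    refine le_antisymm ?_ (not_lt.1 fun h => hxf.2 ((hgr x hxb').2 h))
    have hcl : x ∈ closure (Metric.ball p r ∩ Ω) :=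
      Metric.isOpen_ball.inter_closure ⟨hxb', hxf.1⟩
    have hclosed : IsClosed {x | ψ (x - ⟪e, x⟫_ℝ • e) ≤ ⟪e, x⟫_ℝ} := by
      have := hψ.continuous
      exact isClosed_le (by fun_prop) (by fun_prop)
    exact closure_minimal (fun z hz => ((hgr z hz.1).1 hz.2).le) hclosed hcl
  -- Moving along `e` keeps the horizontal component and raises the height. The radius `r / 2` of
  -- `A` and the length `r / 4` together stay within the chart of radius `r`.
  have hAΩ : ∀ x ∈ A, ∀ s ∈ Ioc 0 (r / 4), x + s • e ∈ Ω := by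
    intro x hx s hs
    have hxs : x + s • e ∈ Metric.ball p r := by
      have := hx.1
      rw [Metric.mem_ball, dist_eq_norm] at this ⊢
      calc ‖x + s • e - p‖ = ‖(x - p) + s • e‖ := by congr 1; abel
        _ ≤ ‖x - p‖ + s := by
          refine (norm_add_le _ _).trans ?_
          rw [norm_smul, he, mul_one, Real.norm_eq_abs, abs_of_pos hs.1]
        _ < r := by linarith [hs.2]
    rw [hgr _ hxs]
    have h1 : ⟪e, x + s • e⟫_ℝ = ⟪e, x⟫_ℝ + s := by
      rw [inner_add_right, inner_smul_right, real_inner_self_eq_norm_sq, he]; simp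
    have h2 : x + s • e - ⟪e, x + s • e⟫_ℝ • e = x - ⟪e, x⟫_ℝ • e := by
      rw [h1, add_smul]; abel
    rw [h2, h1, hAgr x hx]
    linarith [hs.1]
  set C₁ : ENNReal := ((1 + k : NNReal) : ENNReal) ^ ((N - 1 : ℕ) : ℝ) with hC₁
  have hC₁t : C₁ ≠ ⊤ := ENNReal.rpow_ne_top_of_nonneg (by positivity) ENNReal.coe_ne_top
  set C₂ : ENNReal := ENNReal.ofReal (1 / (r / 4) + 1) with hC₂
  refine ⟨r / 2, by positivity, C₁ * (C₂ * c), ENNReal.mul_ne_top hC₁t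
    (ENNReal.mul_ne_top ENNReal.ofReal_ne_top hc), fun φ hφ => ?_⟩
  set Q : Eucl N → ENNReal := Ω.indicator (energyDensity φ) with hQ
  have hQm : Measurable Q :=
    (continuous_energyDensity hφ).measurable.indicator hΩ.isOpen.measurableSet
  have hφm : Measurable fun x => ENNReal.ofReal (φ x ^ 2) := by
    have := hφ.continuous.measurable
    fun_prop
  have hGm : Measurable (graphMap e ψ) := (lipschitzWith_graphMap he hψ).continuous.measurable
  have hpt : ∀ y, A.indicator (fun x => ENNReal.ofReal (φ x ^ 2)) (graphMap e ψ y)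
      ≤ C₂ * ∫⁻ s : ℝ, Q (y + s • e) := by
    intro y
    by_cases hy : graphMap e ψ y ∈ A
    · rw [indicator_of_mem hy]
      refine (ofReal_sq_le_lintegral_segment hφ he _ (by positivity : 0 < r / 4)).trans ?_
      refine mul_le_mul_right ?_ _
      calc ∫⁻ s in Ioc 0 (r / 4), energyDensity φ (graphMap e ψ y + s • e)
          = ∫⁻ s in Ioc 0 (r / 4), Q (graphMap e ψ y + s • e) := by
            refine setLIntegral_congr_fun measurableSet_Ioc fun s hs => ?_
            simp only [hQ, indicator_of_mem (hAΩ _ hy s hs)]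
        _ ≤ ∫⁻ s, Q (graphMap e ψ y + s • e) := setLIntegral_le_lintegral _ _
        -- Once the integral runs over the whole line, a shift by `ψ y` replaces the graph point by
        -- its base point, which is the form required by Fubini.
        _ = ∫⁻ s : ℝ, Q (y + s • e) := by
            rw [← lintegral_add_left_eq_self (fun s : ℝ => Q (y + s • e)) (ψ y)]
            simp only [graphMap, add_smul, add_assoc]
    · rw [indicator_of_notMem hy]; exact bot_le
  calc ∫⁻ x in Metric.ball p (r / 2), ENNReal.ofReal (φ x ^ 2) ∂(surfaceMeasure Ω)
      = ∫⁻ x, ENNReal.ofReal (φ x ^ 2)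
          ∂((Measure.euclideanHausdorffMeasure (N - 1)).restrict A) := by
        rw [surfaceMeasure, Measure.restrict_restrict Metric.isOpen_ball.measurableSet]
    _ ≤ ∫⁻ x, ENNReal.ofReal (φ x ^ 2)
          ∂(C₁ • (Measure.map (graphMap e ψ) (hyperplaneMeasure e)).restrict A) :=
        lintegral_mono' (restrict_graph_le he hψ hAm hAgr) le_rfl
    _ = C₁ * ∫⁻ y, A.indicator (fun x => ENNReal.ofReal (φ x ^ 2)) (graphMap e ψ y)
          ∂(hyperplaneMeasure e) := by
        rw [lintegral_smul_measure, smul_eq_mul, ← lintegral_indicator hAm,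
          lintegral_map (hφm.indicator hAm) hGm]
    _ ≤ C₁ * ∫⁻ y, (C₂ * ∫⁻ s : ℝ, Q (y + s • e)) ∂(hyperplaneMeasure e) := by
        refine mul_le_mul_right ?_ _
        exact lintegral_mono hpt
    _ = C₁ * (C₂ * c) * ∫⁻ x in Ω, energyDensity φ x := by
        rw [lintegral_const_mul' _ _ ENNReal.ofReal_ne_top, hfub Q hQm, hQ,
          lintegral_indicator hΩ.isOpen.measurableSet]
        ring

/-- The trace inequality for functions smooth up to the boundary. -/
lemma trace_inequality_smooth (hN : 1 ≤ N) (hΩ : IsLipschitzDomain Ω) :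
    ∃ C : ENNReal, C ≠ ⊤ ∧ ∀ φ : Eucl N → ℝ, ContDiff ℝ ∞ φ →
      ∫⁻ x, ENNReal.ofReal (φ x ^ 2) ∂(surfaceMeasure Ω) ≤ C * ∫⁻ x in Ω, energyDensity φ x := by
  have hcomp : IsCompact (frontier Ω) :=
    hΩ.isBounded.isCompact_closure.of_isClosed_subset isClosed_frontier frontier_subset_closure
  have key : ∃ C : ENNReal, C ≠ ⊤ ∧ ∀ φ : Eucl N → ℝ, ContDiff ℝ ∞ φ →
      ∫⁻ x in frontier Ω, ENNReal.ofReal (φ x ^ 2) ∂(surfaceMeasure Ω)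
        ≤ C * ∫⁻ x in Ω, energyDensity φ x := by
    refine hcomp.induction_on (p := fun s => ∃ C : ENNReal, C ≠ ⊤ ∧
      ∀ φ : Eucl N → ℝ, ContDiff ℝ ∞ φ →
      ∫⁻ x in s, ENNReal.ofReal (φ x ^ 2) ∂(surfaceMeasure Ω)
        ≤ C * ∫⁻ x in Ω, energyDensity φ x) ?_ ?_ ?_ ?_
    · exact ⟨0, ENNReal.zero_ne_top, fun φ _ => by simp⟩
    · rintro s t hst ⟨C, hC, h⟩
      exact ⟨C, hC, fun φ hφ => (lintegral_mono_set hst).trans (h φ hφ)⟩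
    · rintro s t ⟨C, hC, h⟩ ⟨C', hC', h'⟩
      refine ⟨C + C', ENNReal.add_ne_top.2 ⟨hC, hC'⟩, fun φ hφ => ?_⟩
      rw [add_mul]
      exact (lintegral_union_le _ _ _).trans (add_le_add (h φ hφ) (h' φ hφ))
    · intro p hp
      obtain ⟨r, hr, C, hC, h⟩ := local_trace_inequality hN hΩ hp
      exact ⟨_, mem_nhdsWithin_of_mem_nhds (Metric.ball_mem_nhds p hr), C, hC, h⟩
  obtain ⟨C, hC, h⟩ := key
  refine ⟨C, hC, fun φ hφ => ?_⟩
  have := h φ hφ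
  rwa [surfaceMeasure, Measure.restrict_restrict isClosed_frontier.measurableSet, inter_self]
    at this

/-- This is the trace inequality for the constant function `1`, whose energy is the volume of the
bounded set `Ω`. -/
lemma isFiniteMeasure_surfaceMeasure (hN : 1 ≤ N) (hΩ : IsLipschitzDomain Ω) :
    IsFiniteMeasure (surfaceMeasure Ω) := by
  obtain ⟨C, hC, h⟩ := trace_inequality_smooth hN hΩ
  have := hΩ.isFiniteMeasure
  have h1 := h (fun _ => 1) contDiff_const
  have h2 : ∀ x, energyDensity (fun _ : Eucl N => (1 : ℝ)) x = 1 := fun x => by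
    rw [energyDensity, gradient_fun_const]; simp
  simp only [h2, lintegral_const, one_mul, one_pow, ENNReal.ofReal_one] at h1
  exact ⟨h1.trans_lt (ENNReal.mul_lt_top hC.lt_top (measure_lt_top _ _))⟩

end TraceInequality

/-! ### The trace operator on `H¹(Ω)`. -/

section TraceOperator

variable {N : ℕ} {Ω : Set (Eucl N)}

lemma memLp_surfaceMeasure (hN : 1 ≤ N) (hΩ : IsLipschitzDomain Ω) {φ : Eucl N → ℝ}
    (hφ : Continuous φ) : MemLp φ 2 (surfaceMeasure Ω) := by
  have := isFiniteMeasure_surfaceMeasure hN hΩ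
  obtain ⟨C, hC⟩ := hΩ.isBounded.isCompact_closure.exists_bound_of_continuousOn hφ.continuousOn
  refine MemLp.of_bound hφ.aestronglyMeasurable C ?_
  rw [surfaceMeasure]
  exact (ae_restrict_iff' isClosed_frontier.measurableSet).2
    (Eventually.of_forall fun x hx => hC x (frontier_subset_closure hx))

/-- The restriction to `Γ` of a smooth function. -/
def bdryOfSmooth (hN : 1 ≤ N) (hΩ : IsLipschitzDomain Ω) {φ : Eucl N → ℝ}
    (hφ : ContDiff ℝ ∞ φ) : L2Bdry Ω :=
  (memLp_surfaceMeasure hN hΩ hφ.continuous).toLp φ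

lemma norm_toLp_sq {α : Type*} [MeasurableSpace α] {μ : Measure α} {E : Type*}
    [NormedAddCommGroup E] [InnerProductSpace ℝ E] {a : α → E} (ha : MemLp a 2 μ) :
    ‖ha.toLp a‖ ^ 2 = ∫ x, ‖a x‖ ^ 2 ∂μ := by
  rw [← real_inner_self_eq_norm_sq, inner_toLp_left]
  refine integral_congr_ae ?_
  filter_upwards [ha.coeFn_toLp] with x hx
  rw [hx, real_inner_self_eq_norm_sq]

lemma exists_norm_bdryOfSmooth_le (hN : 1 ≤ N) (hΩ : IsLipschitzDomain Ω) :
    ∃ C : ℝ, 0 ≤ C ∧ ∀ (φ : Eucl N → ℝ) (hφ : ContDiff ℝ ∞ φ),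
      ‖bdryOfSmooth hN hΩ hφ‖ ≤ C * ‖H1.ofSmooth hΩ.isBounded hφ‖ := by
  obtain ⟨C, hC, h⟩ := trace_inequality_smooth hN hΩ
  refine ⟨Real.sqrt C.toReal, Real.sqrt_nonneg _, fun φ hφ => ?_⟩
  have h1 : ‖bdryOfSmooth hN hΩ hφ‖ ^ 2
      = (∫⁻ x, ENNReal.ofReal (φ x ^ 2) ∂(surfaceMeasure Ω)).toReal := by
    rw [bdryOfSmooth, norm_toLp_sq, integral_eq_lintegral_of_nonneg_ae
      (Eventually.of_forall fun x => by positivity)]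
    · simp
    · exact (hφ.continuous.norm.pow 2).aestronglyMeasurable
  have hf := memLp_restrict_of_continuous hΩ.isBounded hφ.continuous 2 volume
  have hg := memLp_restrict_of_continuous hΩ.isBounded (continuous_gradient hφ) 2 volume
  have hc : Continuous fun x => φ x ^ 2 + ‖∇ φ x‖ ^ 2 :=
    (hφ.continuous.pow 2).add ((continuous_gradient hφ).norm.pow 2)
  have h2 : ‖H1.ofSmooth hΩ.isBounded hφ‖ ^ 2 = (∫⁻ x in Ω, energyDensity φ x).toReal := by
    rw [H1.norm_sq_eq, H1.ofSmooth_fn, H1.ofSmooth_grad, norm_toLp_sq, norm_toLp_sq,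
      ← integral_add hf.norm.integrable_sq hg.norm.integrable_sq]
    simp only [energyDensity]
    rw [← integral_eq_lintegral_of_nonneg_ae (Eventually.of_forall fun x => by positivity)
      hc.aestronglyMeasurable]
    simp
  have hfin : ∫⁻ x in Ω, energyDensity φ x ≠ ⊤ := by
    have : Integrable (fun x => φ x ^ 2 + ‖∇ φ x‖ ^ 2) (volume.restrict Ω) :=
      hf.integrable_sq.add hg.norm.integrable_sq
    exact this.lintegral_lt_top.ne
  have h3 := ENNReal.toReal_mono (ENNReal.mul_ne_top hC hfin) (h φ hφ)
  rw [ENNReal.toReal_mul, ← h1, ← h2] at h3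
  refine abs_le_of_sq_le_sq' ?_ (by positivity) |>.2
  rwa [mul_pow, Real.sq_sqrt ENNReal.toReal_nonneg]

lemma tendsto_Lp_iff_eLpNorm {α : Type*} [MeasurableSpace α] {μ : Measure α} {E : Type*}
    [NormedAddCommGroup E] {f : ℕ → Lp E 2 μ} {a : ℕ → α → E} (ha : ∀ k, f k =ᵐ[μ] a k)
    (l : Lp E 2 μ) :
    Tendsto f atTop (𝓝 l) ↔ Tendsto (fun k => eLpNorm (fun x => a k x - l x) 2 μ) atTop (𝓝 0) := by
  rw [Lp.tendsto_Lp_iff_tendsto_eLpNorm']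
  refine Iff.of_eq (congrArg (fun z => Tendsto z atTop (𝓝 0)) (funext fun k => ?_))
  refine eLpNorm_congr_ae ?_
  filter_upwards [ha k] with x hx
  simp [hx]

lemma tendsto_h1_iff {f : ℕ → H1 Ω} {u : H1 Ω} : Tendsto f atTop (𝓝 u) ↔
    Tendsto (fun k => (f k).fn) atTop (𝓝 u.fn) ∧ Tendsto (fun k => (f k).grad) atTop (𝓝 u.grad) := by
  constructor
  · intro h
    exact ⟨(H1.fnL.continuous.tendsto u).comp h, (H1.gradL.continuous.tendsto u).comp h⟩
  · rintro ⟨h1, h2⟩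
    rw [tendsto_iff_norm_sub_tendsto_zero] at h1 h2 ⊢
    have h3 := (h1.pow 2).add (h2.pow 2)
    have h4 : Tendsto (fun k => ‖f k - u‖ ^ 2) atTop (𝓝 0) := by
      simp only [H1.norm_sq_eq, H1.fn_sub, H1.grad_sub]
      simpa using h3
    simpa using h4.sqrt

/-- This presents the graph of the trace as the closure of the pairs `(φ, φ|Γ)` in `H¹(Ω) × L²(Γ)`,
so that linearity, boundedness and uniqueness pass to limits. -/
lemma hasTrace_iff_tendsto (hN : 1 ≤ N) (hΩ : IsLipschitzDomain Ω) (u : H1 Ω) (w : L2Bdry Ω) :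
    HasTrace u w ↔ ∃ (φ : ℕ → Eucl N → ℝ) (hφ : ∀ k, ContDiff ℝ ∞ (φ k)),
      Tendsto (fun k => H1.ofSmooth hΩ.isBounded (hφ k)) atTop (𝓝 u) ∧
      Tendsto (fun k => bdryOfSmooth hN hΩ (hφ k)) atTop (𝓝 w) := by
  refine exists_congr fun φ => ?_
  rw [← exists_prop]
  refine exists_congr fun hφ => ?_
  rw [tendsto_h1_iff, tendsto_Lp_iff_eLpNorm (fun k => H1.ofSmooth_fn_ae hΩ.isBounded (hφ k)),
    tendsto_Lp_iff_eLpNorm (fun k => H1.ofSmooth_grad_ae hΩ.isBounded (hφ k)),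
    tendsto_Lp_iff_eLpNorm (f := fun k => bdryOfSmooth hN hΩ (hφ k)) (a := φ)
      (fun k => MemLp.coeFn_toLp (memLp_surfaceMeasure hN hΩ (hφ k).continuous)), and_assoc]

/-- The trace operator `H¹(Ω) → L²(Γ)` of a Lipschitz domain. -/
lemma exists_trace_operator (hN : 1 ≤ N) (hΩ : IsLipschitzDomain Ω) :
    ∃ tr : H1 Ω →L[ℝ] L2Bdry Ω, ∀ u w, HasTrace u w ↔ w = tr u := by
  obtain ⟨C, hC0, hC⟩ := exists_norm_bdryOfSmooth_le hN hΩ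
  have hadd : ∀ u v w z, HasTrace (Ω := Ω) u w → HasTrace v z → HasTrace (u + v) (w + z) := by
    intro u v w z h1 h2
    rw [hasTrace_iff_tendsto hN hΩ] at h1 h2 ⊢
    obtain ⟨φ, hφ, h1, h1'⟩ := h1
    obtain ⟨χ, hχ, h2, h2'⟩ := h2
    refine ⟨fun k => φ k + χ k, fun k => (hφ k).add (hχ k), ?_, ?_⟩
    · simpa only [H1.ofSmooth_add] using h1.add h2
    · exact h1'.add h2'
  have hsmul : ∀ (c : ℝ) u w, HasTrace (Ω := Ω) u w → HasTrace (c • u) (c • w) := by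
    intro c u w h1
    rw [hasTrace_iff_tendsto hN hΩ] at h1 ⊢
    obtain ⟨φ, hφ, h1, h1'⟩ := h1
    refine ⟨fun k => c • φ k, fun k => contDiff_const.smul (hφ k), ?_, ?_⟩
    · simpa only [H1.ofSmooth_smul] using h1.const_smul c
    · exact h1'.const_smul c
  have hbound : ∀ u w, HasTrace (Ω := Ω) u w → ‖w‖ ≤ C * ‖u‖ := by
    intro u w h
    obtain ⟨φ, hφ, h1, h1'⟩ := (hasTrace_iff_tendsto hN hΩ u w).1 h
    exact le_of_tendsto_of_tendsto' h1'.norm (h1.norm.const_mul C) fun k => hC _ (hφ k)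
  -- The difference of two traces of `u` is a trace of `0`, and the bound forces it to vanish.
  have huniq : ∀ u w z, HasTrace (Ω := Ω) u w → HasTrace u z → w = z := by
    intro u w z h1 h2
    have h3 := hbound _ _ (hadd _ _ _ _ h1 (hsmul (-1) _ _ h2))
    have h4 : w + (-1 : ℝ) • z = 0 := by
      rw [← norm_le_zero_iff]
      simpa using h3
    rwa [neg_one_smul, ← sub_eq_add_neg, sub_eq_zero] at h4
  have hex : ∀ u : H1 Ω, ∃ w, HasTrace u w := by
    intro u
    obtain ⟨φ, hφ, hlim⟩ := H1.exists_smooth_tendsto hΩ u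
    have hcau : CauchySeq fun k => bdryOfSmooth hN hΩ (hφ k) := by
      have h1 := hlim.cauchySeq
      rw [Metric.cauchySeq_iff] at h1 ⊢
      intro ε hε
      obtain ⟨n, hn⟩ := h1 (ε / (C + 1)) (by positivity)
      refine ⟨n, fun k hk l hl => ?_⟩
      have hs : bdryOfSmooth hN hΩ (hφ k) - bdryOfSmooth hN hΩ (hφ l)
          = bdryOfSmooth hN hΩ (φ := φ k + (-1 : ℝ) • φ l)
            ((hφ k).add (contDiff_const.smul (hφ l))) := by
        rw [sub_eq_add_neg, ← neg_one_smul ℝ (bdryOfSmooth hN hΩ (hφ l))]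
        rfl
      have hs' : H1.ofSmooth hΩ.isBounded (hφ k) - H1.ofSmooth hΩ.isBounded (hφ l)
          = H1.ofSmooth hΩ.isBounded (φ := φ k + (-1 : ℝ) • φ l)
            ((hφ k).add (contDiff_const.smul (hφ l))) := by
        rw [sub_eq_add_neg, ← neg_one_smul ℝ (H1.ofSmooth hΩ.isBounded (hφ l)),
          H1.ofSmooth_smul, H1.ofSmooth_add]
      have h2 := hn k hk l hl
      rw [dist_eq_norm] at h2 ⊢
      rw [hs'] at h2
      rw [hs]
      refine (hC _ _).trans_lt ?_
      rw [lt_div_iff₀ (by positivity)] at h2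
      nlinarith [norm_nonneg (H1.ofSmooth hΩ.isBounded (φ := φ k + (-1 : ℝ) • φ l)
            ((hφ k).add (contDiff_const.smul (hφ l))))]
    obtain ⟨w, hw⟩ := cauchySeq_tendsto_of_complete hcau
    exact ⟨w, (hasTrace_iff_tendsto hN hΩ u w).2 ⟨φ, hφ, hlim, hw⟩⟩
  choose tr htr using hex
  let trₗ : H1 Ω →ₗ[ℝ] L2Bdry Ω :=
    { toFun := tr
      map_add' := fun u v => huniq _ _ _ (htr _) (hadd _ _ _ _ (htr u) (htr v))
      map_smul' := fun c u => huniq _ _ _ (htr _) (hsmul c _ _ (htr u)) }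
  refine ⟨trₗ.mkContinuous C fun u => hbound u _ (htr u), fun u w => ⟨fun h => ?_, ?_⟩⟩
  · exact huniq u _ _ h (htr u)
  · rintro rfl
    exact htr u

/-- The support avoids the boundary, so the constant sequence `φ` serves as approximation. This is
how Green's formula will specialise to the weak Laplacian. -/
lemma IsTestFunction.hasTrace_zero (hN : 1 ≤ N) (hΩ : IsLipschitzDomain Ω) {φ : Eucl N → ℝ}
    (hφ : IsTestFunction Ω φ) : HasTrace (H1.ofSmooth hΩ.isBounded hφ.contDiff) 0 := by
  rw [hasTrace_iff_tendsto hN hΩ]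
  refine ⟨fun _ => φ, fun _ => hφ.contDiff, tendsto_const_nhds, ?_⟩
  have : bdryOfSmooth hN hΩ hφ.contDiff = 0 := by
    refine Lp.ext ?_
    have h0 : ∀ᵐ x ∂(surfaceMeasure Ω), φ x = 0 := by
      rw [surfaceMeasure]
      refine (ae_restrict_iff' isClosed_frontier.measurableSet).2 (Eventually.of_forall ?_)
      intro x hx
      rw [hΩ.isOpen.frontier_eq] at hx
      exact hφ.eq_zero hx.2
    filter_upwards [h0, Lp.coeFn_zero ℝ 2 (surfaceMeasure Ω),
      MemLp.coeFn_toLp (memLp_surfaceMeasure hN hΩ hφ.contDiff.continuous)] with x h1 h2 h3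
    rw [bdryOfSmooth, h3, h1, h2, Pi.zero_apply]
  exact tendsto_const_nhds.congr fun _ => this.symm

end TraceOperator

/-! ### Discrete Gronwall inequalities and the energy bound for an abstract Euler scheme. -/

section Euler

section Sums

lemma sum_Icc_one {M : Type*} [AddCommMonoid M] (f : ℕ → M) (n : ℕ) :
    ∑ i ∈ Finset.Icc 1 n, f i = ∑ i ∈ Finset.range n, f (i + 1) := by
  induction n with
  | zero => simp
  | succ n ih => rw [Finset.sum_Icc_succ_top (by omega), ih, Finset.sum_range_succ]

lemma sum_Icc_one_reflect {M : Type*} [AddCommMonoid M] (f : ℕ → M) (n : ℕ) :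
    ∑ k ∈ Finset.Icc 1 n, f (n - k) = ∑ l ∈ Finset.range n, f l := by
  rw [sum_Icc_one, ← Finset.sum_range_reflect f]
  refine Finset.sum_congr rfl fun i hi => ?_
  congr 1
  omega

lemma le_exp_mul_of_step {x : ℕ → ℝ} {c τ : ℝ} {n : ℕ} (hc : 0 ≤ c) (hτ : 0 ≤ τ) (h0 : 0 ≤ x 0)
    (h : ∀ i < n, x (i + 1) ≤ (1 + τ * c) * x i) :
    ∀ i ≤ n, x i ≤ Real.exp (c * (n * τ)) * x 0 := by
  have key : ∀ i ≤ n, x i ≤ Real.exp (c * (i * τ)) * x 0 := by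
    intro i hi
    induction i with
    | zero => simp
    | succ i ih =>
      have h1 : 1 + τ * c ≤ Real.exp (τ * c) := by linarith [Real.add_one_le_exp (τ * c)]
      have h2 : 0 ≤ Real.exp (c * (i * τ)) * x 0 := by positivity
      calc x (i + 1) ≤ (1 + τ * c) * x i := h i (by omega)
        _ ≤ (1 + τ * c) * (Real.exp (c * (i * τ)) * x 0) := by
          gcongr
          exact ih (by omega)
        _ ≤ Real.exp (τ * c) * (Real.exp (c * (i * τ)) * x 0) := by gcongr
        _ = Real.exp (c * ((i + 1 : ℕ) * τ)) * x 0 := by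
          rw [← mul_assoc, ← Real.exp_add]
          congr 2
          push_cast
          ring
  intro i hi
  refine (key i hi).trans ?_
  gcongr

/-- A discrete Gronwall inequality, in summed form. -/
lemma le_exp_mul_of_sum {x : ℕ → ℝ} {A c τ : ℝ} {n : ℕ} (hA : 0 ≤ A) (hc : 0 ≤ c) (hτ : 0 ≤ τ)
    (h : ∀ i ≤ n, x i ≤ A + c * ∑ l ∈ Finset.range i, τ * x l) :
    ∀ i ≤ n, A + c * ∑ l ∈ Finset.range i, τ * x l ≤ Real.exp (c * (n * τ)) * A := by
  have := le_exp_mul_of_step (x := fun i => A + c * ∑ l ∈ Finset.range i, τ * x l) (n := n) hc hτ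
    (by simpa using hA) (fun i hi => by
      simp only [Finset.sum_range_succ]
      have h1 := h i hi.le
      have : τ * c * x i ≤ τ * c * (A + c * ∑ l ∈ Finset.range i, τ * x l) := by gcongr
      linarith)
  simpa using this

lemma le_of_step_sum {x y : ℕ → ℝ} {n : ℕ} (h : ∀ i < n, x (i + 1) ≤ x i + y i) :
    ∀ i ≤ n, x i ≤ x 0 + ∑ l ∈ Finset.range i, y l := by
  intro i hi
  induction i with
  | zero => simp
  | succ i ih =>
    rw [Finset.sum_range_succ]
    linarith [h i (by omega), ih (by omega)]

lemma sum_range_le_of_nonneg {y : ℕ → ℝ} {i n : ℕ} (hi : i ≤ n) (hy : ∀ l, 0 ≤ y l) :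
    ∑ l ∈ Finset.range i, y l ≤ ∑ l ∈ Finset.range n, y l :=
  Finset.sum_le_sum_of_subset_of_nonneg (Finset.range_mono hi) fun l _ _ => hy l

lemma sq_sum_mul_le {y : ℕ → ℝ} {τ T : ℝ} {n : ℕ} (hτ : 0 ≤ τ) (hn : n * τ ≤ T) :
    (∑ l ∈ Finset.range n, τ * y l) ^ 2 ≤ T * ∑ l ∈ Finset.range n, τ * y l ^ 2 := by
  have h1 := sq_sum_le_card_mul_sum_sq (s := Finset.range n) (f := y)
  rw [Finset.card_range] at h1
  have h2 : 0 ≤ ∑ l ∈ Finset.range n, y l ^ 2 := Finset.sum_nonneg fun l _ => sq_nonneg _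
  rw [← Finset.mul_sum, ← Finset.mul_sum]
  calc (τ * ∑ l ∈ Finset.range n, y l) ^ 2
      = τ ^ 2 * (∑ l ∈ Finset.range n, y l) ^ 2 := by ring
    _ ≤ τ ^ 2 * (n * ∑ l ∈ Finset.range n, y l ^ 2) := by gcongr
    _ = (n * τ) * (τ * ∑ l ∈ Finset.range n, y l ^ 2) := by ring
    _ ≤ T * (τ * ∑ l ∈ Finset.range n, y l ^ 2) := by gcongr

lemma one_add_sq_le (s : ℝ) : (1 + s) ^ 2 ≤ 2 * (1 + s ^ 2) := by
  nlinarith [sq_nonneg (1 - s)]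

lemma one_add_mul_le_mul {p a : ℝ} (hp : 0 ≤ p) (ha : 0 ≤ a) : 1 + p * a ≤ (1 + p) * (1 + a) := by
  nlinarith

end Sums

section Abstract

variable {V L D B : Type*} [AddCommGroup V] [Module ℝ V]
  [NormedAddCommGroup L] [InnerProductSpace ℝ L] [NormedAddCommGroup D] [InnerProductSpace ℝ D]
  [NormedAddCommGroup B] [InnerProductSpace ℝ B]

/-- The source of both the telescoping term and the sum of squared increments in every estimate
below. -/
lemma inner_sub_self_right (a b : L) :
    ⟪a - b, a⟫_ℝ = (‖a‖ ^ 2 - ‖b‖ ^ 2 + ‖a - b‖ ^ 2) / 2 := by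
  rw [← real_inner_self_eq_norm_sq, ← real_inner_self_eq_norm_sq, ← real_inner_self_eq_norm_sq]
  simp only [inner_sub_left, inner_sub_right, real_inner_comm a b]
  ring

lemma abs_inner_le_mul {a b : L} {x y : ℝ} (ha : ‖a‖ ≤ x) (hb : ‖b‖ ≤ y) :
    |⟪a, b⟫_ℝ| ≤ x * y := by
  refine (abs_real_inner_le_norm a b).trans ?_
  have := norm_nonneg a
  gcongr
  linarith

/-- The weak equation of a backward Euler scheme, multiplied by the step. -/
def IsEulerStep (ι : V →ₗ[ℝ] L) (d : V →ₗ[ℝ] D) (tr : V →ₗ[ℝ] B) (τ : ℝ) (u u' : V) (G : B)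
    (R : L) : Prop :=
  ∀ φ : V, ⟪ι u' - ι u, ι φ⟫_ℝ + τ * ⟪d u', d φ⟫_ℝ + τ * ⟪G, tr φ⟫_ℝ = τ * ⟪R, ι φ⟫_ℝ

variable {ι : V →ₗ[ℝ] L} {d : V →ₗ[ℝ] D} {tr : V →ₗ[ℝ] B} {β : ℝ}

/-- The test function is `u'`. On the right, `‖ι u'‖` is replaced by `‖ι u‖ + ‖ι u' - ι u‖` and the
increment is absorbed on the left, so only the old value appears and no smallness of `τ` is
required. -/
lemma IsEulerStep.energy_step (hβ : 0 ≤ β) (htr : ∀ v, ‖tr v‖ ≤ β * (‖ι v‖ + ‖d v‖))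
    {τ γ : ℝ} (hτ : 0 < τ) {u u' : V} {G : B} {R : L} (hG : ‖G‖ ≤ γ)
    (h : IsEulerStep ι d tr τ u u' G R) :
    ‖ι u'‖ ^ 2 + (1 / 2 * ‖ι u' - ι u‖ ^ 2 + τ * ‖d u'‖ ^ 2) ≤ ‖ι u‖ ^ 2
      + τ * ((1 + 2 * τ) * (‖R‖ + γ * β) ^ 2 + ‖ι u‖ ^ 2 + (γ * β) ^ 2) := by
  have hγ : 0 ≤ γ := (norm_nonneg G).trans hG
  have h1 := h u'
  rw [inner_sub_self_right, real_inner_self_eq_norm_sq] at h1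
  have h2 := (abs_le.1 (abs_inner_le_mul hG (htr u'))).1
  have h3 := real_inner_le_norm R (ι u')
  have h4 : ‖ι u'‖ ≤ ‖ι u‖ + ‖ι u' - ι u‖ := by
    have := norm_add_le (ι u) (ι u' - ι u)
    rwa [add_sub_cancel] at this
  set ρ := ‖R‖ + γ * β with hρ
  have hρ0 : 0 ≤ ρ := by positivity
  set x := ‖ι u'‖
  set y := ‖ι u‖
  set w := ‖ι u' - ι u‖
  set z := ‖d u'‖
  have h5 : τ * ⟪R, ι u'⟫_ℝ - τ * ⟪G, tr u'⟫_ℝ ≤ τ * (ρ * (y + w) + γ * β * z) := by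
    have : ρ * x ≤ ρ * (y + w) := by gcongr
    rw [← mul_sub]
    gcongr
    rw [hρ] at *
    nlinarith
  have h6 : τ * (ρ * y) ≤ τ * (ρ ^ 2 / 2 + y ^ 2 / 2) := by
    gcongr; nlinarith [sq_nonneg (ρ - y)]
  have h7 : τ * (γ * β * z) ≤ τ * ((γ * β) ^ 2 / 2 + z ^ 2 / 2) := by
    gcongr; nlinarith [sq_nonneg (γ * β - z)]
  have h8 : τ * (ρ * w) ≤ w ^ 2 / 4 + τ ^ 2 * ρ ^ 2 := by nlinarith [sq_nonneg (w / 2 - τ * ρ)]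
  nlinarith

/-- The basic energy estimate for a backward Euler scheme with memory. -/
lemma exists_energy_bound (hβ : 0 ≤ β) (htr : ∀ v, ‖tr v‖ ≤ β * (‖ι v‖ + ‖d v‖))
    {T γ c : ℝ} (hT : 0 ≤ T) (hγ : 0 ≤ γ) (hc : 0 ≤ c) (u₀ : V) :
    ∃ C : ℝ, 0 < C ∧ ∀ (n : ℕ) (τ : ℝ) (u : ℕ → V) (G : ℕ → B) (R : ℕ → L), 0 < τ → n * τ ≤ T →
      u 0 = u₀ → (∀ i < n, ‖G i‖ ≤ γ) →
      (∀ i < n, ‖R i‖ ≤ c * (1 + ∑ l ∈ Finset.range (i + 1), τ * ‖ι (u l)‖)) →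
      (∀ i < n, IsEulerStep ι d tr τ (u i) (u (i + 1)) (G i) (R i)) →
      ∀ j ≤ n, ‖ι (u j)‖ ^ 2 + ∑ i ∈ Finset.range n, ‖d (u (i + 1))‖ ^ 2 * τ
        + ∑ i ∈ Finset.range n, ‖ι (u (i + 1)) - ι (u i)‖ ^ 2 ≤ C := by
  set c' := c + γ * β with hc'
  have hc'0 : 0 ≤ c' := by positivity
  -- The first summand pays for the source and memory. The `2` pays for `‖ι u_i‖ ^ 2` twice: once
  -- from the energy step and once from the growth of the history sum in `A`.
  set K := (1 + 2 * T) * (2 * c' ^ 2) * (1 + T * (1 + T)) + 2 + (γ * β) ^ 2 with hK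
  have hK0 : 0 ≤ K := by positivity
  set M := Real.exp (K * T) * (1 + ‖ι u₀‖ ^ 2) with hM
  refine ⟨3 * M, by positivity, fun n τ u G R hτ hnτ hu0 hG hR h => ?_⟩
  have hn : ∀ i < n, ((i + 1 : ℕ) : ℝ) * τ ≤ T := fun i hi => by
    refine le_trans ?_ hnτ
    gcongr
    exact_mod_cast hi
  -- Including the accumulated dissipation and the history sum makes `A i` dominate the squared
  -- memory (by Cauchy–Schwarz), so a one-step growth inequality suffices.
  set A : ℕ → ℝ := fun i => ‖ι (u i)‖ ^ 2
    + ∑ l ∈ Finset.range i, (1 / 2 * ‖ι (u (l + 1)) - ι (u l)‖ ^ 2 + τ * ‖d (u (l + 1))‖ ^ 2)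
    + ∑ l ∈ Finset.range i, τ * ‖ι (u l)‖ ^ 2 with hA
  have hs1 : ∀ i, 0 ≤ ∑ l ∈ Finset.range i,
      (1 / 2 * ‖ι (u (l + 1)) - ι (u l)‖ ^ 2 + τ * ‖d (u (l + 1))‖ ^ 2) := fun i =>
    Finset.sum_nonneg fun l _ => by positivity
  have hs2 : ∀ i, 0 ≤ ∑ l ∈ Finset.range i, τ * ‖ι (u l)‖ ^ 2 := fun i =>
    Finset.sum_nonneg fun l _ => by positivity
  have hstep : ∀ i < n, 1 + A (i + 1) ≤ (1 + τ * K) * (1 + A i) := by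
    intro i hi
    have hτT : τ ≤ T := by
      have := hn i hi
      push_cast at this
      have : 0 ≤ (i : ℝ) * τ := by positivity
      linarith
    have e1 := (h i hi).energy_step hβ htr hτ (hG i hi)
    have e2 := sq_sum_mul_le (y := fun l => ‖ι (u l)‖) hτ.le (hn i hi)
    set s := ∑ l ∈ Finset.range (i + 1), τ * ‖ι (u l)‖ with hs
    have hs0 : 0 ≤ s := Finset.sum_nonneg fun l _ => by positivity
    have hA0 : 0 ≤ A i := by
      have := hs1 i; have := hs2 i
      simp only [hA]; positivity
    have hai : ‖ι (u i)‖ ^ 2 ≤ A i := by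
      have := hs1 i; have := hs2 i
      simp only [hA]; linarith
    have e3 : ∑ l ∈ Finset.range (i + 1), τ * ‖ι (u l)‖ ^ 2 ≤ (1 + T) * A i := by
      rw [Finset.sum_range_succ]
      have h1 : ∑ l ∈ Finset.range i, τ * ‖ι (u l)‖ ^ 2 ≤ A i := by
        have := hs1 i
        have := sq_nonneg ‖ι (u i)‖
        simp only [hA]; linarith
      have h2 : τ * ‖ι (u i)‖ ^ 2 ≤ T * A i := by gcongr
      linarith
    have e4 : (‖R i‖ + γ * β) ^ 2 ≤ 2 * c' ^ 2 * ((1 + T * (1 + T)) * (1 + A i)) := by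
      have h1 : ‖R i‖ + γ * β ≤ c' * (1 + s) := by
        have := hR i hi
        have : 0 ≤ γ * β * s := by positivity
        rw [hc']; linarith
      calc (‖R i‖ + γ * β) ^ 2 ≤ (c' * (1 + s)) ^ 2 := by gcongr
        _ ≤ 2 * c' ^ 2 * (1 + s ^ 2) := by
          rw [mul_pow, mul_comm 2, mul_assoc]
          gcongr
          exact one_add_sq_le s
        _ ≤ 2 * c' ^ 2 * (1 + T * ((1 + T) * A i)) := by
          have h2 : s ^ 2 ≤ T * ((1 + T) * A i) := e2.trans (by gcongr)
          gcongr
        _ ≤ 2 * c' ^ 2 * ((1 + T * (1 + T)) * (1 + A i)) := by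
          gcongr
          rw [← mul_assoc]
          exact one_add_mul_le_mul (by positivity) hA0
    have e5 : (1 + 2 * τ) * (‖R i‖ + γ * β) ^ 2
        ≤ (1 + 2 * T) * (2 * c' ^ 2 * ((1 + T * (1 + T)) * (1 + A i))) := by gcongr
    have e6 : τ * ((1 + 2 * τ) * (‖R i‖ + γ * β) ^ 2 + ‖ι (u i)‖ ^ 2 + (γ * β) ^ 2)
        + τ * ‖ι (u i)‖ ^ 2 ≤ τ * (K * (1 + A i)) := by
      rw [← mul_add]
      gcongr
      have : (γ * β) ^ 2 ≤ (γ * β) ^ 2 * (1 + A i) :=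
        le_mul_of_one_le_right (sq_nonneg _) (by linarith)
      rw [hK]
      linarith
    have e7 : A (i + 1) = ‖ι (u (i + 1))‖ ^ 2 + (∑ l ∈ Finset.range i,
        (1 / 2 * ‖ι (u (l + 1)) - ι (u l)‖ ^ 2 + τ * ‖d (u (l + 1))‖ ^ 2)
        + (1 / 2 * ‖ι (u (i + 1)) - ι (u i)‖ ^ 2 + τ * ‖d (u (i + 1))‖ ^ 2))
        + (∑ l ∈ Finset.range i, τ * ‖ι (u l)‖ ^ 2 + τ * ‖ι (u i)‖ ^ 2) := by
      simp only [hA, Finset.sum_range_succ]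
    have e8 : A i = ‖ι (u i)‖ ^ 2
      + ∑ l ∈ Finset.range i, (1 / 2 * ‖ι (u (l + 1)) - ι (u l)‖ ^ 2 + τ * ‖d (u (l + 1))‖ ^ 2)
      + ∑ l ∈ Finset.range i, τ * ‖ι (u l)‖ ^ 2 := rfl
    linarith
  have hbd : ∀ i ≤ n, A i ≤ M := by
    intro i hi
    have h1 := le_exp_mul_of_step (x := fun i => 1 + A i) hK0 hτ.le
      (by simp only [hA]; simp; positivity) hstep i hi
    have h2 : A 0 = ‖ι u₀‖ ^ 2 := by simp [hA, hu0]
    rw [h2] at h1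
    have h3 : Real.exp (K * (n * τ)) * (1 + ‖ι u₀‖ ^ 2) ≤ M := by
      rw [hM]; gcongr
    linarith
  intro j hj
  have b1 : ‖ι (u j)‖ ^ 2 ≤ M := by
    have := hs1 j; have := hs2 j; have := hbd j hj
    simp only [hA] at this; linarith
  have b2 : ∑ l ∈ Finset.range n,
      (1 / 2 * ‖ι (u (l + 1)) - ι (u l)‖ ^ 2 + τ * ‖d (u (l + 1))‖ ^ 2) ≤ M := by
    have := hs2 n; have := hbd n le_rfl; have := sq_nonneg ‖ι (u n)‖
    simp only [hA] at *; linarith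
  have b3 : ∑ i ∈ Finset.range n, ‖d (u (i + 1))‖ ^ 2 * τ
        + ∑ i ∈ Finset.range n, ‖ι (u (i + 1)) - ι (u i)‖ ^ 2 ≤ 2 * M := by
    refine le_trans ?_ (mul_le_mul_of_nonneg_left b2 two_pos.le)
    rw [← Finset.sum_add_distrib, Finset.mul_sum]
    refine Finset.sum_le_sum fun i _ => ?_
    have : 0 ≤ τ * ‖d (u (i + 1))‖ ^ 2 := by positivity
    linarith
  linarith

end Abstract

end Euler

/-! ### Gradient and Laplacian bounds for an abstract Euler scheme. -/

section EulerGradientLaplacian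

section Sums

/-- The sequence shifted by one, starting with `0`. -/
def prev (f : ℕ → ℝ) : ℕ → ℝ
  | 0 => 0
  | i + 1 => f i

lemma sum_prev_le {f : ℕ → ℝ} (hf : ∀ i, 0 ≤ f i) (j : ℕ) :
    ∑ i ∈ Finset.range j, prev f i ≤ ∑ i ∈ Finset.range j, f i := by
  cases j with
  | zero => simp
  | succ j =>
    rw [Finset.sum_range_succ', Finset.sum_range_succ]
    simpa [prev] using hf j

/-- Discrete Gronwall for a Volterra inequality whose leading coefficient is bounded below by `η`;
it will be applied to the absolute values of the kernel. -/
lemma exists_bound_of_memory {T η c c' : ℝ} (hη : 0 < η) (hc : 0 ≤ c) (hc' : 0 ≤ c') :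
    ∃ C : ℝ, 0 ≤ C ∧ ∀ (n : ℕ) (τ : ℝ) (x : ℕ → ℝ), 0 < τ → n * τ ≤ T → (∀ i, 0 ≤ x i) →
      (∀ i < n, x i * η ≤ c + c' * ∑ l ∈ Finset.range i, τ * x l) → ∀ i < n, x i ≤ C := by
  refine ⟨Real.exp (c' / η * T) * (c / η), by positivity, fun n τ x hτ hn hx h i hi => ?_⟩
  have h1 : ∀ i < n, x i ≤ c / η + c' / η * ∑ l ∈ Finset.range i, τ * x l := fun i hi => by
    have := (le_div_iff₀ hη).2 (h i hi)
    rwa [add_div, mul_div_right_comm] at this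
  refine (h1 i hi).trans ((le_exp_mul_of_sum (n := i) (by positivity) (by positivity) hτ.le
    (fun l hl => h1 l (by omega)) i le_rfl).trans ?_)
  have : (i : ℝ) * τ ≤ T := le_trans (by gcongr) hn
  gcongr

end Sums

section Abstract

variable {V L D B : Type*} [AddCommGroup V] [Module ℝ V]
  [NormedAddCommGroup L] [InnerProductSpace ℝ L] [NormedAddCommGroup D] [InnerProductSpace ℝ D]
  [NormedAddCommGroup B] [InnerProductSpace ℝ B]
  {ι : V →ₗ[ℝ] L} {d : V →ₗ[ℝ] D} {tr : V →ₗ[ℝ] B} {β : ℝ}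

/-- The test function is `u' - u`. The boundary pairing is kept on both sides rather than estimated:
the trace of the increment has no bound of order `τ` at this stage, so this term has to be summed by
parts. -/
lemma IsEulerStep.gradient_step {τ : ℝ} (hτ : 0 < τ) {u u' : V} {G : B} {R : L}
    (h : IsEulerStep ι d tr τ u u' G R) :
    1 / 2 * ‖d u'‖ ^ 2 + ⟪G, tr u'⟫_ℝ
      + (1 / 2 * (‖τ⁻¹ • (ι u' - ι u)‖ ^ 2 * τ) + 1 / 2 * ‖d u' - d u‖ ^ 2)
      ≤ 1 / 2 * ‖d u‖ ^ 2 + ⟪G, tr u⟫_ℝ + τ * (‖R‖ ^ 2 / 2) := by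
  have h1 := h (u' - u)
  set δ := τ⁻¹ • (ι u' - ι u) with hδ
  have hw : ι u' - ι u = τ • δ := by rw [hδ, smul_inv_smul₀ hτ.ne']
  clear_value δ
  rw [map_sub, map_sub, map_sub, hw, real_inner_comm _ (d u'), inner_sub_self_right,
    inner_sub_right, inner_smul_left, inner_smul_right, inner_smul_right,
    real_inner_self_eq_norm_sq] at h1
  simp only [conj_trivial] at h1
  have h2 : τ * ‖δ‖ ^ 2 + (‖d u'‖ ^ 2 - ‖d u‖ ^ 2 + ‖d u' - d u‖ ^ 2) / 2
      + (⟪G, tr u'⟫_ℝ - ⟪G, tr u⟫_ℝ) = τ * ⟪R, δ⟫_ℝ := by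
    refine mul_left_cancel₀ hτ.ne' ?_
    linarith
  have h3 : τ * ⟪R, δ⟫_ℝ ≤ τ * (‖R‖ ^ 2 / 2 + ‖δ‖ ^ 2 / 2) := by
    gcongr
    have := real_inner_le_norm R δ
    nlinarith [sq_nonneg (‖R‖ - ‖δ‖)]
  linarith

/-- The estimate of gradients and difference quotients for a backward Euler scheme. -/
lemma exists_gradient_bound (hβ : 0 ≤ β) (htr : ∀ v, ‖tr v‖ ≤ β * (‖ι v‖ + ‖d v‖))
    {T γ γ' c C₁ : ℝ} (hT : 0 ≤ T) (hγ : 0 ≤ γ) (hγ' : 0 ≤ γ') (hC₁ : 0 ≤ C₁)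
    (u₀ : V) :
    ∃ C : ℝ, 0 < C ∧ ∀ (n : ℕ) (τ : ℝ) (u : ℕ → V) (G : ℕ → B) (R : ℕ → L), 0 < τ → n * τ ≤ T →
      u 0 = u₀ → (∀ i ≤ n, ‖G i‖ ≤ γ) → (∀ i < n, ‖G (i + 1) - G i‖ ≤ τ * γ') →
      (∀ i < n, ‖R i‖ ≤ c) →
      (∀ i < n, IsEulerStep ι d tr τ (u i) (u (i + 1)) (G (i + 1)) (R i)) →
      (∀ j ≤ n, ‖ι (u j)‖ ^ 2 ≤ C₁) → (∑ i ∈ Finset.range n, ‖d (u (i + 1))‖ ^ 2 * τ ≤ C₁) →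
      ∀ j ≤ n, ‖d (u j)‖ ^ 2 + ∑ i ∈ Finset.range n, ‖τ⁻¹ • (ι (u (i + 1)) - ι (u i))‖ ^ 2 * τ
        + ∑ i ∈ Finset.range n, ‖d (u (i + 1)) - d (u i)‖ ^ 2 ≤ C := by
  set k := c ^ 2 / 2 + γ' * β * (2 + C₁) with hk
  have hk0 : 0 ≤ k := by positivity
  set M := 1 / 2 * ‖d u₀‖ ^ 2 + γ * ‖tr u₀‖ + T * k + γ' * β * (T * ‖d u₀‖ ^ 2 + C₁)
    + γ * β * (1 + C₁) + (γ * β) ^ 2 with hM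
  have hM0 : 0 ≤ M := by positivity
  refine ⟨6 * M + 1, by positivity, fun n τ u G R hτ hnτ hu0 hG hG' hR h hC hC' => ?_⟩
  have hx : ∀ x : ℝ, x ≤ 1 + x ^ 2 := fun x => by nlinarith [sq_nonneg (x - 1)]
  set p : ℕ → ℝ := fun l => 1 / 2 * (‖τ⁻¹ • (ι (u (l + 1)) - ι (u l))‖ ^ 2 * τ)
    + 1 / 2 * ‖d (u (l + 1)) - d (u l)‖ ^ 2 with hp
  have hp0 : ∀ l, 0 ≤ p l := fun l => by positivity
  -- With the boundary pairing inside the energy, only the increment of `G` enters a step, and it is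
  -- of order `τ`. The pairing has no sign; it is finally controlled by half of the gradient term,
  -- which leaves the factor `1 / 4` in `hbd`.
  set E : ℕ → ℝ := fun i => 1 / 2 * ‖d (u i)‖ ^ 2 + ⟪G i, tr (u i)⟫_ℝ
    + ∑ l ∈ Finset.range i, p l with hE
  have hstep : ∀ i < n, E (i + 1) ≤ E i + (τ * k + γ' * β * (τ * ‖d (u i)‖ ^ 2)) := by
    intro i hi
    have e1 := (h i hi).gradient_step hτ
    have e2 : ⟪G (i + 1), tr (u i)⟫_ℝ - ⟪G i, tr (u i)⟫_ℝ
        ≤ τ * γ' * (β * (‖ι (u i)‖ + ‖d (u i)‖)) := by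
      rw [← inner_sub_left]
      exact (abs_le.1 (abs_inner_le_mul (hG' i hi) (htr (u i)))).2
    have e3 : τ * γ' * (β * (‖ι (u i)‖ + ‖d (u i)‖))
        ≤ τ * γ' * (β * ((2 + C₁) + ‖d (u i)‖ ^ 2)) := by
      have := hx ‖ι (u i)‖
      have := hx ‖d (u i)‖
      have := hC i hi.le
      refine mul_le_mul_of_nonneg_left (mul_le_mul_of_nonneg_left ?_ hβ) (by positivity)
      linarith
    have e4 : τ * (‖R i‖ ^ 2 / 2) ≤ τ * (c ^ 2 / 2) := by
      have := hR i hi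
      gcongr
    have e5 : ∑ l ∈ Finset.range (i + 1), p l = ∑ l ∈ Finset.range i, p l + p i :=
      Finset.sum_range_succ _ _
    simp only [hE, e5]
    simp only [hp, hk] at *
    linarith
  have hbd : ∀ j ≤ n, 1 / 4 * ‖d (u j)‖ ^ 2 + ∑ l ∈ Finset.range j, p l ≤ M := by
    intro j hj
    have e1 := le_of_step_sum hstep j hj
    have e2 : ∑ l ∈ Finset.range j, (τ * k + γ' * β * (τ * ‖d (u l)‖ ^ 2))
        ≤ T * k + γ' * β * (T * ‖d u₀‖ ^ 2 + C₁) := by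
      refine (sum_range_le_of_nonneg hj fun l => by positivity).trans ?_
      rw [Finset.sum_add_distrib, Finset.sum_const, Finset.card_range, nsmul_eq_mul,
        ← mul_assoc, ← Finset.mul_sum]
      gcongr
      -- The energy bound covers only indices from `1` on; the term of index `0` is estimated
      -- separately, using `τ ≤ T`.
      have e3 : ∑ l ∈ Finset.range n, τ * ‖d (u l)‖ ^ 2
          ≤ ∑ l ∈ Finset.range (n + 1), τ * ‖d (u l)‖ ^ 2 :=
        sum_range_le_of_nonneg (Nat.le_succ n) fun l => by positivity
      rw [Finset.sum_range_succ', hu0] at e3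
      have e4 : ∑ i ∈ Finset.range n, τ * ‖d (u (i + 1))‖ ^ 2 ≤ C₁ := by
        simpa only [mul_comm] using hC'
      rcases Nat.eq_zero_or_pos n with rfl | hn
      · simp; positivity
      have e5 : τ ≤ T := le_trans (by
        have : (1 : ℝ) ≤ n := by exact_mod_cast hn
        nlinarith) hnτ
      have e6 : τ * ‖d u₀‖ ^ 2 ≤ T * ‖d u₀‖ ^ 2 := by gcongr
      linarith
    have e7 : E 0 ≤ 1 / 2 * ‖d u₀‖ ^ 2 + γ * ‖tr u₀‖ := by
      simp only [hE, hu0, Finset.range_zero, Finset.sum_empty, add_zero]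
      gcongr
      exact (abs_le.1 (abs_inner_le_mul (hG 0 (Nat.zero_le n)) le_rfl)).2
    have e8 := (abs_le.1 (abs_inner_le_mul (hG j hj) (htr (u j)))).1
    have e9 : γ * (β * (‖ι (u j)‖ + ‖d (u j)‖))
        ≤ γ * β * (1 + C₁) + ((γ * β) ^ 2 + 1 / 4 * ‖d (u j)‖ ^ 2) := by
      have h1 : γ * β * ‖ι (u j)‖ ≤ γ * β * (1 + C₁) := by
        have := hx ‖ι (u j)‖
        have := hC j hj
        gcongr
        linarith
      have h2 : γ * β * ‖d (u j)‖ ≤ (γ * β) ^ 2 + 1 / 4 * ‖d (u j)‖ ^ 2 := by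
        nlinarith [sq_nonneg (γ * β - 1 / 2 * ‖d (u j)‖)]
      linarith
    simp only [hE] at e1 e7
    rw [hM]
    linarith
  intro j hj
  have b1 : ‖d (u j)‖ ^ 2 ≤ 4 * M := by
    have := hbd j hj
    have : 0 ≤ ∑ l ∈ Finset.range j, p l := Finset.sum_nonneg fun l _ => hp0 l
    linarith
  have b2 : ∑ l ∈ Finset.range n, p l ≤ M := by
    have := hbd n le_rfl
    have := sq_nonneg ‖d (u n)‖
    linarith
  simp only [hp, Finset.sum_add_distrib, ← Finset.mul_sum] at b2
  linarith

/-- Here `Λ'` is replaced by `ι v + ι s - F` in `⟪Λ' - Λ, Λ'⟫`, and Green's formula for the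
difference is tested with `v` and with `s`. Testing with `v` yields `τ * ‖d v‖ ^ 2`. A quarter
absorbs the boundary term, a quarter absorbs `⟪d v, d s⟫`, and the remaining half is split: one
quarter is kept for the final sum, the other is reserved for the source increment of the next step.
-/
lemma laplacian_step (htr : ∀ v, ‖tr v‖ ≤ β * (‖ι v‖ + ‖d v‖)) {τ γ' c : ℝ}
    (hβ : 0 ≤ β) (hγ' : 0 ≤ γ') (hτ : 0 < τ) {v s : V} {ΔG : B} {Λ Λ' F : L}
    (hΛ : Λ' = ι v + ι s - F)
    (hgreen : ∀ φ, -⟪Λ' - Λ, ι φ⟫_ℝ = τ * ⟪d v, d φ⟫_ℝ + ⟪ΔG, tr φ⟫_ℝ) (hG : ‖ΔG‖ ≤ τ * γ')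
    (hs : ‖ι s‖ ≤ c) (hds : ‖d s‖ ≤ c) :
    1 / 2 * ‖Λ'‖ ^ 2 + (1 / 2 * ‖Λ' - Λ‖ ^ 2 + 1 / 4 * (‖d v‖ ^ 2 * τ)) + ⟪F, Λ' - Λ⟫_ℝ
      + 1 / 4 * (‖d v‖ ^ 2 * τ)
      ≤ 1 / 2 * ‖Λ‖ ^ 2 + (τ * (2 * (γ' * β) ^ 2 + c ^ 2 + 2 * (γ' * β * c)) + ‖ι v‖ ^ 2 * τ) := by
  have h1 : ⟪Λ' - Λ, Λ'⟫_ℝ = ⟪Λ' - Λ, ι v⟫_ℝ + ⟪Λ' - Λ, ι s⟫_ℝ - ⟪F, Λ' - Λ⟫_ℝ := by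
    conv_lhs => rw [hΛ]
    rw [inner_sub_right, inner_add_right, ← hΛ, real_inner_comm F]
  rw [inner_sub_self_right] at h1
  have h2 := hgreen v
  have h3 := hgreen s
  rw [real_inner_self_eq_norm_sq] at h2
  have h4 := (abs_le.1 (abs_inner_le_mul hG (htr v))).1
  have h5 := (abs_le.1 (abs_inner_le_mul hG (htr s))).1
  have h6 := (abs_le.1 (abs_real_inner_le_norm (d v) (d s))).1
  have h7 : τ * γ' * (β * (‖ι v‖ + ‖d v‖))
      ≤ τ * (2 * (γ' * β) ^ 2 + ‖ι v‖ ^ 2 + 1 / 4 * ‖d v‖ ^ 2) := by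
    rw [mul_assoc]
    gcongr
    nlinarith [sq_nonneg (γ' * β - 1 / 2 * ‖d v‖), sq_nonneg (γ' * β - ‖ι v‖), sq_nonneg ‖ι v‖,
      sq_nonneg (γ' * β)]
  have h8 : τ * γ' * (β * (‖ι s‖ + ‖d s‖)) ≤ τ * (2 * (γ' * β * c)) := by
    calc τ * γ' * (β * (‖ι s‖ + ‖d s‖)) ≤ τ * γ' * (β * (c + c)) := by gcongr
      _ = _ := by ring
  have h9 : τ * (-⟪d v, d s⟫_ℝ) ≤ τ * (1 / 4 * ‖d v‖ ^ 2 + c ^ 2) := by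
    gcongr
    have h10 : ‖d v‖ * ‖d s‖ ≤ ‖d v‖ * c := by gcongr
    nlinarith [sq_nonneg (1 / 2 * ‖d v‖ - c)]
  linarith

/-- The estimate of Laplacians for a backward Euler scheme. -/
lemma exists_laplacian_bound (hβ : 0 ≤ β) (htr : ∀ v, ‖tr v‖ ≤ β * (‖ι v‖ + ‖d v‖))
    {T γ' c ℓ C₂ lam₀ : ℝ} (hT : 0 ≤ T) (hγ' : 0 ≤ γ') (hc : 0 ≤ c) (hC₂ : 0 ≤ C₂)
    (hlam₀ : 0 ≤ lam₀) :
    ∃ C : ℝ, 0 < C ∧ ∀ (n : ℕ) (τ : ℝ) (u s : ℕ → V) (G : ℕ → B) (Λ F : ℕ → L),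
      0 < τ → n * τ ≤ T → ‖Λ 0‖ ≤ lam₀ →
      (∀ i < n, ‖G (i + 1) - G i‖ ≤ τ * γ') → (∀ i < n, ‖ι (s i)‖ ≤ c) → (∀ i < n, ‖d (s i)‖ ≤ c) →
      (∀ i < n, ‖F i‖ ≤ c) →
      (∀ i, i + 1 < n → ‖F (i + 1) - F i‖ ≤ ℓ * τ * (1 + ‖τ⁻¹ • (ι (u (i + 1)) - ι (u i))‖
        + ‖τ⁻¹ • (d (u (i + 1)) - d (u i))‖)) →
      (∀ i ≤ n, ∀ φ, -⟪Λ i, ι φ⟫_ℝ = ⟪d (u i), d φ⟫_ℝ + ⟪G i, tr φ⟫_ℝ) →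
      (∀ i < n, Λ (i + 1) = τ⁻¹ • (ι (u (i + 1)) - ι (u i)) + ι (s i) - F i) →
      (∑ i ∈ Finset.range n, ‖τ⁻¹ • (ι (u (i + 1)) - ι (u i))‖ ^ 2 * τ ≤ C₂) →
      (∀ j ≤ n, ‖Λ j‖ ^ 2 + ∑ i ∈ Finset.range n, ‖τ⁻¹ • (d (u (i + 1)) - d (u i))‖ ^ 2 * τ
        + ∑ i ∈ Finset.range n, ‖Λ (i + 1) - Λ i‖ ^ 2 ≤ C) ∧
      ∀ i < n, ‖τ⁻¹ • (ι (u (i + 1)) - ι (u i))‖ ≤ C := by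
  set k := 2 * (γ' * β) ^ 2 + c ^ 2 + 2 * (γ' * β * c) with hk
  have hk0 : 0 ≤ k := by positivity
  set M := c ^ 2 + (1 / 2 * lam₀ ^ 2 + c * lam₀) + T * (k + 1) + 2 * C₂ with hM
  have hM0 : 0 ≤ M := by positivity
  set M' := Real.exp (8 * ℓ ^ 2 * T) * (4 * M) with hM'
  have hM'0 : 0 ≤ M' := by positivity
  refine ⟨2 * M' + 2 * c + 1, by positivity,
    fun n τ u s G Λ F hτ hnτ hΛ0 hG hs hds hF hF' hgreen hΛ hC => ?_⟩
  -- The difference quotient lives in `V` itself, so it may be used as a test function.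
  set v : ℕ → V := fun i => τ⁻¹ • (u (i + 1) - u i) with hv
  have hιv : ∀ i, τ⁻¹ • (ι (u (i + 1)) - ι (u i)) = ι (v i) := fun i => by simp [hv]
  have hdv : ∀ i, τ⁻¹ • (d (u (i + 1)) - d (u i)) = d (v i) := fun i => by simp [hv]
  simp only [hιv, hdv] at hF' hΛ hC ⊢
  have hgr : ∀ i < n, ∀ φ, -⟪Λ (i + 1) - Λ i, ι φ⟫_ℝ
      = τ * ⟪d (v i), d φ⟫_ℝ + ⟪G (i + 1) - G i, tr φ⟫_ℝ := by
    intro i hi φ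
    have h1 := hgreen i hi.le φ
    have h2 := hgreen (i + 1) hi φ
    rw [← hdv, inner_smul_left, inner_sub_left, inner_sub_left, inner_sub_left, conj_trivial,
      mul_inv_cancel_left₀ hτ.ne']
    linarith
  set p : ℕ → ℝ := fun l => 1 / 2 * ‖Λ (l + 1) - Λ l‖ ^ 2 + 1 / 4 * (‖d (v l)‖ ^ 2 * τ) with hp
  have hp0 : ∀ l, 0 ≤ p l := fun l => by positivity
  set y : ℕ → ℝ := fun i => τ * (k + 1) + ‖ι (v i)‖ ^ 2 * τ + prev (fun l => ‖ι (v l)‖ ^ 2 * τ) i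
    + 2 * ℓ ^ 2 * (τ * ‖Λ i‖ ^ 2) with hy
  -- The source pairing is summed by parts, and the `prev` term carries the reserved quarter of `τ *
  -- ‖d v‖ ^ 2` to the next step, where `hdiff` consumes it. At `i = 0` the truncated index makes
  -- the source `F 0`, so the first increment vanishes.
  set E : ℕ → ℝ := fun i => 1 / 2 * ‖Λ i‖ ^ 2 + ⟪F (i - 1), Λ i⟫_ℝ + ∑ l ∈ Finset.range i, p l
    + prev (fun l => 1 / 4 * (‖d (v l)‖ ^ 2 * τ)) i with hE
  have hdiff : ∀ i < n, ⟪F i - F (i - 1), Λ i⟫_ℝ ≤ prev (fun l => 1 / 4 * (‖d (v l)‖ ^ 2 * τ)) i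
      + prev (fun l => ‖ι (v l)‖ ^ 2 * τ) i + τ + 2 * ℓ ^ 2 * (τ * ‖Λ i‖ ^ 2) := by
    intro i hi
    cases i with
    | zero => simp [prev]; positivity
    | succ i =>
      simp only [prev, Nat.add_sub_cancel]
      refine (abs_le.1 (abs_inner_le_mul (hF' i hi) le_rfl)).2.trans ?_
      set z := ‖Λ (i + 1)‖
      have : ℓ * z * (1 + ‖ι (v i)‖ + ‖d (v i)‖)
          ≤ 1 / 4 * ‖d (v i)‖ ^ 2 + ‖ι (v i)‖ ^ 2 + 1 + 2 * ℓ ^ 2 * z ^ 2 := by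
        nlinarith only [sq_nonneg (1 / 2 * ‖d (v i)‖ - ℓ * z), sq_nonneg (‖ι (v i)‖ - 1 / 2 * (ℓ * z)),
          sq_nonneg (1 - 1 / 2 * (ℓ * z)), sq_nonneg (ℓ * z)]
      calc ℓ * τ * (1 + ‖ι (v i)‖ + ‖d (v i)‖) * z
          = τ * (ℓ * z * (1 + ‖ι (v i)‖ + ‖d (v i)‖)) := by ring
        _ ≤ τ * (1 / 4 * ‖d (v i)‖ ^ 2 + ‖ι (v i)‖ ^ 2 + 1 + 2 * ℓ ^ 2 * z ^ 2) := by gcongr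
        _ = _ := by ring
  have hstep : ∀ i < n, E (i + 1) ≤ E i + y i := by
    intro i hi
    have e1 := laplacian_step htr hβ hγ' hτ (hΛ i hi) (hgr i hi) (hG i hi) (hs i hi) (hds i hi)
    have e2 := hdiff i hi
    have e5 : ∑ l ∈ Finset.range (i + 1), p l = ∑ l ∈ Finset.range i, p l + p i :=
      Finset.sum_range_succ _ _
    have e6 : prev (fun l => 1 / 4 * (‖d (v l)‖ ^ 2 * τ)) (i + 1) = 1 / 4 * (‖d (v i)‖ ^ 2 * τ) :=
      rfl
    rw [inner_sub_left] at e2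
    rw [inner_sub_right] at e1
    simp only [hE, e5, e6, Nat.add_sub_cancel, hy]
    simp only [hp]
    linarith
  have hbd : ∀ j ≤ n, 0 < n → 1 / 4 * ‖Λ j‖ ^ 2 + ∑ l ∈ Finset.range j, p l
      ≤ M + 2 * ℓ ^ 2 * ∑ l ∈ Finset.range j, τ * ‖Λ l‖ ^ 2 := by
    intro j hj hn
    have e1 := le_of_step_sum hstep j hj
    have e2 : ∑ l ∈ Finset.range j, y l ≤ T * (k + 1) + 2 * C₂
        + 2 * ℓ ^ 2 * ∑ l ∈ Finset.range j, τ * ‖Λ l‖ ^ 2 := by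
      have h1 : ∑ l ∈ Finset.range j, ‖ι (v l)‖ ^ 2 * τ ≤ C₂ :=
        (sum_range_le_of_nonneg hj fun l => by positivity).trans hC
      have h2 := (sum_prev_le (f := fun l => ‖ι (v l)‖ ^ 2 * τ) (fun l => by positivity) j).trans h1
      have h3 : (j : ℝ) * (τ * (k + 1)) ≤ T * (k + 1) := by
        rw [← mul_assoc]
        have : (j : ℝ) * τ ≤ T := le_trans (by gcongr) hnτ
        gcongr
      simp only [hy, Finset.sum_add_distrib, Finset.sum_const, Finset.card_range, nsmul_eq_mul,
        ← Finset.mul_sum] at *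
      linarith
    have e7 : E 0 ≤ 1 / 2 * lam₀ ^ 2 + c * lam₀ := by
      simp only [hE, Finset.range_zero, Finset.sum_empty, add_zero, prev]
      have := (abs_le.1 (abs_inner_le_mul (hF 0 hn) hΛ0)).2
      have : 1 / 2 * ‖Λ 0‖ ^ 2 ≤ 1 / 2 * lam₀ ^ 2 := by gcongr
      simp only [Nat.zero_sub]
      linarith
    have e8 := (abs_le.1 (abs_inner_le_mul (hF (j - 1) (by omega)) (le_refl ‖Λ j‖))).1
    have e9 : c * ‖Λ j‖ ≤ c ^ 2 + 1 / 4 * ‖Λ j‖ ^ 2 := by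
      nlinarith [sq_nonneg (c - 1 / 2 * ‖Λ j‖)]
    have e10 : 0 ≤ prev (fun l => 1 / 4 * (‖d (v l)‖ ^ 2 * τ)) j := by
      cases j with
      | zero => exact le_rfl
      | succ j => simp only [prev]; positivity
    have e11 : 1 / 2 * ‖Λ j‖ ^ 2 + ⟪F (j - 1), Λ j⟫_ℝ + ∑ l ∈ Finset.range j, p l ≤ E j := by
      simp only [hE]; linarith
    rw [hM]
    linarith
  have hgron : ∀ j ≤ n, 0 < n →
      4 * M + 8 * ℓ ^ 2 * ∑ l ∈ Finset.range j, τ * ‖Λ l‖ ^ 2 ≤ M' := by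
    intro j hj hn
    refine (le_exp_mul_of_sum (x := fun l => ‖Λ l‖ ^ 2) (n := n) (by positivity) (by positivity)
      hτ.le (fun i hi => ?_) j hj).trans ?_
    · have h1 := hbd i hi hn
      have : 0 ≤ ∑ l ∈ Finset.range i, p l := Finset.sum_nonneg fun l _ => hp0 l
      linarith
    · rw [hM']; gcongr
  have hΛb : ∀ j ≤ n, 0 < n → ‖Λ j‖ ^ 2 ≤ M' := fun j hj hn => by
    have h1 := hbd j hj hn
    have h2 := hgron j hj hn
    have : 0 ≤ ∑ l ∈ Finset.range j, p l := Finset.sum_nonneg fun l _ => hp0 l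
    linarith
  constructor
  · intro j hj
    rcases Nat.eq_zero_or_pos n with rfl | hn
    · obtain rfl : j = 0 := by omega
      have h1 : ‖Λ 0‖ ^ 2 ≤ lam₀ ^ 2 := by gcongr
      have h2 : lam₀ ^ 2 ≤ 4 * M := by
        have : 0 ≤ c ^ 2 + c * lam₀ + T * (k + 1) + 2 * C₂ := by positivity
        have := sq_nonneg lam₀
        rw [hM]
        linarith
      have h3 : 4 * M ≤ M' := by
        rw [hM']
        exact le_mul_of_one_le_left (by positivity) (Real.one_le_exp (by positivity))
      simp only [Finset.range_zero, Finset.sum_empty, add_zero]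
      linarith
    · have h1 := hbd n le_rfl hn
      have h2 := hgron n le_rfl hn
      have h3 := hΛb j hj hn
      have h4 := sq_nonneg ‖Λ n‖
      have h5 : 0 ≤ ∑ i ∈ Finset.range n, ‖Λ (i + 1) - Λ i‖ ^ 2 :=
        Finset.sum_nonneg fun l _ => sq_nonneg _
      simp only [hp, Finset.sum_add_distrib, ← Finset.mul_sum] at h1 h2
      linarith
  · intro i hi
    -- The pointwise bound on the difference quotient is read off from the equation, all other terms
    -- being bounded.
    have h1 : ι (v i) = Λ (i + 1) - ι (s i) + F i := by rw [hΛ i hi]; abel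
    have h2 : ‖ι (v i)‖ ≤ ‖Λ (i + 1)‖ + ‖ι (s i)‖ + ‖F i‖ := by
      rw [h1]
      exact (norm_add_le _ _).trans (by gcongr; exact norm_sub_le _ _)
    have h3 := hΛb (i + 1) hi (by omega)
    have h4 := hs i hi
    have h5 := hF i hi
    have h6 : ‖Λ (i + 1)‖ ≤ 1 + ‖Λ (i + 1)‖ ^ 2 := by nlinarith only [sq_nonneg (‖Λ (i + 1)‖ - 1)]
    linarith

end Abstract

end EulerGradientLaplacian

/-! ### Consequences of the assumptions and reduction to the abstract scheme. -/

section Assumptions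

lemma exists_norm_le_of_continuousOn {X : Type*} [NormedAddCommGroup X] {z : ℝ → X} {T : ℝ}
    (hz : ContinuousOn z (Icc 0 T)) : ∃ C : ℝ, 0 ≤ C ∧ ∀ t ∈ Icc 0 T, ‖z t‖ ≤ C := by
  obtain ⟨C, hC⟩ := isCompact_Icc.exists_bound_of_continuousOn hz
  exact ⟨max C 0, le_max_right _ _, fun t ht => (hC t ht).trans (le_max_left _ _)⟩

lemma exists_lipschitz_of_contDiffOn {X : Type*} [NormedAddCommGroup X] [NormedSpace ℝ X]
    {z : ℝ → X} {T : ℝ} (hT : 0 < T) (hz : ContDiffOn ℝ 1 z (Icc 0 T)) :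
    ∃ C : ℝ, 0 ≤ C ∧ ∀ s ∈ Icc 0 T, ∀ t ∈ Icc 0 T, ‖z t - z s‖ ≤ C * |t - s| := by
  obtain ⟨C, hC0, hC⟩ := exists_norm_le_of_continuousOn
    (hz.continuousOn_derivWithin (uniqueDiffOn_Icc hT) le_rfl)
  exact ⟨C, hC0, fun s hs t ht => (convex_Icc 0 T).norm_image_sub_le_of_norm_derivWithin_le
    (hz.differentiableOn one_ne_zero) hC hs ht⟩

lemma mul_div_mem_Icc {T : ℝ} (hT : 0 < T) {n i : ℕ} (hn : 0 < n) (hi : i ≤ n) :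
    (i : ℝ) * (T / n) ∈ Icc 0 T := by
  have hn' : (0 : ℝ) < n := by exact_mod_cast hn
  refine ⟨by positivity, ?_⟩
  rw [mul_div_assoc', div_le_iff₀ hn', mul_comm]
  gcongr

variable {N : ℕ} {Ω : Set (Eucl N)} {T κ : ℝ} {f : Eucl N → ℝ → ℝ → Eucl N → ℝ}
  {g : ℝ → L2Bdry Ω} {h : ℝ → L2 Ω} {u₀ : H1 Ω} {m : ℝ → ℝ}

/-- The standing assumptions on the data. -/
structure RotheAssumptions (Ω : Set (Eucl N)) (T : ℝ) (f : Eucl N → ℝ → ℝ → Eucl N → ℝ)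
    (g : ℝ → L2Bdry Ω) (h : ℝ → L2 Ω) (m : ℝ → ℝ) (κ : ℝ) : Prop where
  one_le : 1 ≤ N
  domain : IsLipschitzDomain Ω
  pos : 0 < T
  measurable_source : ∀ t ∈ Icc 0 T,
    Measurable fun q : Eucl N × ℝ × Eucl N => f q.1 t q.2.1 q.2.2
  bounded_source : ∃ M : ℝ, ∀ x ∈ Ω, ∀ t ∈ Icc 0 T, ∀ (r : ℝ) (p : Eucl N), |f x t r p| ≤ M
  continuous_flux : ContinuousOn g (Icc 0 T)
  continuous_kernel : ContinuousOn h (Icc 0 T)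
  lower_pos : 0 < κ
  lower : ∀ t ∈ Icc 0 T, κ ≤ |∫ x in Ω, h t x|
  measurement : ContDiffOn ℝ 1 m (Icc 0 T)

open Classical in
/-- The superposition `x ↦ f(x, t, u(x), ∇u(x))` as an element of `L²(Ω)`. -/
def superposLp (f : Eucl N → ℝ → ℝ → Eucl N → ℝ) (t : ℝ) (u : H1 Ω) : L2 Ω :=
  if hf : MemLp (superpos f t u) 2 (volume.restrict Ω) then hf.toLp _ else 0

lemma RotheAssumptions.exists_ae_bound (A : RotheAssumptions Ω T f g h m κ) :
    ∃ M : ℝ, 0 ≤ M ∧ ∀ t ∈ Icc 0 T, ∀ u : H1 Ω,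
      ∀ᵐ x ∂(volume.restrict Ω), ‖superpos f t u x‖ ≤ M := by
  obtain ⟨M, hM⟩ := A.bounded_source
  refine ⟨|M|, abs_nonneg M, fun t ht u => ?_⟩
  exact (ae_restrict_iff' A.domain.isOpen.measurableSet).2
    (Eventually.of_forall fun x hx => (hM x hx t ht _ _).trans (le_abs_self M))

lemma RotheAssumptions.memLp_superpos (A : RotheAssumptions Ω T f g h m κ) {t : ℝ}
    (ht : t ∈ Icc 0 T) (u : H1 Ω) : MemLp (superpos f t u) 2 (volume.restrict Ω) := by
  have := A.domain.isFiniteMeasure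
  obtain ⟨M, -, hM⟩ := A.exists_ae_bound
  refine MemLp.of_bound ?_ M (hM t ht u)
  have h1 : AEMeasurable (fun x => (x, u.fn x, u.grad x)) (volume.restrict Ω) :=
    aemeasurable_id.prodMk ((Lp.aestronglyMeasurable u.fn).aemeasurable.prodMk
      (Lp.aestronglyMeasurable u.grad).aemeasurable)
  exact ((A.measurable_source t ht).comp_aemeasurable h1).aestronglyMeasurable

lemma RotheAssumptions.superposLp_ae (A : RotheAssumptions Ω T f g h m κ) {t : ℝ}
    (ht : t ∈ Icc 0 T) (u : H1 Ω) : superposLp f t u =ᵐ[volume.restrict Ω] superpos f t u := by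
  rw [superposLp, dif_pos (A.memLp_superpos ht u)]
  exact MemLp.coeFn_toLp _

lemma RotheAssumptions.exists_norm_superposLp_le (A : RotheAssumptions Ω T f g h m κ) :
    ∃ C : ℝ, 0 ≤ C ∧ ∀ t ∈ Icc 0 T, ∀ u : H1 Ω, ‖superposLp f t u‖ ≤ C := by
  have := A.domain.isFiniteMeasure
  obtain ⟨M, hM0, hM⟩ := A.exists_ae_bound
  refine ⟨_, by positivity, fun t ht u => Lp.norm_le_of_ae_bound (C := M) hM0 ?_⟩
  filter_upwards [A.superposLp_ae ht u, hM t ht u] with x h1 h2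
  rwa [h1]

lemma RotheAssumptions.integral_superpos_mul (A : RotheAssumptions Ω T f g h m κ) {t : ℝ}
    (ht : t ∈ Icc 0 T) (u : H1 Ω) (v : L2 Ω) :
    ∫ x in Ω, superpos f t u x * v x = ⟪superposLp f t u, v⟫_ℝ := by
  rw [superposLp, dif_pos (A.memLp_superpos ht u), inner_toLp_left]
  simp [mul_comm]

/-- The constant function `1` in `L²` of a finite measure. -/
def oneLp {α : Type*} [MeasurableSpace α] (μ : Measure α) [IsFiniteMeasure μ] : Lp ℝ 2 μ :=
  (memLp_const (1 : ℝ)).toLp (fun _ => (1 : ℝ))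

lemma inner_oneLp {α : Type*} [MeasurableSpace α] {μ : Measure α} [IsFiniteMeasure μ]
    (v : Lp ℝ 2 μ) : ⟪oneLp μ, v⟫_ℝ = ∫ x, v x ∂μ := by
  rw [oneLp, inner_toLp_left]
  simp

lemma RotheAssumptions.integral_superpos (A : RotheAssumptions Ω T f g h m κ) {t : ℝ}
    (ht : t ∈ Icc 0 T) (u : H1 Ω) :
    ∫ x in Ω, superpos f t u x = ∫ x in Ω, superposLp f t u x :=
  (integral_congr_ae (A.superposLp_ae ht u)).symm

lemma exists_abs_integral_le {α : Type*} [MeasurableSpace α] (μ : Measure α) [IsFiniteMeasure μ] :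
    ∃ C : ℝ, 0 ≤ C ∧ ∀ v : Lp ℝ 2 μ, |∫ x, v x ∂μ| ≤ C * ‖v‖ :=
  ⟨‖oneLp μ‖, norm_nonneg _, fun v => by
    rw [← inner_oneLp]; exact abs_real_inner_le_norm _ _⟩

lemma integral_Lp_sub {α : Type*} [MeasurableSpace α] {μ : Measure α} [IsFiniteMeasure μ]
    (v w : Lp ℝ 2 μ) : ∫ x, (v - w) x ∂μ = (∫ x, v x ∂μ) - ∫ x, w x ∂μ := by
  rw [← inner_oneLp, ← inner_oneLp, ← inner_oneLp, inner_sub_right]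

/-- Both superpositions are compared at the same point `x`, so the spatial increment vanishes and
the pointwise bound is an `L²` function whose norm is estimated termwise; `e` is the constant `1`.
-/
lemma RotheAssumptions.exists_lipschitz_superposLp (A : RotheAssumptions Ω T f g h m κ)
    (hL : LipschitzInAll Ω T f) :
    ∃ C : ℝ, 0 ≤ C ∧ ∀ s ∈ Icc 0 T, ∀ t ∈ Icc 0 T, ∀ u v : H1 Ω,
      ‖superposLp f t u - superposLp f s v‖
        ≤ C * (|t - s| + ‖u.fn - v.fn‖ + ‖u.grad - v.grad‖) := by
  have := A.domain.isFiniteMeasure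
  obtain ⟨L, hL⟩ := hL
  set e : L2 Ω := oneLp (volume.restrict Ω) with he
  refine ⟨|L| * (‖e‖ + 1), by positivity, fun s hs t ht u v => ?_⟩
  have m1 : MemLp (fun x => ‖(u.fn - v.fn) x‖) 2 (volume.restrict Ω) := (Lp.memLp _).norm
  have m2 : MemLp (fun x => ‖(u.grad - v.grad) x‖) 2 (volume.restrict Ω) := (Lp.memLp _).norm
  have n1 : ‖m1.toLp _‖ = ‖u.fn - v.fn‖ := by
    rw [Lp.norm_toLp, eLpNorm_norm, Lp.norm_def]
  have n2 : ‖m2.toLp _‖ = ‖u.grad - v.grad‖ := by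
    rw [Lp.norm_toLp, eLpNorm_norm, Lp.norm_def]
  set q : L2 Ω := |L| • (|t - s| • e + m1.toLp _ + m2.toLp _) with hq
  have hle : ‖superposLp f t u - superposLp f s v‖ ≤ ‖q‖ := by
    refine Lp.norm_le_norm_of_ae_le ?_
    have hΩm := A.domain.isOpen.measurableSet
    filter_upwards [A.superposLp_ae ht u, A.superposLp_ae hs v,
      Lp.coeFn_sub (superposLp f t u) (superposLp f s v), Lp.coeFn_sub u.fn v.fn,
      Lp.coeFn_sub u.grad v.grad, Lp.coeFn_smul |L| (|t - s| • e + m1.toLp _ + m2.toLp _),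
      Lp.coeFn_add (|t - s| • e + m1.toLp _) (m2.toLp _), Lp.coeFn_add (|t - s| • e) (m1.toLp _),
      Lp.coeFn_smul |t - s| e, m1.coeFn_toLp, m2.coeFn_toLp,
      (memLp_const (μ := volume.restrict Ω) (p := 2) (1 : ℝ)).coeFn_toLp,
      ae_restrict_mem hΩm] with x h1 h2 h3 h4 h5 h6 h7 h8 h9 h10 h11 h12 hx
    have h12' : e x = 1 := h12
    rw [h3, Pi.sub_apply, h1, h2, h6, Pi.smul_apply, h7, Pi.add_apply, h8, Pi.add_apply, h9,
      Pi.smul_apply, h10, h11, h12', h4, h5, Pi.sub_apply, Pi.sub_apply, smul_eq_mul, smul_eq_mul,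
      mul_one, Real.norm_eq_abs, Real.norm_eq_abs]
    refine le_trans ?_ (le_abs_self _)
    refine (hL x hx x hx t ht s hs (u.fn x) (v.fn x) (u.grad x) (v.grad x)).trans ?_
    rw [sub_self, norm_zero, zero_add]
    gcongr
    · exact le_abs_self L
    · exact (Real.norm_eq_abs _).ge
  refine hle.trans ?_
  rw [hq, norm_smul, Real.norm_eq_abs, abs_abs, mul_assoc]
  gcongr
  have h1 := norm_add₃_le (a := |t - s| • e) (b := m1.toLp _) (c := m2.toLp _)
  rw [n1, n2, norm_smul, Real.norm_eq_abs, abs_abs] at h1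
  refine h1.trans ?_
  have a1 := abs_nonneg (t - s)
  have a2 := norm_nonneg (u.fn - v.fn)
  have a3 := norm_nonneg (u.grad - v.grad)
  have a4 := norm_nonneg e
  nlinarith [mul_nonneg a4 a2, mul_nonneg a4 a3]

lemma RotheAssumptions.exists_trace (A : RotheAssumptions Ω T f g h m κ) :
    ∃ (tr : H1 Ω →L[ℝ] L2Bdry Ω) (β : ℝ), 0 ≤ β ∧ (∀ u w, HasTrace u w ↔ w = tr u) ∧
      ∀ v, ‖tr v‖ ≤ β * (‖v.fn‖ + ‖v.grad‖) := by
  obtain ⟨tr, htr⟩ := exists_trace_operator A.one_le A.domain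
  refine ⟨tr, ‖tr‖, tr.opNorm_nonneg, htr, fun v => (tr.le_opNorm v).trans ?_⟩
  gcongr
  refine abs_le_of_sq_le_sq' ?_ (by positivity) |>.2
  rw [H1.norm_sq_eq]
  nlinarith [mul_nonneg (norm_nonneg v.fn) (norm_nonneg v.grad)]

/-- The memory term of the `(i+1)`-st Rothe step together with the unknown source `K_{i+1} h`. -/
def memoryTerm (h : ℝ → L2 Ω) (τ : ℝ) (K : ℕ → ℝ) (u : ℕ → H1 Ω) (i : ℕ) : L2 Ω :=
  K (i + 1) • h ((i + 1 : ℕ) * τ) + ∑ k ∈ Finset.Icc 1 (i + 1), (K k * τ) • (u (i + 1 - k)).fn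

/-- The measured equation of the `(i+1)`-st Rothe step. -/
def MeasuredEq (T : ℝ) (f : Eucl N → ℝ → ℝ → Eucl N → ℝ) (g : ℝ → L2Bdry Ω) (h : ℝ → L2 Ω)
    (m : ℝ → ℝ) (τ : ℝ) (K : ℕ → ℝ) (u : ℕ → H1 Ω) (i : ℕ) : Prop :=
  K (i + 1) * ((∫ x in Ω, h ((i + 1 : ℕ) * τ) x) + m 0 * τ)
    = (∫ x in Ω, superposLp f (i * τ) (u i) x) - derivWithin m (Icc 0 T) ((i + 1 : ℕ) * τ)
      - (∫ x, g ((i + 1 : ℕ) * τ) x ∂(surfaceMeasure Ω))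
      - ∑ l ∈ Finset.range i, K (l + 1) * m ((i - l : ℕ) * τ) * τ

/-- Steps are reindexed by `i + 1`, the last summand of the convolution, `K (i + 1) * m 0 * τ`,
joins the leading coefficient, the weak equation is multiplied by `τ`, and traces become values of
`tr`. -/
lemma RotheAssumptions.isRotheIterate_iff (A : RotheAssumptions Ω T f g h m κ)
    {tr : H1 Ω →L[ℝ] L2Bdry Ω} (htr : ∀ u w, HasTrace u w ↔ w = tr u) {n : ℕ} (hn : 0 < n)
    {τ : ℝ} {K : ℕ → ℝ} {u : ℕ → H1 Ω} :
    IsRotheIterate T f g h u₀ m n τ K u ↔ τ = T / n ∧ u 0 = u₀ ∧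
      (∀ i < n, MeasuredEq T f g h m τ K u i) ∧
      ∀ i < n, IsEulerStep H1.fnL.toLinearMap H1.gradL.toLinearMap tr.toLinearMap τ (u i)
        (u (i + 1)) (g ((i + 1 : ℕ) * τ)) (superposLp f (i * τ) (u i) - memoryTerm h τ K u i) := by
  have hmeas : τ = T / n → ∀ i < n, ((derivWithin m (Icc 0 T) ((i + 1 : ℕ) * τ)
        + (∫ x, g ((i + 1 : ℕ) * τ) x ∂(surfaceMeasure Ω))
        + K (i + 1) * (∫ x in Ω, h ((i + 1 : ℕ) * τ) x)
        + ∑ k ∈ Finset.Icc 1 (i + 1), K k * m (((i + 1 - k : ℕ) : ℝ) * τ) * τ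
      = ∫ x in Ω, superpos f (((i + 1 - 1 : ℕ) : ℝ) * τ) (u (i + 1 - 1)) x) ↔
      MeasuredEq T f g h m τ K u i) := by
    intro hτ i hi
    have ht : (i : ℝ) * τ ∈ Icc 0 T := hτ ▸ mul_div_mem_Icc A.pos hn hi.le
    rw [MeasuredEq, Nat.add_sub_cancel, A.integral_superpos ht, sum_Icc_one,
      Finset.sum_range_succ]
    simp only [Nat.add_sub_add_right, Nat.sub_self, Nat.cast_zero, zero_mul]
    constructor <;> intro hh <;> linarith
  have hweak : τ = T / n → ∀ i < n, ((∀ (φ : H1 Ω) (w : L2Bdry Ω), HasTrace φ w →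
      ⟪(bdiff τ u (i + 1)).fn, φ.fn⟫_ℝ + ⟪(u (i + 1)).grad, φ.grad⟫_ℝ
        + ⟪g ((i + 1 : ℕ) * τ), w⟫_ℝ + K (i + 1) * ⟪h ((i + 1 : ℕ) * τ), φ.fn⟫_ℝ
        + ⟪∑ k ∈ Finset.Icc 1 (i + 1), (K k * τ) • (u (i + 1 - k)).fn, φ.fn⟫_ℝ
      = ∫ x in Ω, superpos f (((i + 1 - 1 : ℕ) : ℝ) * τ) (u (i + 1 - 1)) x * φ.fn x) ↔
      IsEulerStep H1.fnL.toLinearMap H1.gradL.toLinearMap tr.toLinearMap τ (u i)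
        (u (i + 1)) (g ((i + 1 : ℕ) * τ))
        (superposLp f (i * τ) (u i) - memoryTerm h τ K u i)) := by
    intro hτ i hi
    have ht : (i : ℝ) * τ ∈ Icc 0 T := hτ ▸ mul_div_mem_Icc A.pos hn hi.le
    have hτ0 : τ ≠ 0 := by
      rw [hτ]; exact div_ne_zero A.pos.ne' (by exact_mod_cast hn.ne')
    refine forall_congr' fun φ => ?_
    simp only [htr, forall_eq, Nat.add_sub_cancel]
    rw [A.integral_superpos_mul ht, memoryTerm, bdiff, Nat.add_sub_cancel, H1.fn_smul, H1.fn_sub,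
      inner_smul_left, inner_sub_left (superposLp f (i * τ) (u i)), inner_add_left, inner_smul_left,
      conj_trivial, conj_trivial]
    simp only [ContinuousLinearMap.coe_coe, H1.fnL_apply, H1.gradL_apply]
    constructor
    · intro hh
      have := congrArg (fun z => τ * z) hh
      simp only [mul_add, mul_inv_cancel_left₀ hτ0] at this
      linarith
    · intro hh
      refine mul_left_cancel₀ hτ0 ?_
      simp only [mul_add, mul_inv_cancel_left₀ hτ0]
      linarith
  have hidx : ∀ P : ℕ → Prop, (∀ i ∈ Finset.Icc 1 n, P i) ↔ ∀ i < n, P (i + 1) := by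
    intro P
    constructor
    · intro hP i hi
      exact hP _ (Finset.mem_Icc.2 ⟨by omega, by omega⟩)
    · intro hP i hi
      obtain ⟨h1, h2⟩ := Finset.mem_Icc.1 hi
      obtain ⟨j, rfl⟩ := Nat.exists_eq_add_of_le' h1
      exact hP j (by omega)
  constructor
  · intro H
    refine ⟨H.step, H.init, fun i hi => ?_, fun i hi => ?_⟩
    · exact (hmeas H.step i hi).1 ((hidx _).1 H.measured i hi)
    · exact (hweak H.step i hi).1 ((hidx _).1 H.weak i hi)
  · rintro ⟨hτ, h0, h1, h2⟩
    exact ⟨hτ, h0, (hidx _).2 fun i hi => (hmeas hτ i hi).2 (h1 i hi),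
      (hidx _).2 fun i hi => (hweak hτ i hi).2 (h2 i hi)⟩

end Assumptions

/-! ### Estimates of the kernel values and of the iterates. -/

section Estimates

variable {N : ℕ} {Ω : Set (Eucl N)} {T κ : ℝ} {f : Eucl N → ℝ → ℝ → Eucl N → ℝ}
  {g : ℝ → L2Bdry Ω} {h : ℝ → L2 Ω} {u₀ : H1 Ω} {m : ℝ → ℝ}

/-- The steps below this bound are admissible. -/
def stepBound (κ : ℝ) (m : ℝ → ℝ) : ℝ := κ / (2 * (|m 0| + 1))

lemma stepBound_pos (hκ : 0 < κ) : 0 < stepBound κ m := by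
  rw [stepBound]; positivity

/-- The step restriction makes `|m 0| * τ` smaller than `κ / 2`. This is the only place where
smallness of `τ` acts. -/
lemma half_le_abs_add {a τ : ℝ} (ha : κ ≤ |a|) (hτ0 : 0 < τ)
    (hτ : τ < stepBound κ m) : κ / 2 ≤ |a + m 0 * τ| := by
  rw [stepBound, lt_div_iff₀ (by positivity)] at hτ
  have h1 : |a| - |m 0 * τ| ≤ |a + m 0 * τ| := by
    have := abs_sub_abs_le_abs_sub a (-(m 0 * τ))
    rwa [abs_neg, sub_neg_eq_add] at this
  rw [abs_mul, abs_of_pos hτ0] at h1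
  linarith

lemma RotheAssumptions.isFiniteMeasure_surface (A : RotheAssumptions Ω T f g h m κ) :
    IsFiniteMeasure (surfaceMeasure Ω) :=
  isFiniteMeasure_surfaceMeasure A.one_le A.domain

/-- The data entering the measured equations are bounded. -/
lemma RotheAssumptions.exists_measured_data_bound (A : RotheAssumptions Ω T f g h m κ) :
    ∃ C : ℝ, 0 ≤ C ∧ ∀ t ∈ Icc 0 T, ∀ s ∈ Icc 0 T, ∀ u : H1 Ω,
      |∫ x in Ω, superposLp f t u x| + |derivWithin m (Icc 0 T) s|
        + |∫ x, g s x ∂(surfaceMeasure Ω)| ≤ C := by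
  have := A.domain.isFiniteMeasure
  have := A.isFiniteMeasure_surface
  obtain ⟨cF, hcF0, hcF⟩ := A.exists_norm_superposLp_le
  obtain ⟨I, hI0, hI⟩ := exists_abs_integral_le ((volume : Measure (Eucl N)).restrict Ω)
  obtain ⟨J, hJ0, hJ⟩ := exists_abs_integral_le (surfaceMeasure Ω)
  obtain ⟨γ, hγ0, hγ⟩ := exists_norm_le_of_continuousOn A.continuous_flux
  obtain ⟨c, hc0, hc⟩ := exists_norm_le_of_continuousOn
    (A.measurement.continuousOn_derivWithin (uniqueDiffOn_Icc A.pos) le_rfl)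
  refine ⟨I * cF + c + J * γ, by positivity, fun t ht s hs u => ?_⟩
  gcongr
  · exact (hI _).trans (by gcongr; exact hcF t ht u)
  · exact hc s hs
  · exact (hJ _).trans (by gcongr; exact hγ s hs)

/-- The iterates enter the measured equation only through the bounded `f`, so the kernel satisfies a
Volterra inequality with constants independent of `u`. -/
lemma RotheAssumptions.exists_kernel_bound (A : RotheAssumptions Ω T f g h m κ) :
    ∃ C : ℝ, 0 ≤ C ∧ ∀ (n : ℕ) (τ : ℝ) (K : ℕ → ℝ) (u : ℕ → H1 Ω), 0 < n → τ < stepBound κ m →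
      τ = T / n → (∀ i < n, MeasuredEq T f g h m τ K u i) → ∀ i < n, |K (i + 1)| ≤ C := by
  obtain ⟨c, hc0, hc⟩ := A.exists_measured_data_bound
  obtain ⟨c', hc'0, hc'⟩ := exists_norm_le_of_continuousOn A.measurement.continuousOn
  obtain ⟨C, hC0, hC⟩ := exists_bound_of_memory (T := T) (half_pos A.lower_pos) hc0 hc'0
  refine ⟨C, hC0, fun n τ K u hn hτ hτn hK => ?_⟩
  have hn' : (0 : ℝ) < n := by exact_mod_cast hn
  have hτ0 : 0 < τ := by rw [hτn]; exact div_pos A.pos hn'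
  have ht : ∀ i ≤ n, (i : ℝ) * τ ∈ Icc 0 T := fun i hi => hτn ▸ mul_div_mem_Icc A.pos hn hi
  refine hC n τ (fun i => |K (i + 1)|) hτ0 (by rw [hτn]; field_simp; rfl)
    (fun i => abs_nonneg _) fun i hi => ?_
  have h1 := half_le_abs_add (A.lower _ (ht (i + 1) hi)) hτ0 hτ
  have h2 := congrArg abs (hK i hi)
  rw [abs_mul] at h2
  have h3 := hc _ (ht i hi.le) _ (ht (i + 1) hi) (u i)
  set Fi := ∫ x in Ω, superposLp f (i * τ) (u i) x
  set mi := derivWithin m (Icc 0 T) ((i + 1 : ℕ) * τ)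
  set gi := ∫ x, g ((i + 1 : ℕ) * τ) x ∂(surfaceMeasure Ω)
  have h4 : |∑ l ∈ Finset.range i, K (l + 1) * m ((i - l : ℕ) * τ) * τ|
      ≤ c' * ∑ l ∈ Finset.range i, τ * |K (l + 1)| := by
    rw [Finset.mul_sum]
    refine (Finset.abs_sum_le_sum_abs _ _).trans (Finset.sum_le_sum fun l _ => ?_)
    rw [abs_mul, abs_mul, abs_of_pos hτ0]
    have h5 := hc' _ (ht (i - l) (by omega))
    rw [Real.norm_eq_abs] at h5
    calc |K (l + 1)| * |m ((i - l : ℕ) * τ)| * τ ≤ |K (l + 1)| * c' * τ := by gcongr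
      _ = _ := by ring
  set W := ∑ l ∈ Finset.range i, K (l + 1) * m ((i - l : ℕ) * τ) * τ
  have h6 : |Fi - mi - gi - W| ≤ |Fi| + |mi| + |gi| + |W| :=
    (abs_sub _ _).trans (by gcongr; exact (abs_sub _ _).trans (by gcongr; exact abs_sub _ _))
  calc |K (i + 1)| * (κ / 2) ≤ |K (i + 1)| * |(∫ x in Ω, h ((i + 1 : ℕ) * τ) x) + m 0 * τ| := by
        gcongr
    _ = |Fi - mi - gi - W| := h2
    _ ≤ _ := by linarith

/-- Reflecting the summation index turns the convolution into a sum over the history `z 0, …, z (j -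
1)`; the current value does not occur. -/
lemma norm_memory_sum_le {X : Type*} [NormedAddCommGroup X] [NormedSpace ℝ X] {K : ℕ → ℝ}
    {z : ℕ → X} {c τ : ℝ} (hτ : 0 ≤ τ) {j : ℕ} (hK : ∀ k < j, |K (k + 1)| ≤ c) :
    ‖∑ k ∈ Finset.Icc 1 j, (K k * τ) • z (j - k)‖ ≤ c * ∑ l ∈ Finset.range j, τ * ‖z l‖ := by
  rw [← sum_Icc_one_reflect, Finset.mul_sum]
  refine (norm_sum_le _ _).trans (Finset.sum_le_sum fun k hk => ?_)
  obtain ⟨h1, h2⟩ := Finset.mem_Icc.1 hk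
  obtain ⟨k, rfl⟩ := Nat.exists_eq_add_of_le' h1
  rw [norm_smul, Real.norm_eq_abs, abs_mul, abs_of_nonneg hτ, mul_assoc]
  have := hK k (by omega)
  gcongr

lemma norm_memory_le_of_bounded {X : Type*} [NormedAddCommGroup X] [NormedSpace ℝ X] {K : ℕ → ℝ}
    {z : ℕ → X} {a : X} {c c' C τ : ℝ} (hτ : 0 ≤ τ) (hc : 0 ≤ c) (hC : 0 ≤ C) {i : ℕ}
    (hiT : (i + 1 : ℕ) * τ ≤ T) (hK : ∀ k < i + 1, |K (k + 1)| ≤ c) (ha : ‖a‖ ≤ c')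
    (hz : ∀ l < i + 1, ‖z l‖ ≤ C) :
    ‖K (i + 1) • a + ∑ k ∈ Finset.Icc 1 (i + 1), (K k * τ) • z (i + 1 - k)‖
      ≤ c * c' + c * (T * C) := by
  refine (norm_add_le _ _).trans (add_le_add ?_ ((norm_memory_sum_le hτ hK).trans ?_))
  · rw [norm_smul, Real.norm_eq_abs]
    have := hK i (Nat.lt_succ_self i)
    gcongr
  · gcongr
    calc ∑ l ∈ Finset.range (i + 1), τ * ‖z l‖ ≤ ∑ l ∈ Finset.range (i + 1), τ * C :=
          Finset.sum_le_sum fun l hl => by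
            have := hz l (Finset.mem_range.1 hl)
            gcongr
      _ = (i + 1 : ℕ) * τ * C := by simp; ring
      _ ≤ T * C := by gcongr

lemma le_one_add_of_sq_le {x C : ℝ} (h : x ^ 2 ≤ C) : x ≤ 1 + C := by
  nlinarith [sq_nonneg (x - 1)]

lemma RotheAssumptions.exists_energy_estimate (A : RotheAssumptions Ω T f g h m κ) (u₀ : H1 Ω) :
    ∃ C : ℝ, 0 < C ∧ ∀ (n : ℕ) (τ : ℝ) (K : ℕ → ℝ) (u : ℕ → H1 Ω), 0 < n → τ < stepBound κ m →
      IsRotheIterate T f g h u₀ m n τ K u → ∀ j ≤ n,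
        ‖(u j).fn‖ ^ 2 + ∑ i ∈ Finset.range n, ‖(u (i + 1)).grad‖ ^ 2 * τ
          + ∑ i ∈ Finset.range n, ‖(u (i + 1)).fn - (u i).fn‖ ^ 2 ≤ C := by
  obtain ⟨tr, β, hβ, htr, hbd⟩ := A.exists_trace
  obtain ⟨CK, hCK0, hCK⟩ := A.exists_kernel_bound
  obtain ⟨cF, hcF0, hcF⟩ := A.exists_norm_superposLp_le
  obtain ⟨γ, hγ0, hγ⟩ := exists_norm_le_of_continuousOn A.continuous_flux
  obtain ⟨ch, hch0, hch⟩ := exists_norm_le_of_continuousOn A.continuous_kernel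
  obtain ⟨C, hC0, hC⟩ := exists_energy_bound (ι := H1.fnL.toLinearMap)
    (d := H1.gradL.toLinearMap) (tr := tr.toLinearMap) hβ hbd A.pos.le hγ0
    (c := cF + CK * ch + CK) (by positivity) u₀
  refine ⟨C, hC0, fun n τ K u hn hτ hI => ?_⟩
  obtain ⟨hτn, h0, hm, he⟩ := (A.isRotheIterate_iff htr hn).1 hI
  have hn' : (0 : ℝ) < n := by exact_mod_cast hn
  have hτ0 : 0 < τ := by rw [hτn]; exact div_pos A.pos hn'
  have ht : ∀ i ≤ n, (i : ℝ) * τ ∈ Icc 0 T := fun i hi => hτn ▸ mul_div_mem_Icc A.pos hn hi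
  have hK := hCK n τ K u hn hτ hτn hm
  refine hC n τ u _ _ hτ0 (ht n le_rfl).2 h0 (fun i hi => hγ _ (ht (i + 1) hi)) (fun i hi => ?_) he
  have h1 := hcF _ (ht i hi.le) (u i)
  have h2 := norm_memory_sum_le (z := fun l => (u l).fn) hτ0.le (j := i + 1)
    (fun k hk => hK k (by omega))
  have h3 : ‖K (i + 1) • h ((i + 1 : ℕ) * τ)‖ ≤ CK * ch := by
    rw [norm_smul, Real.norm_eq_abs]
    have := hK i hi
    have := hch _ (ht (i + 1) hi)
    gcongr
  have h4 := norm_sub_le (superposLp f (i * τ) (u i)) (memoryTerm h τ K u i)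
  have h5 := norm_add_le (K (i + 1) • h ((i + 1 : ℕ) * τ))
    (∑ k ∈ Finset.Icc 1 (i + 1), (K k * τ) • (u (i + 1 - k)).fn)
  have h6 : 0 ≤ ∑ l ∈ Finset.range (i + 1), τ * ‖(u l).fn‖ :=
    Finset.sum_nonneg fun l _ => by positivity
  have h7 : 0 ≤ (cF + CK * ch) * ∑ l ∈ Finset.range (i + 1), τ * ‖(u l).fn‖ := by positivity
  rw [memoryTerm] at h4 ⊢
  simp only [ContinuousLinearMap.coe_coe, H1.fnL_apply]
  linarith

lemma RotheAssumptions.exists_gradient_estimate (A : RotheAssumptions Ω T f g h m κ) (u₀ : H1 Ω)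
    (hg : ContDiffOn ℝ 1 g (Icc 0 T)) :
    ∃ C : ℝ, 0 < C ∧ ∀ (n : ℕ) (τ : ℝ) (K : ℕ → ℝ) (u : ℕ → H1 Ω), 0 < n → τ < stepBound κ m →
      IsRotheIterate T f g h u₀ m n τ K u → ∀ j ≤ n,
        ‖(u j).grad‖ ^ 2 + ∑ i ∈ Finset.range n, ‖τ⁻¹ • ((u (i + 1)).fn - (u i).fn)‖ ^ 2 * τ
          + ∑ i ∈ Finset.range n, ‖(u (i + 1)).grad - (u i).grad‖ ^ 2 ≤ C := by
  obtain ⟨tr, β, hβ, htr, hbd⟩ := A.exists_trace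
  obtain ⟨CK, hCK0, hCK⟩ := A.exists_kernel_bound
  obtain ⟨cF, hcF0, hcF⟩ := A.exists_norm_superposLp_le
  obtain ⟨γ, hγ0, hγ⟩ := exists_norm_le_of_continuousOn A.continuous_flux
  obtain ⟨γ', hγ'0, hγ'⟩ := exists_lipschitz_of_contDiffOn A.pos hg
  obtain ⟨ch, hch0, hch⟩ := exists_norm_le_of_continuousOn A.continuous_kernel
  obtain ⟨C₁, hC₁0, hC₁⟩ := A.exists_energy_estimate u₀
  have hT := A.pos
  obtain ⟨C, hC0, hC⟩ := exists_gradient_bound (ι := H1.fnL.toLinearMap)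
    (d := H1.gradL.toLinearMap) (tr := tr.toLinearMap) hβ hbd A.pos.le hγ0 hγ'0
    (c := cF + (CK * ch + CK * (T * (1 + C₁)))) hC₁0.le u₀
  refine ⟨C, hC0, fun n τ K u hn hτ hI => ?_⟩
  have hE := hC₁ n τ K u hn hτ hI
  obtain ⟨hτn, h0, hm, he⟩ := (A.isRotheIterate_iff htr hn).1 hI
  have hn' : (0 : ℝ) < n := by exact_mod_cast hn
  have hτ0 : 0 < τ := by rw [hτn]; exact div_pos A.pos hn'
  have ht : ∀ i ≤ n, (i : ℝ) * τ ∈ Icc 0 T := fun i hi => hτn ▸ mul_div_mem_Icc A.pos hn hi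
  have hK := hCK n τ K u hn hτ hτn hm
  have s1 : 0 ≤ ∑ i ∈ Finset.range n, ‖(u (i + 1)).grad‖ ^ 2 * τ :=
    Finset.sum_nonneg fun l _ => by positivity
  have s2 : 0 ≤ ∑ i ∈ Finset.range n, ‖(u (i + 1)).fn - (u i).fn‖ ^ 2 :=
    Finset.sum_nonneg fun l _ => by positivity
  have hu : ∀ j ≤ n, ‖(u j).fn‖ ^ 2 ≤ C₁ := fun j hj => by linarith [hE j hj]
  refine hC n τ u (fun i => g (i * τ)) _ hτ0 (ht n le_rfl).2 h0 (fun i hi => hγ _ (ht i hi))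
    (fun i hi => ?_) (fun i hi => ?_) he hu ?_
  · refine (hγ' _ (ht i hi.le) _ (ht (i + 1) hi)).trans_eq ?_
    rw [← sub_mul]
    push_cast
    rw [add_sub_cancel_left, one_mul, abs_of_pos hτ0, mul_comm]
  · refine (norm_sub_le _ _).trans (add_le_add (hcF _ (ht i hi.le) (u i)) ?_)
    exact norm_memory_le_of_bounded (z := fun l => (u l).fn) hτ0.le hCK0 (by positivity)
      (ht (i + 1) hi).2 (fun k hk => hK k (by omega)) (hch _ (ht (i + 1) hi))
      (fun l hl => le_one_add_of_sq_le (hu l (by omega)))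
  · have := hE n le_rfl
    have := sq_nonneg ‖(u n).fn‖
    change ∑ i ∈ Finset.range n, ‖(u (i + 1)).grad‖ ^ 2 * τ ≤ C₁
    linarith

/-- The distributional Laplacian is Green's formula tested with functions of zero trace. -/
lemma isLaplacianWithFlux_of_green (hN : 1 ≤ N) (hΩ : IsLipschitzDomain Ω) {u : H1 Ω}
    {w : L2Bdry Ω} {Λ : L2 Ω} (hgreen : ∀ (φ : H1 Ω) (z : L2Bdry Ω), HasTrace φ z →
      -⟪Λ, φ.fn⟫_ℝ = ⟪u.grad, φ.grad⟫_ℝ + ⟪w, z⟫_ℝ) : IsLaplacianWithFlux u w Λ where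
  green := hgreen
  weak_laplacian φ hφ := by
    have h1 := hgreen _ _ (hφ.hasTrace_zero hN hΩ)
    rw [inner_zero_right, add_zero, H1.ofSmooth_fn, H1.ofSmooth_grad, real_inner_comm,
      inner_toLp_left, real_inner_comm, inner_toLp_left, neg_eq_iff_eq_neg] at h1
    simp only [real_inner_comm (∇ φ _)]
    rw [← h1]
    simp

lemma RotheAssumptions.exists_laplacian_estimate (A : RotheAssumptions Ω T f g h m κ) (u₀ : H1 Ω)
    (hg : ContDiffOn ℝ 1 g (Icc 0 T)) (hh : ContinuousInH1 T h) (hu₀ : SatisfiesNeumann u₀ (g 0))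
    (hf : LipschitzInAll Ω T f) :
    ∃ C : ℝ, 0 < C ∧ ∀ (n : ℕ) (τ : ℝ) (K : ℕ → ℝ) (u : ℕ → H1 Ω), 0 < n → τ < stepBound κ m →
      IsRotheIterate T f g h u₀ m n τ K u →
      ∃ Λ : ℕ → L2 Ω, (∀ i ≤ n, IsLaplacianWithFlux (u i) (g (i * τ)) (Λ i)) ∧
        (∀ j ≤ n, ‖Λ j‖ ^ 2
          + ∑ i ∈ Finset.range n, ‖τ⁻¹ • ((u (i + 1)).grad - (u i).grad)‖ ^ 2 * τ
          + ∑ i ∈ Finset.range n, ‖Λ (i + 1) - Λ i‖ ^ 2 ≤ C) ∧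
        ∀ i < n, ‖τ⁻¹ • ((u (i + 1)).fn - (u i).fn)‖ ≤ C := by
  obtain ⟨tr, β, hβ, htr, hbd⟩ := A.exists_trace
  obtain ⟨CK, hCK0, hCK⟩ := A.exists_kernel_bound
  obtain ⟨cF, hcF0, hcF⟩ := A.exists_norm_superposLp_le
  obtain ⟨γ', hγ'0, hγ'⟩ := exists_lipschitz_of_contDiffOn A.pos hg
  obtain ⟨H, hHc, hH⟩ := hh
  obtain ⟨cH, hcH0, hcH⟩ := exists_norm_le_of_continuousOn hHc
  obtain ⟨C₁, hC₁0, hC₁⟩ := A.exists_energy_estimate u₀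
  obtain ⟨C₂, hC₂0, hC₂⟩ := A.exists_gradient_estimate u₀ hg
  obtain ⟨ℓ, hℓ0, hℓ⟩ := A.exists_lipschitz_superposLp hf
  obtain ⟨Λ₀, hΛ₀⟩ := hu₀
  have hT := A.pos
  set c := cF + (CK * cH + CK * (T * (1 + C₁ + C₂))) with hc
  have hc0 : 0 ≤ c := by positivity
  obtain ⟨C, hC0, hC⟩ := exists_laplacian_bound (ι := H1.fnL.toLinearMap)
    (d := H1.gradL.toLinearMap) (tr := tr.toLinearMap) hβ hbd A.pos.le hγ'0 hc0 (ℓ := ℓ) hC₂0.le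
    (norm_nonneg Λ₀)
  refine ⟨C, hC0, fun n τ K u hn hτ hI => ?_⟩
  have hE := hC₁ n τ K u hn hτ hI
  have hG := hC₂ n τ K u hn hτ hI
  obtain ⟨hτn, h0, hm, he⟩ := (A.isRotheIterate_iff htr hn).1 hI
  have hn' : (0 : ℝ) < n := by exact_mod_cast hn
  have hτ0 : 0 < τ := by rw [hτn]; exact div_pos A.pos hn'
  have ht : ∀ i ≤ n, (i : ℝ) * τ ∈ Icc 0 T := fun i hi => hτn ▸ mul_div_mem_Icc A.pos hn hi
  have hK := hCK n τ K u hn hτ hτn hm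
  have hstep : ∀ i : ℕ, ((i + 1 : ℕ) : ℝ) * τ - i * τ = τ := fun i => by push_cast; ring
  have hufn : ∀ j ≤ n, ‖(u j).fn‖ ^ 2 ≤ C₁ := fun j hj => by
    have s1 : 0 ≤ ∑ i ∈ Finset.range n, ‖(u (i + 1)).grad‖ ^ 2 * τ :=
      Finset.sum_nonneg fun l _ => by positivity
    have s2 : 0 ≤ ∑ i ∈ Finset.range n, ‖(u (i + 1)).fn - (u i).fn‖ ^ 2 :=
      Finset.sum_nonneg fun l _ => by positivity
    linarith [hE j hj]
  have s3 : 0 ≤ ∑ i ∈ Finset.range n, ‖(u (i + 1)).grad - (u i).grad‖ ^ 2 :=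
    Finset.sum_nonneg fun l _ => by positivity
  have hugr : ∀ j ≤ n, ‖(u j).grad‖ ^ 2 ≤ C₂ := fun j hj => by
    have s1 : 0 ≤ ∑ i ∈ Finset.range n, ‖τ⁻¹ • ((u (i + 1)).fn - (u i).fn)‖ ^ 2 * τ :=
      Finset.sum_nonneg fun l _ => by positivity
    linarith [hG j hj]
  -- The memory term lifted to `H¹(Ω)`, so that it can be tested in Green's formula; this is where
  -- `h` with values in `H¹(Ω)` is needed.
  let s : ℕ → H1 Ω := fun i => K (i + 1) • H ((i + 1 : ℕ) * τ)
    + ∑ k ∈ Finset.Icc 1 (i + 1), (K k * τ) • u (i + 1 - k)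
  have hsfn : ∀ i, (s i).fn = K (i + 1) • (H ((i + 1 : ℕ) * τ)).fn
      + ∑ k ∈ Finset.Icc 1 (i + 1), (K k * τ) • (u (i + 1 - k)).fn := fun i => by
    simp only [s, ← H1.fnL_apply, map_add, map_smul, map_sum]
  have hsgr : ∀ i, (s i).grad = K (i + 1) • (H ((i + 1 : ℕ) * τ)).grad
      + ∑ k ∈ Finset.Icc 1 (i + 1), (K k * τ) • (u (i + 1 - k)).grad := fun i => by
    simp only [s, ← H1.gradL_apply, map_add, map_smul, map_sum]
  have hsm : ∀ i < n, (s i).fn = memoryTerm h τ K u i := fun i hi => by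
    rw [hsfn, hH _ (ht (i + 1) hi), memoryTerm]
  have hfn_le : ∀ v : H1 Ω, ‖v.fn‖ ≤ ‖v‖ := fun v => by
    refine abs_le_of_sq_le_sq' ?_ (norm_nonneg v) |>.2
    rw [H1.norm_sq_eq]
    linarith [sq_nonneg ‖v.grad‖]
  have hgrad_le : ∀ v : H1 Ω, ‖v.grad‖ ≤ ‖v‖ := fun v => by
    refine abs_le_of_sq_le_sq' ?_ (norm_nonneg v) |>.2
    rw [H1.norm_sq_eq]
    linarith [sq_nonneg ‖v.fn‖]
  -- The Laplacian is defined by the equation: at index `0` by the compatibility of `u₀`, afterwards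
  -- by solving the Rothe step for it. Green's formula is then the weak equation.
  let Λ : ℕ → L2 Ω := fun i => Nat.casesOn i Λ₀ fun i =>
    τ⁻¹ • ((u (i + 1)).fn - (u i).fn) + (s i).fn - superposLp f (i * τ) (u i)
  have hgreen : ∀ i ≤ n, ∀ φ : H1 Ω,
      -⟪Λ i, φ.fn⟫_ℝ = ⟪(u i).grad, φ.grad⟫_ℝ + ⟪g (i * τ), tr φ⟫_ℝ := by
    intro i hi φ
    cases i with
    | zero =>
      simp only [Nat.cast_zero, zero_mul, h0]
      exact hΛ₀.green φ _ ((htr _ _).2 rfl)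
    | succ i =>
      have h1 := he i hi φ
      rw [← hsm i hi] at h1
      simp only [ContinuousLinearMap.coe_coe, H1.fnL_apply, H1.gradL_apply] at h1
      refine mul_left_cancel₀ hτ0.ne' ?_
      change τ * -⟪τ⁻¹ • ((u (i + 1)).fn - (u i).fn) + (s i).fn - superposLp f (i * τ) (u i),
        φ.fn⟫_ℝ = _
      rw [inner_sub_left (superposLp f (i * τ) (u i))] at h1
      rw [inner_sub_left, inner_add_left, inner_smul_left, conj_trivial]
      have h2 : τ * (τ⁻¹ * ⟪(u (i + 1)).fn - (u i).fn, φ.fn⟫_ℝ)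
          = ⟪(u (i + 1)).fn - (u i).fn, φ.fn⟫_ℝ := mul_inv_cancel_left₀ hτ0.ne' _
      linarith
  have hmain := hC n τ u s (fun i => g (i * τ)) Λ (fun i => superposLp f (i * τ) (u i)) hτ0
    (ht n le_rfl).2 le_rfl (fun i hi => ?_) (fun i hi => ?_) (fun i hi => ?_) (fun i hi => ?_)
    (fun i hi => ?_) hgreen (fun i hi => rfl) ?_
  · refine ⟨Λ, fun i hi => isLaplacianWithFlux_of_green A.one_le A.domain fun φ z hz => ?_, hmain⟩
    rw [(htr _ _).1 hz]
    exact hgreen i hi φ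
  · refine (hγ' _ (ht i hi.le) _ (ht (i + 1) hi)).trans_eq ?_
    rw [hstep, abs_of_pos hτ0, mul_comm]
  · change ‖(s i).fn‖ ≤ c
    rw [hsfn]
    refine (norm_memory_le_of_bounded (z := fun l => (u l).fn) hτ0.le hCK0
      (by positivity : 0 ≤ 1 + C₁ + C₂)
      (ht (i + 1) hi).2 (fun k hk => hK k (by omega)) ((hfn_le _).trans (hcH _ (ht (i + 1) hi)))
      (fun l hl => ?_)).trans (by rw [hc]; linarith)
    linarith [le_one_add_of_sq_le (hufn l (by omega))]
  · change ‖(s i).grad‖ ≤ c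
    rw [hsgr]
    refine (norm_memory_le_of_bounded (z := fun l => (u l).grad) hτ0.le hCK0
      (by positivity : 0 ≤ 1 + C₁ + C₂)
      (ht (i + 1) hi).2 (fun k hk => hK k (by omega)) ((hgrad_le _).trans (hcH _ (ht (i + 1) hi)))
      (fun l hl => ?_)).trans (by rw [hc]; linarith)
    linarith [le_one_add_of_sq_le (hugr l (by omega))]
  · refine (hcF _ (ht i hi.le) (u i)).trans ?_
    rw [hc]
    have : 0 ≤ CK * cH + CK * (T * (1 + C₁ + C₂)) := by positivity
    linarith
  · refine (hℓ _ (ht i (by omega)) _ (ht (i + 1) hi.le) (u (i + 1)) (u i)).trans_eq ?_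
    rw [hstep, abs_of_pos hτ0]
    simp only [ContinuousLinearMap.coe_coe, H1.fnL_apply, H1.gradL_apply, norm_smul, norm_inv,
      Real.norm_eq_abs, abs_of_pos hτ0]
    field_simp
  · change ∑ i ∈ Finset.range n, ‖τ⁻¹ • ((u (i + 1)).fn - (u i).fn)‖ ^ 2 * τ ≤ C₂
    linarith [hG n le_rfl, sq_nonneg ‖(u n).grad‖]

end Estimates

/-! ### Difference quotients of the kernel. -/

section KernelDifference

variable {N : ℕ} {Ω : Set (Eucl N)} {T κ : ℝ} {f : Eucl N → ℝ → ℝ → Eucl N → ℝ}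
  {g : ℝ → L2Bdry Ω} {h : ℝ → L2 Ω} {u₀ : H1 Ω} {m : ℝ → ℝ}

/-- The difference falls on `m`, not on `K`: there is one new term of order `τ`, and at most `T / τ`
terms of order `τ ^ 2`. -/
lemma abs_convolution_sub_le {K : ℕ → ℝ} {m : ℝ → ℝ} {C c ℓ τ T : ℝ} (hC : 0 ≤ C) (hℓ : 0 ≤ ℓ)
    (hτ : 0 ≤ τ) {i : ℕ} (hi : (i + 1 : ℕ) * τ ≤ T) (hK : ∀ k < i + 1, |K (k + 1)| ≤ C)
    (hm : |m 0| ≤ c) (hL : ∀ s ∈ Icc 0 T, ∀ t ∈ Icc 0 T, |m t - m s| ≤ ℓ * |t - s|) :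
    |(∑ k ∈ Finset.Icc 1 (i + 1), K k * m ((i + 1 - k : ℕ) * τ) * τ)
      - ∑ k ∈ Finset.Icc 1 i, K k * m ((i - k : ℕ) * τ) * τ| ≤ τ * (C * c + C * ℓ * T) := by
  rw [Finset.sum_Icc_succ_top (by omega), add_sub_right_comm, ← Finset.sum_sub_distrib, add_comm,
    mul_add]
  have hmem : ∀ j ≤ i + 1, (j : ℝ) * τ ∈ Icc 0 T := fun j hj =>
    ⟨by positivity, le_trans (by gcongr) hi⟩
  refine (abs_add_le _ _).trans (add_le_add ?_ ?_)
  · rw [Nat.sub_self, Nat.cast_zero, zero_mul, abs_mul, abs_mul, abs_of_nonneg hτ, mul_comm τ]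
    have := hK i (Nat.lt_succ_self i)
    gcongr
  · refine (Finset.abs_sum_le_sum_abs _ _).trans ?_
    have h1 : ∀ k ∈ Finset.Icc 1 i, |K k * m ((i + 1 - k : ℕ) * τ) * τ
        - K k * m ((i - k : ℕ) * τ) * τ| ≤ τ * (C * ℓ * τ) := fun k hk => by
      obtain ⟨hk1, hk2⟩ := Finset.mem_Icc.1 hk
      obtain ⟨k, rfl⟩ := Nat.exists_eq_add_of_le' hk1
      have h2 := hL _ (hmem (i - (k + 1)) (by omega)) _ (hmem (i + 1 - (k + 1)) (by omega))
      have h3 : ((i + 1 - (k + 1) : ℕ) : ℝ) * τ - (i - (k + 1) : ℕ) * τ = τ := by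
        rw [show i + 1 - (k + 1) = (i - (k + 1)) + 1 by omega]
        push_cast
        ring
      rw [h3, abs_of_nonneg hτ] at h2
      rw [← sub_mul, ← mul_sub, abs_mul, abs_mul, abs_of_nonneg hτ]
      have h4 := hK k (by omega)
      calc |K (k + 1)| * |m ((i + 1 - (k + 1) : ℕ) * τ) - m ((i - (k + 1) : ℕ) * τ)| * τ
          ≤ C * (ℓ * τ) * τ := by gcongr
        _ = _ := by ring
    refine (Finset.sum_le_sum h1).trans ?_
    rw [Finset.sum_const, Nat.card_Icc, nsmul_eq_mul, Nat.add_sub_cancel]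
    have h5 := (hmem i (by omega)).2
    calc (i : ℝ) * (τ * (C * ℓ * τ)) = τ * (C * ℓ * (i * τ)) := by ring
      _ ≤ _ := by gcongr

/-- Consecutive measured equations are subtracted. Every datum changes by order `τ`, except that the
source changes in proportion to the preceding increment of `u` and `∇u`; hence `prev`. The first
step and the equation for `K 0` share the same source, so nothing is contributed there. -/
lemma RotheAssumptions.exists_kernel_difference_bound (A : RotheAssumptions Ω T f g h m κ)
    (u₀ : H1 Ω) (hg : ContDiffOn ℝ 1 g (Icc 0 T)) (hh : ContDiffOn ℝ 1 h (Icc 0 T))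
    (hm : ContDiffOn ℝ 2 m (Icc 0 T)) (hf : LipschitzInAll Ω T f) :
    ∃ c : ℝ, 0 ≤ c ∧ ∀ (n : ℕ) (τ : ℝ) (K : ℕ → ℝ) (u : ℕ → H1 Ω), 0 < n → τ < stepBound κ m →
      IsRotheIterate T f g h u₀ m n τ K u → IsInitialKernel T f g h u₀ m (K 0) → ∀ i < n,
        |K (i + 1) - K i| ≤ τ * (c * (1 + prev (fun j => ‖τ⁻¹ • ((u (j + 1)).fn - (u j).fn)‖
          + ‖τ⁻¹ • ((u (j + 1)).grad - (u j).grad)‖) i)) := by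
  have := A.domain.isFiniteMeasure
  have := A.isFiniteMeasure_surface
  obtain ⟨tr, β, hβ, htr, hbd⟩ := A.exists_trace
  obtain ⟨CK, hCK0, hCK⟩ := A.exists_kernel_bound
  obtain ⟨c₀, hc₀0, hc₀⟩ := A.exists_measured_data_bound
  obtain ⟨cm, hcm0, hcm⟩ := exists_norm_le_of_continuousOn A.measurement.continuousOn
  obtain ⟨ℓm, hℓm0, hℓm⟩ := exists_lipschitz_of_contDiffOn A.pos A.measurement
  obtain ⟨ℓd, hℓd0, hℓd⟩ := exists_lipschitz_of_contDiffOn A.pos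
    (hm.derivWithin (uniqueDiffOn_Icc A.pos) (m := 1) (by norm_num))
  obtain ⟨ℓg, hℓg0, hℓg⟩ := exists_lipschitz_of_contDiffOn A.pos hg
  obtain ⟨ℓh, hℓh0, hℓh⟩ := exists_lipschitz_of_contDiffOn A.pos hh
  obtain ⟨ℓf, hℓf0, hℓf⟩ := A.exists_lipschitz_superposLp hf
  obtain ⟨I, hI0, hI⟩ := exists_abs_integral_le ((volume : Measure (Eucl N)).restrict Ω)
  obtain ⟨J, hJ0, hJ⟩ := exists_abs_integral_le (surfaceMeasure Ω)
  have hκ := A.lower_pos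
  have hT := A.pos
  set M := CK + c₀ / κ with hM
  set c := M * (I * ℓh) + (CK * cm + CK * ℓm * T) + ℓd + J * ℓg + I * ℓf with hc
  have hc0 : 0 ≤ c := by positivity
  refine ⟨c / κ, by positivity, fun n τ K u hn hτ hR hK0 i hi => ?_⟩
  obtain ⟨hτn, h0, hmeas, -⟩ := (A.isRotheIterate_iff htr hn).1 hR
  have hn' : (0 : ℝ) < n := by exact_mod_cast hn
  have hτ0 : 0 < τ := by rw [hτn]; exact div_pos A.pos hn'
  have ht : ∀ i ≤ n, (i : ℝ) * τ ∈ Icc 0 T := fun i hi => hτn ▸ mul_div_mem_Icc A.pos hn hi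
  have hK := hCK n τ K u hn hτ hτn hmeas
  have hzero : (0 : ℝ) ∈ Icc 0 T := ⟨le_rfl, hT.le⟩
  have hstep : ∀ i : ℕ, ((i + 1 : ℕ) : ℝ) * τ - i * τ = τ := fun i => by push_cast; ring
  have hKle : ∀ i ≤ n, |K i| ≤ M := by
    intro i hi
    cases i with
    | zero =>
      rw [IsInitialKernel, A.integral_superpos hzero] at hK0
      have h1 := hc₀ 0 hzero 0 hzero u₀
      have h2 : K 0 * (∫ x in Ω, h 0 x) = (∫ x in Ω, superposLp f 0 u₀ x)
          - derivWithin m (Icc 0 T) 0 - ∫ x, g 0 x ∂(surfaceMeasure Ω) := by linarith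
      have h3 : |K 0| * κ ≤ c₀ := by
        calc |K 0| * κ ≤ |K 0| * |∫ x in Ω, h 0 x| := by gcongr; exact A.lower 0 hzero
          _ = _ := by rw [← abs_mul, h2]
          _ ≤ _ := (abs_sub _ _).trans (add_le_add (abs_sub _ _) le_rfl)
          _ ≤ c₀ := h1
      have := (le_div_iff₀ hκ).2 h3
      linarith
    | succ i =>
      have : 0 ≤ c₀ / κ := by positivity
      linarith [hK i hi]
  -- With truncated subtraction the equation of `K 0` is the case `i = 0` of the measured equations,
  -- the convolution being empty.
  have heq : ∀ i ≤ n, K i * (∫ x in Ω, h (i * τ) x)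
      = (∫ x in Ω, superposLp f ((i - 1 : ℕ) * τ) (u (i - 1)) x) - derivWithin m (Icc 0 T) (i * τ)
        - (∫ x, g (i * τ) x ∂(surfaceMeasure Ω))
        - ∑ k ∈ Finset.Icc 1 i, K k * m ((i - k : ℕ) * τ) * τ := by
    intro i hi
    rw [← A.integral_superpos (ht (i - 1) (by omega))]
    rcases Nat.eq_zero_or_pos i with rfl | hi0
    · rw [IsInitialKernel] at hK0
      simp only [Nat.zero_sub, Nat.cast_zero, zero_mul, h0, Finset.Icc_eq_empty_of_lt zero_lt_one,
        Finset.sum_empty, sub_zero]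
      linarith
    · linarith [hR.measured i (Finset.mem_Icc.2 ⟨hi0, hi⟩)]
  have e1 := heq i hi.le
  have e2 := heq (i + 1) hi
  set X := prev (fun j => ‖τ⁻¹ • ((u (j + 1)).fn - (u j).fn)‖
          + ‖τ⁻¹ • ((u (j + 1)).grad - (u j).grad)‖) i with hX
  have hX0 : 0 ≤ X := by
    rw [hX]; cases i <;> simp only [prev] <;> positivity
  have b1 : |(∫ x in Ω, h ((i + 1 : ℕ) * τ) x) - ∫ x in Ω, h (i * τ) x| ≤ τ * (I * ℓh) := by
    rw [← integral_Lp_sub]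
    refine (hI _).trans ?_
    have := hℓh _ (ht i hi.le) _ (ht (i + 1) hi)
    rw [hstep, abs_of_pos hτ0] at this
    calc I * _ ≤ I * (ℓh * τ) := by gcongr
      _ = _ := by ring
  have b2 : |(∫ x, g ((i + 1 : ℕ) * τ) x ∂(surfaceMeasure Ω)) - ∫ x, g (i * τ) x ∂(surfaceMeasure Ω)|
      ≤ τ * (J * ℓg) := by
    rw [← integral_Lp_sub]
    refine (hJ _).trans ?_
    have := hℓg _ (ht i hi.le) _ (ht (i + 1) hi)
    rw [hstep, abs_of_pos hτ0] at this
    calc J * _ ≤ J * (ℓg * τ) := by gcongr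
      _ = _ := by ring
  have b3 : |derivWithin m (Icc 0 T) ((i + 1 : ℕ) * τ) - derivWithin m (Icc 0 T) (i * τ)|
      ≤ τ * ℓd := by
    have := hℓd _ (ht i hi.le) _ (ht (i + 1) hi)
    rwa [hstep, abs_of_pos hτ0, mul_comm ℓd, Real.norm_eq_abs] at this
  have b4 := abs_convolution_sub_le (K := K) (m := m) hCK0 hℓm0 hτ0.le (ht (i + 1) hi).2
    (fun k hk => hK k (by omega)) (by simpa using hcm 0 hzero) hℓm
  have b5 : |(∫ x in Ω, superposLp f ((i + 1 - 1 : ℕ) * τ) (u (i + 1 - 1)) x)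
      - ∫ x in Ω, superposLp f ((i - 1 : ℕ) * τ) (u (i - 1)) x| ≤ τ * (I * ℓf * (1 + X)) := by
    rw [Nat.add_sub_cancel]
    rcases i with _ | i
    · simp only [Nat.zero_sub, sub_self, abs_zero]
      positivity
    · rw [Nat.add_sub_cancel, ← integral_Lp_sub]
      refine (hI _).trans ?_
      have h1 := hℓf _ (ht i (by omega)) _ (ht (i + 1) hi.le) (u (i + 1)) (u i)
      rw [hstep, abs_of_pos hτ0] at h1
      have h2 : τ + ‖(u (i + 1)).fn - (u i).fn‖ + ‖(u (i + 1)).grad - (u i).grad‖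
          = τ * (1 + X) := by
        rw [hX, prev, norm_smul, norm_smul, norm_inv, Real.norm_eq_abs, abs_of_pos hτ0]
        field_simp
        ring
      rw [h2] at h1
      calc I * _ ≤ I * (ℓf * (τ * (1 + X))) := by gcongr
        _ = _ := by ring
  set a := ∫ x in Ω, h (i * τ) x
  set a' := ∫ x in Ω, h ((i + 1 : ℕ) * τ) x with ha'
  have hKi := hKle i hi.le
  have b6 : |K i * (a' - a)| ≤ τ * (M * (I * ℓh)) := by
    rw [abs_mul]
    calc |K i| * |a' - a| ≤ M * (τ * (I * ℓh)) := by gcongr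
      _ = _ := by ring
  have hlow : κ ≤ |a'| := A.lower _ (ht (i + 1) hi)
  -- The difference of the products is `(K (i + 1) - K i) * a' + K i * (a' - a)`. Dividing by `a'`
  -- alone is enough, since the term with `m 0 * τ` is already bounded within the convolution.
  have key : |K (i + 1) - K i| * κ ≤ τ * (c * (1 + X)) := by
    calc |K (i + 1) - K i| * κ ≤ |K (i + 1) - K i| * |a'| := by gcongr
      _ = |(K (i + 1) - K i) * a'| := (abs_mul _ _).symm
      _ ≤ τ * (M * (I * ℓh)) + τ * (CK * cm + CK * ℓm * T) + τ * ℓd + τ * (J * ℓg)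
          + τ * (I * ℓf * (1 + X)) := by
        rw [abs_le] at b1 b2 b3 b4 b5 b6 ⊢
        constructor <;> linarith
      _ ≤ τ * (c * (1 + X)) := by
        rw [hc]
        have : 0 ≤ τ * (M * (I * ℓh) + (CK * cm + CK * ℓm * T) + ℓd + J * ℓg) * X := by positivity
        linarith
  rw [div_mul_eq_mul_div, ← mul_div_assoc, le_div_iff₀ hκ]
  exact key

lemma RotheAssumptions.exists_kernel_difference_estimate (A : RotheAssumptions Ω T f g h m κ)
    (u₀ : H1 Ω) (hg : ContDiffOn ℝ 1 g (Icc 0 T)) (hh1 : ContinuousInH1 T h)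
    (hh : ContDiffOn ℝ 1 h (Icc 0 T)) (hu₀ : SatisfiesNeumann u₀ (g 0))
    (hm : ContDiffOn ℝ 2 m (Icc 0 T)) (hf : LipschitzInAll Ω T f) :
    ∃ C : ℝ, 0 < C ∧ ∀ (n : ℕ) (τ : ℝ) (K : ℕ → ℝ) (u : ℕ → H1 Ω), 0 < n → τ < stepBound κ m →
      IsRotheIterate T f g h u₀ m n τ K u → IsInitialKernel T f g h u₀ m (K 0) →
        ∑ i ∈ Finset.range n, |τ⁻¹ * (K (i + 1) - K i)| ^ 2 * τ ≤ C := by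
  obtain ⟨c, hc0, hc⟩ := A.exists_kernel_difference_bound u₀ hg hh hm hf
  obtain ⟨C₂, hC₂0, hC₂⟩ := A.exists_gradient_estimate u₀ hg
  obtain ⟨C₃, hC₃0, hC₃⟩ := A.exists_laplacian_estimate u₀ hg hh1 hu₀ hf
  have hT := A.pos
  refine ⟨c ^ 2 * (2 * (T + 2 * (C₂ + C₃))) + 1, by positivity, fun n τ K u hn hτ hR hK0 => ?_⟩
  have hG := hC₂ n τ K u hn hτ hR n le_rfl
  obtain ⟨Λ, -, hΛ, -⟩ := hC₃ n τ K u hn hτ hR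
  have hΛ := hΛ n le_rfl
  have hn' : (0 : ℝ) < n := by exact_mod_cast hn
  have hτ0 : 0 < τ := by rw [hR.step]; exact div_pos A.pos hn'
  set U : ℕ → ℝ := fun j => ‖τ⁻¹ • ((u (j + 1)).fn - (u j).fn)‖ with hU
  set D : ℕ → ℝ := fun j => ‖τ⁻¹ • ((u (j + 1)).grad - (u j).grad)‖ with hD
  have hU2 : ∑ i ∈ Finset.range n, U i ^ 2 * τ ≤ C₂ := by
    have : 0 ≤ ∑ i ∈ Finset.range n, ‖(u (i + 1)).grad - (u i).grad‖ ^ 2 :=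
      Finset.sum_nonneg fun l _ => by positivity
    linarith [sq_nonneg ‖(u n).grad‖]
  have hD2 : ∑ i ∈ Finset.range n, D i ^ 2 * τ ≤ C₃ := by
    have : 0 ≤ ∑ i ∈ Finset.range n, ‖Λ (i + 1) - Λ i‖ ^ 2 :=
      Finset.sum_nonneg fun l _ => by positivity
    linarith [sq_nonneg ‖Λ n‖]
  have hterm : ∀ i ∈ Finset.range n, |τ⁻¹ * (K (i + 1) - K i)| ^ 2 * τ
      ≤ c ^ 2 * (2 * (τ + prev (fun j => 2 * (U j ^ 2 * τ + D j ^ 2 * τ)) i)) := by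
    intro i hi
    have h1 := hc n τ K u hn hτ hR hK0 i (Finset.mem_range.1 hi)
    have h2 : |τ⁻¹ * (K (i + 1) - K i)| ≤ c * (1 + prev (fun j => U j + D j) i) := by
      rw [abs_mul, abs_inv, abs_of_pos hτ0, inv_mul_le_iff₀ hτ0]
      exact h1
    have h3 : prev (fun j => U j + D j) i ^ 2 * τ
        ≤ prev (fun j => 2 * (U j ^ 2 * τ + D j ^ 2 * τ)) i := by
      cases i with
      | zero => simp [prev]
      | succ i =>
        simp only [prev]
        have : 0 ≤ (U i - D i) ^ 2 * τ := by positivity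
        linarith
    calc |τ⁻¹ * (K (i + 1) - K i)| ^ 2 * τ
        ≤ (c * (1 + prev (fun j => U j + D j) i)) ^ 2 * τ := by gcongr
      _ = c ^ 2 * ((1 + prev (fun j => U j + D j) i) ^ 2 * τ) := by ring
      _ ≤ c ^ 2 * (2 * (1 + prev (fun j => U j + D j) i ^ 2) * τ) := by
        gcongr
        exact one_add_sq_le _
      _ = c ^ 2 * (2 * (τ + prev (fun j => U j + D j) i ^ 2 * τ)) := by ring
      _ ≤ _ := by gcongr
  have hprev := sum_prev_le (f := fun j => 2 * (U j ^ 2 * τ + D j ^ 2 * τ))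
    (fun i => by positivity) n
  have hsum : ∑ j ∈ Finset.range n, 2 * (U j ^ 2 * τ + D j ^ 2 * τ) ≤ 2 * (C₂ + C₃) := by
    rw [← Finset.mul_sum, Finset.sum_add_distrib]
    gcongr
  have hnτ : (n : ℝ) * τ = T := by rw [hR.step]; field_simp
  have hall := Finset.sum_le_sum hterm
  rw [← Finset.mul_sum, ← Finset.mul_sum, Finset.sum_add_distrib, Finset.sum_const,
    Finset.card_range, nsmul_eq_mul, hnτ] at hall
  have hfin : c ^ 2 * (2 * (T + ∑ i ∈ Finset.range n,
      prev (fun j => 2 * (U j ^ 2 * τ + D j ^ 2 * τ)) i)) ≤ c ^ 2 * (2 * (T + 2 * (C₂ + C₃))) := by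
    gcongr
    exact hprev.trans hsum
  linarith

end KernelDifference

/-! ### Existence of the iterates. -/

section Existence

section LaxMilgram

variable {V L D B : Type*} [NormedAddCommGroup V] [InnerProductSpace ℝ V] [CompleteSpace V]
  [NormedAddCommGroup L] [InnerProductSpace ℝ L] [NormedAddCommGroup D] [InnerProductSpace ℝ D]
  [NormedAddCommGroup B] [InnerProductSpace ℝ B]

/-- Solvability of one step of the backward Euler scheme. -/
lemma exists_isEulerStep {ι : V →L[ℝ] L} {d : V →L[ℝ] D}
    (hV : ∀ v, ‖v‖ ^ 2 = ‖ι v‖ ^ 2 + ‖d v‖ ^ 2) (tr : V →L[ℝ] B) {τ : ℝ} (hτ : 0 < τ) (u : V)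
    (G : B) (R : L) :
    ∃ u', IsEulerStep ι.toLinearMap d.toLinearMap tr.toLinearMap τ u u' G R := by
  let b : V →L[ℝ] V →L[ℝ] ℝ :=
    (innerSL ℝ).bilinearComp ι ι + τ • (innerSL ℝ).bilinearComp d d
  have hb : ∀ v w, b v w = ⟪ι v, ι w⟫_ℝ + τ * ⟪d v, d w⟫_ℝ := fun v w => rfl
  have hc : IsCoercive b := by
    -- The form weights the two parts of the `H¹` norm by `1` and `τ`, so the smaller of these is a
    -- coercivity constant.
    refine ⟨min 1 τ, by positivity, fun v => ?_⟩
    rw [hb, real_inner_self_eq_norm_sq, real_inner_self_eq_norm_sq, mul_assoc, ← sq, hV, mul_add]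
    gcongr
    · exact mul_le_of_le_one_left (sq_nonneg _) (min_le_left _ _)
    · exact min_le_right _ _
  let ℓ : V →L[ℝ] ℝ := (innerSL ℝ (ι u + τ • R)).comp ι - τ • (innerSL ℝ G).comp tr
  have hℓ : ∀ w, ℓ w = ⟪ι u + τ • R, ι w⟫_ℝ - τ * ⟪G, tr w⟫_ℝ := fun w => rfl
  refine ⟨hc.continuousLinearEquivOfBilin.symm ((InnerProductSpace.toDual ℝ V).symm ℓ),
    fun φ => ?_⟩
  have h1 := hc.continuousLinearEquivOfBilin_apply
    (hc.continuousLinearEquivOfBilin.symm ((InnerProductSpace.toDual ℝ V).symm ℓ)) φ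
  rw [ContinuousLinearEquiv.apply_symm_apply, InnerProductSpace.toDual_symm_apply, hℓ, hb,
    inner_add_left, inner_smul_left, conj_trivial] at h1
  simp only [ContinuousLinearMap.coe_coe, inner_sub_left]
  linarith

end LaxMilgram

variable {N : ℕ} {Ω : Set (Eucl N)} {T κ : ℝ} {f : Eucl N → ℝ → ℝ → Eucl N → ℝ}
  {g : ℝ → L2Bdry Ω} {h : ℝ → L2 Ω} {m : ℝ → ℝ}

lemma memoryTerm_congr {τ : ℝ} {K K' : ℕ → ℝ} {u u' : ℕ → H1 Ω} {i : ℕ}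
    (hK : ∀ k ≤ i + 1, K k = K' k) (hu : ∀ k ≤ i, u k = u' k) :
    memoryTerm h τ K u i = memoryTerm h τ K' u' i := by
  rw [memoryTerm, memoryTerm, hK _ le_rfl]
  congr 1
  refine Finset.sum_congr rfl fun k hk => ?_
  obtain ⟨h1, h2⟩ := Finset.mem_Icc.1 hk
  rw [hK k h2, hu _ (by omega)]

lemma MeasuredEq.congr {τ : ℝ} {K K' : ℕ → ℝ} {u u' : ℕ → H1 Ω} {i : ℕ}
    (hK : ∀ k ≤ i + 1, K k = K' k) (hu : ∀ k ≤ i, u k = u' k)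
    (H : MeasuredEq T f g h m τ K u i) : MeasuredEq T f g h m τ K' u' i := by
  rw [MeasuredEq, hK _ le_rfl, hu i le_rfl] at H
  rw [MeasuredEq, H]
  congr 1
  refine Finset.sum_congr rfl fun l hl => ?_
  rw [hK _ (by have := Finset.mem_range.1 hl; omega)]

lemma RotheAssumptions.exists_isRotheIterate (A : RotheAssumptions Ω T f g h m κ) (u₀ : H1 Ω)
    {n : ℕ} {τ : ℝ} (hn : 0 < n) (hτn : τ = T / n) (hτ : τ < stepBound κ m) :
    ∃ (K : ℕ → ℝ) (u : ℕ → H1 Ω), IsRotheIterate T f g h u₀ m n τ K u := by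
  obtain ⟨tr, β, hβ, htr, hbd⟩ := A.exists_trace
  have hn' : (0 : ℝ) < n := by exact_mod_cast hn
  have hτ0 : 0 < τ := by rw [hτn]; exact div_pos A.pos hn'
  have ht : ∀ i ≤ n, (i : ℝ) * τ ∈ Icc 0 T := fun i hi => hτn ▸ mul_div_mem_Icc A.pos hn hi
  have key : ∀ j ≤ n, ∃ (K : ℕ → ℝ) (u : ℕ → H1 Ω), u 0 = u₀ ∧
      (∀ i < j, MeasuredEq T f g h m τ K u i) ∧
      ∀ i < j, IsEulerStep H1.fnL.toLinearMap H1.gradL.toLinearMap tr.toLinearMap τ (u i)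
        (u (i + 1)) (g ((i + 1 : ℕ) * τ))
        (superposLp f (i * τ) (u i) - memoryTerm h τ K u i) := by
    intro j
    induction j with
    | zero => exact fun _ => ⟨fun _ => 0, fun _ => u₀, rfl, by simp, by simp⟩
    | succ j ih =>
      intro hj
      obtain ⟨K, u, h0, hM, hE⟩ := ih (by omega)
      have hne : (∫ x in Ω, h ((j + 1 : ℕ) * τ) x) + m 0 * τ ≠ 0 := by
        have h1 := half_le_abs_add (A.lower ((j + 1 : ℕ) * τ) (ht (j + 1) hj)) hτ0 hτ
        exact abs_pos.1 ((half_pos A.lower_pos).trans_le h1)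
      let K' := Function.update K (j + 1)
        (((∫ x in Ω, superposLp f (j * τ) (u j) x) - derivWithin m (Icc 0 T) ((j + 1 : ℕ) * τ)
          - (∫ x, g ((j + 1 : ℕ) * τ) x ∂(surfaceMeasure Ω))
          - ∑ l ∈ Finset.range j, K (l + 1) * m ((j - l : ℕ) * τ) * τ)
          / ((∫ x in Ω, h ((j + 1 : ℕ) * τ) x) + m 0 * τ))
      have hK' : ∀ k ≤ j, K k = K' k := fun k hk =>
        (Function.update_of_ne (by omega) _ _).symm
      -- The kernel value comes first, as it depends on `u` only through `u j`; the memory term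
      -- formed with the updated kernel is then known data for the elliptic problem.
      obtain ⟨v, hv⟩ := exists_isEulerStep (ι := H1.fnL) (d := H1.gradL) H1.norm_sq_eq tr hτ0 (u j)
        (g ((j + 1 : ℕ) * τ)) (superposLp f (j * τ) (u j) - memoryTerm h τ K' u j)
      let u' := Function.update u (j + 1) v
      have hu' : ∀ k ≤ j, u k = u' k := fun k hk =>
        (Function.update_of_ne (by omega) _ _).symm
      refine ⟨K', u', by rw [← hu' 0 (Nat.zero_le j), h0], fun i hi => ?_, fun i hi => ?_⟩
      · rcases Nat.lt_succ_iff_lt_or_eq.1 hi with hi | rfl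
        · exact (hM i hi).congr (fun k hk => hK' k (by omega)) fun k hk => hu' k (by omega)
        · rw [MeasuredEq, ← hu' i le_rfl]
          have hsum : ∑ l ∈ Finset.range i, K' (l + 1) * m ((i - l : ℕ) * τ) * τ
              = ∑ l ∈ Finset.range i, K (l + 1) * m ((i - l : ℕ) * τ) * τ :=
            Finset.sum_congr rfl fun l hl => by
              rw [hK' _ (by have := Finset.mem_range.1 hl; omega)]
          rw [hsum]
          simp only [K', Function.update_self]
          exact div_mul_cancel₀ _ hne
      · rcases Nat.lt_succ_iff_lt_or_eq.1 hi with hi | rfl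
        · rw [← hu' i (by omega), ← hu' (i + 1) (by omega),
            ← memoryTerm_congr (fun k hk => hK' k (by omega)) fun k hk => hu' k (by omega)]
          exact hE i hi
        · rw [← hu' i le_rfl, ← memoryTerm_congr (u := u) (fun k _ => rfl) hu']
          simp only [u', Function.update_self]
          exact hv
  obtain ⟨K, u, h0, hM, hE⟩ := key n le_rfl
  exact ⟨K, u, (A.isRotheIterate_iff htr hn).2 ⟨hτn, h0, hM, hE⟩⟩

end Existence

end Rothe

end

/-! ### Assembly of existence and the four estimates. -/

theorem lemma3p4 (N : ℕ) (hN : 1 ≤ N) (Ω : Set (Eucl N)) (hΩ : IsLipschitzDomain Ω)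
    (T : ℝ) (hT : 0 < T)
    (f : Eucl N → ℝ → ℝ → Eucl N → ℝ)
    (hf_meas : ∀ t ∈ Icc 0 T, Measurable fun q : Eucl N × ℝ × Eucl N => f q.1 t q.2.1 q.2.2)
    (hf_bdd : ∃ M : ℝ, ∀ x ∈ Ω, ∀ t ∈ Icc 0 T, ∀ (r : ℝ) (p : Eucl N), |f x t r p| ≤ M)
    (g : ℝ → L2Bdry Ω) (hg : ContinuousOn g (Icc 0 T))
    (h : ℝ → L2 Ω) (hh : ContinuousOn h (Icc 0 T))
    (κ : ℝ) (hκ : 0 < κ) (hhκ : ∀ t ∈ Icc 0 T, κ ≤ |∫ x in Ω, h t x|)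
    (u₀ : H1 Ω)
    (m : ℝ → ℝ) (hm : ContDiffOn ℝ 1 m (Icc 0 T)) :
    ∃ τ₀ : ℝ, 0 < τ₀ ∧
      -- the iterates exist
      (∀ (n : ℕ) (τ : ℝ), 0 < n → τ = T / n → τ < τ₀ →
        ∃ (K : ℕ → ℝ) (u : ℕ → H1 Ω), IsRotheIterate T f g h u₀ m n τ K u) ∧
      -- the basic energy estimate
      (∃ C : ℝ, 0 < C ∧ ∀ (n : ℕ) (τ : ℝ) (K : ℕ → ℝ) (u : ℕ → H1 Ω), 0 < n → τ < τ₀ →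
        IsRotheIterate T f g h u₀ m n τ K u →
        ∀ j ∈ Finset.Icc 1 n,
          ‖(u j).fn‖ ^ 2 + ∑ i ∈ Finset.Icc 1 n, ‖(u i).grad‖ ^ 2 * τ
            + ∑ i ∈ Finset.Icc 1 n, ‖(u i).fn - (u (i - 1)).fn‖ ^ 2 ≤ C) ∧
      -- the estimate of gradients and difference quotients
      (ContDiffOn ℝ 1 g (Icc 0 T) →
        ∃ C : ℝ, 0 < C ∧ ∀ (n : ℕ) (τ : ℝ) (K : ℕ → ℝ) (u : ℕ → H1 Ω), 0 < n → τ < τ₀ →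
          IsRotheIterate T f g h u₀ m n τ K u →
          ∀ j ∈ Finset.Icc 1 n,
            ‖(u j).grad‖ ^ 2 + ∑ i ∈ Finset.Icc 1 n, ‖(bdiff τ u i).fn‖ ^ 2 * τ
              + ∑ i ∈ Finset.Icc 1 n, ‖(u i).grad - (u (i - 1)).grad‖ ^ 2 ≤ C) ∧
      -- the estimate of Laplacians
      (ContDiffOn ℝ 1 g (Icc 0 T) → ContinuousInH1 T h → IsH2 u₀ → SatisfiesNeumann u₀ (g 0) →
        LipschitzInAll Ω T f →
        ∃ C : ℝ, 0 < C ∧ ∀ (n : ℕ) (τ : ℝ) (K : ℕ → ℝ) (u : ℕ → H1 Ω), 0 < n → τ < τ₀ →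
          IsRotheIterate T f g h u₀ m n τ K u →
          ∃ Δu : ℕ → L2 Ω, (∀ i ≤ n, IsLaplacianWithFlux (u i) (g (i * τ)) (Δu i)) ∧
            ∀ j ∈ Finset.Icc 1 n,
              ‖Δu j‖ ^ 2 + ∑ i ∈ Finset.Icc 1 n, ‖(bdiff τ u i).grad‖ ^ 2 * τ
                + ∑ i ∈ Finset.Icc 1 n, ‖Δu i - Δu (i - 1)‖ ^ 2 ≤ C ∧
              ‖(bdiff τ u j).fn‖ ≤ C) ∧
      -- the estimate of the difference quotients of the kernel
      (ContDiffOn ℝ 1 g (Icc 0 T) → ContinuousInH1 T h → ContDiffOn ℝ 1 h (Icc 0 T) →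
        IsH2 u₀ → SatisfiesNeumann u₀ (g 0) → ContDiffOn ℝ 2 m (Icc 0 T) →
        LipschitzInAll Ω T f →
        ∃ C : ℝ, 0 < C ∧ ∀ (n : ℕ) (τ : ℝ) (K : ℕ → ℝ) (u : ℕ → H1 Ω), 0 < n → τ < τ₀ →
          IsRotheIterate T f g h u₀ m n τ K u → IsInitialKernel T f g h u₀ m (K 0) →
          ∀ j ∈ Finset.Icc 1 n, ∑ i ∈ Finset.Icc 1 j, |bdiff τ K i| ^ 2 * τ ≤ C) := by
  have A : RotheAssumptions Ω T f g h m κ :=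
    ⟨hN, hΩ, hT, hf_meas, hf_bdd, hg, hh, hκ, hhκ, hm⟩
  refine ⟨stepBound κ m, stepBound_pos hκ,
    fun n τ hn hτn hτ => A.exists_isRotheIterate u₀ hn hτn hτ, ?_, fun hg1 => ?_,
    fun hg1 hh1 _ hu₀ hfL => ?_, fun hg1 hh1 hhC _ hu₀ hm2 hfL => ?_⟩
  · obtain ⟨C, hC0, hC⟩ := A.exists_energy_estimate u₀
    refine ⟨C, hC0, fun n τ K u hn hτ hR j hj => ?_⟩
    simp only [sum_Icc_one, Nat.add_sub_cancel]
    exact hC n τ K u hn hτ hR j (Finset.mem_Icc.1 hj).2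
  · obtain ⟨C, hC0, hC⟩ := A.exists_gradient_estimate u₀ hg1
    refine ⟨C, hC0, fun n τ K u hn hτ hR j hj => ?_⟩
    simp only [sum_Icc_one, bdiff, Nat.add_sub_cancel, H1.fn_smul, H1.fn_sub]
    exact hC n τ K u hn hτ hR j (Finset.mem_Icc.1 hj).2
  · obtain ⟨C, hC0, hC⟩ := A.exists_laplacian_estimate u₀ hg1 hh1 hu₀ hfL
    refine ⟨C, hC0, fun n τ K u hn hτ hR => ?_⟩
    obtain ⟨Λ, hΛ, hΛ1, hΛ2⟩ := hC n τ K u hn hτ hR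
    refine ⟨Λ, hΛ, fun j hj => ?_⟩
    obtain ⟨h1, h2⟩ := Finset.mem_Icc.1 hj
    constructor
    · simp only [sum_Icc_one, bdiff, Nat.add_sub_cancel, H1.grad_smul, H1.grad_sub]
      exact hΛ1 j h2
    · obtain ⟨j, rfl⟩ := Nat.exists_eq_add_of_le' h1
      simp only [bdiff, Nat.add_sub_cancel, H1.fn_smul, H1.fn_sub]
      exact hΛ2 j (by omega)
  · obtain ⟨C, hC0, hC⟩ := A.exists_kernel_difference_estimate u₀ hg1 hh1 hhC hu₀ hm2 hfL
    refine ⟨C, hC0, fun n τ K u hn hτ hR hK0 j hj => ?_⟩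
    have hτ0 : 0 < τ := by
      rw [hR.step]
      exact div_pos hT (by exact_mod_cast hn)
    simp only [sum_Icc_one, bdiff, Nat.add_sub_cancel, smul_eq_mul]
    exact (sum_range_le_of_nonneg (Finset.mem_Icc.1 hj).2 fun l => by positivity).trans
      (hC n τ K u hn hτ hR hK0)
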